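/- All logarithms are natural; $\bar u$ denotes the Boolean complement of a bit $u$. **Setting.** Let $\mathcal S=\mathcal S(1,\infty)$ be the set of finite binary words that do not contain $11$, let $\lambda=(1+\sqrt5)/2$. In the binary symmetric channel BSC($\varepsilon$) an input word or process $X$ is turned into the output $Z=X\oplus E$, where $E$ is independent of $X$ and consists of i.i.d. bits equal to $1$ with probability $\varepsilon$. The noisy constrained capacity is $$C(\mathcal S,\varepsilon)=\lim_{n\to\infty}\ \sup_{X_{-n}^0}\ \frac1{n+1}\bigl(H(Z_{-n}^0)-H(Z_{-n}^0\mid X_{-n}^0)\bigr),$$ the supremum being over all random binary words $X_{-n}^0$ of length $n+1$ (not necessarily stationary) whose words of positive probability lie in $\mathcal S$. The entropy rate of a process $Y$ is $H(Y)=\lim_n \frac1{n+1}H(Y_{-n}^0)$. For a stationary binary process $X$ with word probabilities $p$, let $\mathcal A(X)$ be the set of words of positive probability; for a word $u=u_1\cdots u_n$ and $0\le k\le n$ let $$h^k_n(u)=\sum_{j=k+1}^{n}p(u_1\cdots u_{j-1}\bar u_ju_{j+1}\cdots u_n)-(n-k)p(u),$$ and let $p_{XZ}^{k,\varepsilon}$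 be the law of the word formed by the first $k$ input symbols and the remaining output symbols. Put, with $w$ running over words of length $n$ and $v$ over bits, $$f_n^k=\sum_{w\in\mathcal A,\,wv\notin\mathcal A}h_{n+1}^k(wv),$$ $$g_n^k=-\sum_{wv\in\mathcal A}\Bigl(h_{n+1}^k(wv)\log\frac{p(wv)}{p(w)}+\frac{h^k_{n+1}(wv)p(w)-h^k_n(w)p(wv)}{p(w)}\Bigr)-\sum_{w\in\mathcal A,\,wv\notin\mathcal A}h^k_{n+1}(wv)\log\frac{h^k_{n+1}(wv)}{p(w)}-\sum_{\substack{p_{XZ}^{k,\varepsilon}(w)=\Theta(\varepsilon)\\ p_{XZ}^{k,\varepsilon}(wv)=\Theta(\varepsilon)}}h^k_{n+1}(wv)\log\frac{h^k_{n+1}(wv)}{h^k_n(w)},$$ where $\Theta(\varepsilon)$ refers to $\varepsilon\to0^+$. For first order Markov chains $X$ put $f(X)=f_2^0$ and $g(X)=g_3^0$. For $\pi\in[0,1]$ let $X_\pi$ be the stationary first order Markov chain on $\{0,1\}$ with transition matrix $\begin{bmatrix}1-\pi&\pi\\1&0\end{bmatrix}$. **Claims.** 1. Every stationary first order binary Markov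 chain $X$ with $\mathcal A(X)\subseteq\mathcal S$ has the law of $X_\pi$, where $\pi=\pi_{01}=p(01)/p(0)\in[0,1]$. 2. For $0<\pi<1$, $$f(X_\pi)=p(010)+p(001)+p(111)=\frac{\pi(2-\pi)}{1+\pi},$$ $$g(X_\pi)=\frac{2\pi-\pi^2-(2\pi-2\pi^2)\log2+(-1+3\pi-\pi^2)\log\pi+(2-6\pi+2\pi^2)\log(1-\pi)}{1+\pi},$$ the entropy rate $H(X_\pi)$ and, for every $\varepsilon\in[0,1]$, the entropy rate $H(Z_{\pi,\varepsilon})$ of the output of BSC($\varepsilon$) with input $X_\pi$ exist as limits, and as $\varepsilon\to0^+$ $$H(Z_{\pi,\varepsilon})=H(X_\pi)+\frac{\pi(2-\pi)}{1+\pi}\,\varepsilon\log(1/\varepsilon)+g(X_\pi)\,\varepsilon+O(\varepsilon^2\log\varepsilon).$$ 3. Every stationary binary process $X$ with $\mathcal A(X)\subseteq\mathcal S$ has an entropy rate, and $H(X)\le\log\lambda$; for $\pi\in[0,1]$, $H(X_\pi)=\log\lambda$ if and only if $\pi=1/\lambda^2$. 4. The limit defining $C(\mathcal S,\varepsilon)$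 exists for every $\varepsilon\in[0,1]$, $C(\mathcal S,0)=\log\lambda$, and as $\varepsilon\to0^+$ $$C(\mathcal S,\varepsilon)=\log\lambda-\frac{2\lambda+2}{4\lambda+3}\,\varepsilon\log(1/\varepsilon)+\bigl(g(X_{1/\lambda^2})-1\bigr)\varepsilon+O\bigl(\varepsilon^2\log^2(1/\varepsilon)\bigr).$$ 5. The error term cannot be improved: there is a constant $c>0$ such that for all sufficiently small $\varepsilon>0$ $$C(\mathcal S,\varepsilon)-\Bigl(\log\lambda-\frac{2\lambda+2}{4\lambda+3}\,\varepsilon\log(1/\varepsilon)+\bigl(g(X_{1/\lambda^2})-1\bigr)\varepsilon\Bigr)\ \ge\ c\,\varepsilon^2\log^2(1/\varepsilon).$$ -/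

import Mathlib

open Filter Topology Asymptotics MeasureTheory

noncomputable section

/-! ### Binary words and constraints (`true` is the symbol 1, `false` is the symbol 0) -/

/-- The constraint defined by a set `F` of forbidden words: all finite binary words that
contain no element of `F` as a contiguous subword. -/
def constraintOf (F : Set (List Bool)) : Set (List Bool) :=
  {w | ∀ u ∈ F, ¬ u <:+: w}

/-- The forbidden words of the `(d, k)`-RLL constraint: `1 0^l 1` for `0 ≤ l < d`, and
`0^(k+1)` if `k` is finite. -/
def rllForbidden (d : ℕ) (k : ℕ∞) : Set (List Bool) :=
  {u | ∃ l : ℕ, l < d ∧ u = true :: (List.replicate l false ++ [true])} ∪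
  {u | ∃ j : ℕ, k = (j : ℕ∞) ∧ u = List.replicate (j + 1) false}

/-- The `(d, k)`-RLL constraint. -/
def rll (d : ℕ) (k : ℕ∞) : Set (List Bool) := constraintOf (rllForbidden d k)

/-- The word `w` followed by the symbol `v`. -/
def extendWord {n : ℕ} (w : Fin n → Bool) (v : Bool) : Fin (n + 1) → Bool :=
  Fin.snoc (α := fun _ => Bool) w v

/-! ### Entropy (natural logarithm) -/

/-- Entropy of a distribution on a finite alphabet. -/
def entropy {α : Type*} [Fintype α] (P : α → ℝ) : ℝ :=
  -∑ a, P a * Real.log (P a)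

/-- Conditional entropy `H(Y | X)` of a joint distribution `J x y` on finite alphabets. -/
def condEntropy {α β : Type*} [Fintype α] [Fintype β] (J : α → β → ℝ) : ℝ :=
  -∑ x, ∑ y, J x y * Real.log (J x y / ∑ y', J x y')

/-! ### The binary symmetric channel -/

/-- Distribution of one noise bit: 1 with probability `ε`, 0 with probability `1 - ε`. -/
def noiseProb (ε : ℝ) (e : Bool) : ℝ := if e then ε else 1 - ε

/-- Probability that the input word `x` becomes the word `z` when its first `k` symbols are
observed without noise and each of the others passes through the binary symmetric channel with
crossover probability `ε`. For `k = 0` this is the transition probability of the channel. -/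
def transitionProb (k : ℕ) (ε : ℝ) {n : ℕ} (x z : Fin n → Bool) : ℝ :=
  ∏ i : Fin n, noiseProb (if (i : ℕ) < k then 0 else ε) (xor (x i) (z i))

/-- Law of the word that consists of the first `k` input symbols and the remaining output
symbols, when the input word has law `P`. For `k = 0` this is the law of the output word. -/
def mixedLaw (k : ℕ) (ε : ℝ) {n : ℕ} (P : (Fin n → Bool) → ℝ) (z : Fin n → Bool) : ℝ :=
  ∑ x, P x * transitionProb k ε x z

/-- Law of the output word of the channel when the input word has law `P`. -/
def outputLaw (ε : ℝ) {n : ℕ} (P : (Fin n → Bool) → ℝ) : (Fin n → Bool) → ℝ :=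
  mixedLaw 0 ε P

/-- `H(Z) - H(Z | X)` for an input word `X` of law `P` and the corresponding output word `Z`. -/
def mutualInfo (ε : ℝ) {n : ℕ} (P : (Fin n → Bool) → ℝ) : ℝ :=
  entropy (outputLaw ε P) - condEntropy (fun x z => P x * transitionProb 0 ε x z)

/-! ### Noisy constrained capacity -/

/-- The laws of (not necessarily stationary) random words of length `n` all of whose allowed
words, i.e. words of positive probability, lie in `S`. -/
def admissibleLaws (S : Set (List Bool)) (n : ℕ) : Set ((Fin n → Bool) → ℝ) :=
  {P | P ∈ stdSimplex ℝ (Fin n → Bool) ∧ ∀ w, 0 < P w → List.ofFn w ∈ S}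

/-- The supremum of `(H(Z) - H(Z | X)) / (n + 1)` over input words `X` of length `n + 1` whose
allowed words lie in `S`. -/
def blockCapacity (S : Set (List Bool)) (ε : ℝ) (n : ℕ) : ℝ :=
  sSup ((fun P => 1 / ((n : ℝ) + 1) * mutualInfo ε P) '' admissibleLaws S (n + 1))

/-- The noisy constrained capacity `C(S, ε)`. -/
def constrainedCapacity (S : Set (List Bool)) (ε : ℝ) : ℝ :=
  limUnder atTop (blockCapacity S ε)

/-! ### Stationary binary processes -/

/-- The family of word probabilities of a binary process. -/
abbrev WordLaw : Type := (n : ℕ) → (Fin n → Bool) → ℝ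

/-- The shift on binary sequences. -/
def shiftMap (x : ℕ → Bool) : ℕ → Bool := fun i => x (i + 1)

/-- `ν` is the law of a stationary binary process. -/
def IsStationaryLaw (ν : Measure (ℕ → Bool)) : Prop :=
  IsProbabilityMeasure ν ∧ MeasurePreserving shiftMap ν ν

/-- The word probabilities of the process with law `ν`. -/
def wordLaw (ν : Measure (ℕ → Bool)) : WordLaw :=
  fun n w => ν.real {x | ∀ i : Fin n, x (i : ℕ) = w i}

/-- All allowed words of the process lie in `S`. -/
def SupportedIn (p : WordLaw) (S : Set (List Bool)) : Prop :=
  ∀ (n : ℕ) (w : Fin n → Bool), 0 < p n w → List.ofFn w ∈ S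

/-- The first order Markov property of a stationary process: given the word `ua`, the next
symbol has the same conditional law as given the symbol `a` alone. -/
def IsFirstOrderMarkov (p : WordLaw) : Prop :=
  ∀ (n : ℕ) (u : Fin n → Bool) (a b : Bool),
    p (n + 2) (extendWord (extendWord u a) b) * p 1 ![a] =
      p (n + 1) (extendWord u a) * p 2 ![a, b]

/-- The transition probability from 0 to 1. -/
def prob01 (p : WordLaw) : ℝ := p 2 ![false, true] / p 1 ![false]

/-- The word probabilities of the Markov chain with initial law `μ` and transition matrix `Δ`. -/
def markovLaw (μ : Bool → ℝ) (Δ : Bool → Bool → ℝ) : WordLaw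
  | 0, _ => 1
  | (n + 1), w => μ (w 0) * ∏ i : Fin n, Δ (w i.castSucc) (w i.succ)

/-- The stationary vector of the transition matrix `[[1 - π, π], [1, 0]]`. -/
def rllStationary (π : ℝ) : Bool → ℝ
  | false => 1 / (1 + π)
  | true => π / (1 + π)

/-- The transition matrix `[[1 - π, π], [1, 0]]`. -/
def rllMatrix (π : ℝ) : Bool → Bool → ℝ
  | false, false => 1 - π
  | false, true => π
  | true, false => 1
  | true, true => 0

/-- The stationary first order Markov chain with transition matrix `[[1 - π, π], [1, 0]]`. -/
def rllChain (π : ℝ) : WordLaw := markovLaw (rllStationary π) (rllMatrix π)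

/-- The output process of the channel with input process `p`. -/
def outputProcess (ε : ℝ) (p : WordLaw) : WordLaw := fun n => outputLaw ε (p n)

/-- The normalized block entropies, with limit the entropy rate. -/
def blockEntropy (p : WordLaw) (n : ℕ) : ℝ := 1 / ((n : ℝ) + 1) * entropy (p (n + 1))

/-- The entropy rate of a process. -/
def entropyRate (p : WordLaw) : ℝ := limUnder atTop (blockEntropy p)

/-! ### The coefficients of the asymptotic expansion of the entropy rate -/

/-- The number `h(u)`: the sum of the probabilities of the words obtained from `u` by flipping
one symbol after the first `k`, minus `(n - k)` times the probability of `u`. -/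
def flipCoeff (p : WordLaw) (k : ℕ) {n : ℕ} (u : Fin n → Bool) : ℝ :=
  (∑ i : Fin n, if k ≤ (i : ℕ) then p n (Function.update u i (!(u i))) else 0)
    - ((n : ℝ) - (k : ℝ)) * p n u

open Classical in
/-- The coefficient of `ε log (1/ε)` in the expansion of the conditional entropy of the output
symbol at time 0 given the preceding `n` symbols, the first `k` of which are input symbols and
the others output symbols. -/
def fBlock (p : WordLaw) (n k : ℕ) : ℝ :=
  ∑ w : Fin n → Bool, ∑ v : Bool,
    if 0 < p n w ∧ ¬ 0 < p (n + 1) (extendWord w v)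
    then flipCoeff p k (extendWord w v) else 0

open Classical in
/-- The coefficient of `ε` in the same expansion. -/
def gBlock (p : WordLaw) (n k : ℕ) : ℝ :=
  - (∑ w : Fin n → Bool, ∑ v : Bool,
      if 0 < p (n + 1) (extendWord w v)
      then flipCoeff p k (extendWord w v) * Real.log (p (n + 1) (extendWord w v) / p n w)
        + (flipCoeff p k (extendWord w v) * p n w
            - flipCoeff p k w * p (n + 1) (extendWord w v)) / p n w
      else 0)
  - (∑ w : Fin n → Bool, ∑ v : Bool,
      if 0 < p n w ∧ ¬ 0 < p (n + 1) (extendWord w v)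
      then flipCoeff p k (extendWord w v) *
        Real.log (flipCoeff p k (extendWord w v) / p n w)
      else 0)
  - (∑ w : Fin n → Bool, ∑ v : Bool,
      if (fun ε : ℝ => mixedLaw k ε (p n) w) =Θ[𝓝[>] 0] (fun ε : ℝ => ε) ∧
          (fun ε : ℝ => mixedLaw k ε (p (n + 1)) (extendWord w v)) =Θ[𝓝[>] 0] (fun ε : ℝ => ε)
      then flipCoeff p k (extendWord w v) *
        Real.log (flipCoeff p k (extendWord w v) / flipCoeff p k w)
      else 0)

/-- The coefficient `f(X)` for a Markov chain of order `m`. -/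
def fCoeff (m : ℕ) (p : WordLaw) : ℝ := fBlock p (2 * m) 0

/-- The coefficient `g(X)` for a Markov chain of order `m`. -/
def gCoeff (m : ℕ) (p : WordLaw) : ℝ := gBlock p (3 * m) 0

end

/-! ### Sums over binary words -/

/-! Everything rests on one inequality (`gibbs`): if nonnegative weights `exp (-C)` have total mass
at most `Z`, then the entropy of a law is at most its mean of `C` plus `log Z`. Any guess of a code
for a word therefore gives an upper bound for its entropy, and a guess that is right to first order
in ε is accurate up to second order. The mean of a cost over the noisy word is expanded by
`abs_bscMean_sub_flipSum_le`: value at the input, plus ε times the sum over single flips, plus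
O(ε²).

Output of a fixed chain, upper bound: charge each output symbol, given three neighbouring symbols,
minus the logarithm of its leading-order conditional probability (`runCost`, `exp_runCost_le`,
`entropyRate_output_rllChain_le`). Lower bound: H(Z) = H(X) + nH(ε) - H(X | Z), where the binary
entropy H(ε) is that of one noise bit, and the equivocation H(X | Z) is bounded above by a decoder
that guesses each input symbol from the preceding input symbol and three output symbols
(`entropy_add_le_of_decoder`, `le_entropyRate_output_rllChain`). Both bounds have the same terms of
order ε log(1/ε) and ε, which yields the expansion of the output entropy rate.

Capacity, upper bound: mutual information is H(Z) - nH(ε), so H(Z) has to be bounded uniformly over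
all admissible inputs. The costs of the golden chain π = 1/λ² are perturbed by shifts a, a' of order
t = ε log(1/ε), chosen so that the mean cost of each of the eight admissible windows of four symbols
is, up to O(t²) and up to the increment of a potential U on three symbols, the same number V = log λ
+ a (`golden_window_le`). The potential telescopes, so every admissible input has mean cost V per
symbol up to O(t²) (`capacity_le_of_cost`, `capacity_upper_bound_aux`). The shifts spoil the
normalisation only by O(t²), because their first-order effects on the total mass cancel.

Capacity, lower bound: use the chain with π = 1/λ² + t/30. Its entropy rate loses only O(t²), since
1/λ² is a maximum, while the coefficient of ε log(1/ε) increases by an amount of order t and is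
multiplied by t. With the displacement t/30 the gain outweighs the loss, which gives both the lower
half of the expansion and the optimality of the error term (`capacity_lower_bound`).

Existence of all limits is Fekete's lemma applied to subadditive entropies. The noiseless capacity
and the bound log λ come from a Fibonacci count of the words without 11, and the coefficients f and
g are finite sums evaluated over words of lengths three and four. -/

theorem sum_words_cons {M : Type*} [AddCommMonoid M] {n : ℕ} (F : (Fin (n + 1) → Bool) → M) :
    ∑ z, F z = ∑ b, ∑ z : Fin n → Bool, F (Fin.cons b z) := by
  rw [← (Fin.consEquiv (fun _ : Fin (n + 1) => Bool)).sum_comp, Fintype.sum_prod_type]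
  rfl

theorem sum_words_snoc {M : Type*} [AddCommMonoid M] {n : ℕ} (F : (Fin (n + 1) → Bool) → M) :
    ∑ z, F z = ∑ z : Fin n → Bool, ∑ b, F (extendWord z b) := by
  rw [← (Fin.snocEquiv (fun _ : Fin (n + 1) => Bool)).sum_comp, Fintype.sum_prod_type,
    Finset.sum_comm]
  rfl

theorem sum_words_append {M : Type*} [AddCommMonoid M] {m n : ℕ} (F : (Fin (m + n) → Bool) → M) :
    ∑ z, F z = ∑ u : Fin m → Bool, ∑ v : Fin n → Bool, F (Fin.append u v) := by
  rw [← (Fin.appendEquiv m n).sum_comp, Fintype.sum_prod_type]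
  rfl

theorem sum_words_zero {M : Type*} [AddCommMonoid M] (F : (Fin 0 → Bool) → M) :
    ∑ z, F z = F Fin.elim0 := by
  rw [Fintype.sum_unique]
  exact congrArg F (Subsingleton.elim _ _)

theorem extendWord_cons {n : ℕ} (a : Bool) (w : Fin n → Bool) (b : Bool) :
    extendWord (Fin.cons a w : Fin (n + 1) → Bool) b = Fin.cons a (extendWord w b) := by
  simp only [extendWord]
  exact (Fin.cons_snoc_eq_snoc_cons (β := Bool) a w b).symm

/-! ### Entropy -/

section Entropy
variable {α β : Type*} [Fintype α] [Fintype β]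

theorem entropy_eq_sum_negMulLog (P : α → ℝ) : entropy P = ∑ a, Real.negMulLog (P a) := by
  simp [entropy, Real.negMulLog, Finset.sum_neg_distrib]

theorem entropy_comp_equiv (e : α ≃ β) (P : β → ℝ) : entropy (fun a => P (e a)) = entropy P := by
  simp only [entropy]
  rw [e.sum_comp (fun b => P b * Real.log (P b))]

/-- This is log x ≤ x - 1 at x = Q a / (P a · Z), averaged over P. The weights Q need not be
normalised; the excess mass is paid as `log Z`, so that codes satisfying Kraft's inequality only
approximately can be used. The absolute continuity `h0` matters because `Real.log 0 = 0` would make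
impossible symbols free. -/
theorem gibbs {P Q : α → ℝ} (hP : ∀ a, 0 ≤ P a) (hQ : ∀ a, 0 ≤ Q a) (h1 : ∑ a, P a = 1)
    {Z : ℝ} (hZ : ∑ a, Q a ≤ Z) (hZ0 : 0 < Z) (h0 : ∀ a, Q a = 0 → P a = 0) :
    entropy P ≤ -∑ a, P a * Real.log (Q a) + Real.log Z := by
  have key : ∀ a, P a * Real.log (Q a) - P a * Real.log (P a) - P a * Real.log Z
      ≤ Q a / Z - P a := by
    intro a
    rcases (hP a).eq_or_lt with h | h
    · rw [← h]
      simpa using div_nonneg (hQ a) hZ0.le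
    · have hq : 0 < Q a := (hQ a).lt_of_ne fun h' => h.ne' (h0 a h'.symm)
      have := Real.log_le_sub_one_of_pos (div_pos hq (mul_pos h hZ0))
      rw [Real.log_div hq.ne' (mul_pos h hZ0).ne', Real.log_mul h.ne' hZ0.ne'] at this
      have h2 := mul_le_mul_of_nonneg_left this h.le
      have h3 : P a * (Q a / (P a * Z) - 1) = Q a / Z - P a := by
        field_simp
      rw [h3] at h2
      linarith
  have hs := Finset.sum_le_sum fun a (_ : a ∈ Finset.univ) => key a
  simp only [Finset.sum_sub_distrib, ← Finset.sum_mul, ← Finset.sum_div, h1] at hs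
  have : (∑ a, Q a) / Z ≤ 1 := (div_le_one hZ0).2 hZ
  rw [entropy]
  linarith

theorem gibbs_exp {P : α → ℝ} (hP : ∀ a, 0 ≤ P a) (h1 : ∑ a, P a = 1) (C : α → ℝ)
    {Z : ℝ} (hZ : ∑ a, Real.exp (-C a) ≤ Z) (hZ0 : 0 < Z) :
    entropy P ≤ ∑ a, P a * C a + Real.log Z := by
  have := gibbs hP (fun a => (Real.exp_pos (-C a)).le) h1 hZ hZ0
    fun a h => absurd h (Real.exp_ne_zero _)
  simpa [Finset.sum_neg_distrib] using this

theorem entropy_nonneg {P : α → ℝ} (hP : ∀ a, 0 ≤ P a) (h1 : ∑ a, P a = 1) :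
    0 ≤ entropy P := by
  rw [entropy_eq_sum_negMulLog]
  refine Finset.sum_nonneg fun a _ => Real.negMulLog_nonneg (hP a) ?_
  rw [← h1]
  exact Finset.single_le_sum (fun b _ => hP b) (Finset.mem_univ a)

/-- Gibbs' inequality against the product of the two marginals. -/
theorem entropy_prod_le {J : α → β → ℝ} (hJ : ∀ a b, 0 ≤ J a b) (h1 : ∑ a, ∑ b, J a b = 1) :
    entropy (fun p : α × β => J p.1 p.2) ≤
      entropy (fun a => ∑ b, J a b) + entropy (fun b => ∑ a, J a b) := by
  have hA : ∀ a, 0 ≤ ∑ b, J a b := fun a => Finset.sum_nonneg fun b _ => hJ a b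
  have hB : ∀ b, 0 ≤ ∑ a, J a b := fun b => Finset.sum_nonneg fun a _ => hJ a b
  have hzA : ∀ a b, ∑ b, J a b = 0 → J a b = 0 := fun a b h =>
    (Finset.sum_eq_zero_iff_of_nonneg fun b _ => hJ a b).1 h b (Finset.mem_univ b)
  have hzB : ∀ a b, ∑ a, J a b = 0 → J a b = 0 := fun a b h =>
    (Finset.sum_eq_zero_iff_of_nonneg fun a _ => hJ a b).1 h a (Finset.mem_univ a)
  have h := gibbs (P := fun p : α × β => J p.1 p.2)
    (Q := fun p : α × β => (∑ b, J p.1 b) * ∑ a, J a p.2) (fun p => hJ _ _)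
    (fun p => mul_nonneg (hA _) (hB _)) (by rw [Fintype.sum_prod_type]; exact h1) (Z := 1)
    (by
      rw [Fintype.sum_prod_type]
      simp only [← Finset.mul_sum, ← Finset.sum_mul]
      rw [Finset.sum_comm (f := fun b a => J a b), h1, mul_one]) one_pos
    (fun p hp => by
      rcases mul_eq_zero.1 hp with h | h
      · exact hzA _ _ h
      · exact hzB _ _ h)
  refine h.trans_eq ?_
  have e : ∀ a b, J a b * Real.log ((∑ b, J a b) * ∑ a, J a b)
      = J a b * Real.log (∑ b, J a b) + J a b * Real.log (∑ a, J a b) := by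
    intro a b
    by_cases hz : J a b = 0
    · simp [hz]
    · rw [Real.log_mul (fun h => hz (hzA _ _ h)) (fun h => hz (hzB _ _ h)), mul_add]
  rw [Fintype.sum_prod_type]
  simp only [e, Finset.sum_add_distrib, Real.log_one, add_zero, ← Finset.sum_mul]
  rw [Finset.sum_comm (f := fun a b => J a b * Real.log (∑ a, J a b))]
  simp only [entropy, ← Finset.sum_mul]
  ring

end Entropy

theorem entropy_append_le {m n : ℕ} {P : (Fin (m + n) → Bool) → ℝ} (hP : ∀ w, 0 ≤ P w)
    (h1 : ∑ w, P w = 1) :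
    entropy P ≤ entropy (fun u : Fin m → Bool => ∑ v : Fin n → Bool, P (Fin.append u v)) +
      entropy (fun v : Fin n → Bool => ∑ u : Fin m → Bool, P (Fin.append u v)) := by
  rw [← entropy_comp_equiv (Fin.appendEquiv m n) P]
  exact entropy_prod_le (J := fun u v => P (Fin.append u v)) (fun _ _ => hP _)
    (by rw [← sum_words_append]; exact h1)

theorem entropy_words_le {n : ℕ} {P : (Fin n → Bool) → ℝ} (hP : ∀ w, 0 ≤ P w)
    (h1 : ∑ w, P w = 1) : entropy P ≤ n * Real.log 2 := by
  have := gibbs_exp hP h1 (fun _ => 0) (Z := (2 : ℝ) ^ n) (by simp) (by positivity)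
  simpa using this

/-! ### Elementary inequalities and limits -/

theorem exp_le_one_add_add_sq {y : ℝ} (hy : y ≤ 1) : Real.exp y ≤ 1 + y + y ^ 2 := by
  rcases le_or_gt (-1) y with h | h
  · have := (abs_le.1 (Real.abs_exp_sub_one_sub_id_le (abs_le.2 ⟨h, hy⟩))).2
    linarith
  · have : Real.exp y ≤ 1 := Real.exp_le_one_iff.2 (by linarith)
    nlinarith

theorem tendsto_affine_div (a b : ℝ) :
    Tendsto (fun n : ℕ => ((n : ℝ) * a + b) / ((n : ℝ) + 1)) atTop (𝓝 a) := by
  have h : Tendsto (fun n : ℕ => a + (b - a) * (1 / ((n : ℝ) + 1))) atTop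
      (𝓝 (a + (b - a) * 0)) :=
    (tendsto_one_div_add_atTop_nhds_zero_nat.const_mul _).const_add _
  rw [mul_zero, add_zero] at h
  refine h.congr fun n => ?_
  have : (n : ℝ) + 1 ≠ 0 := by positivity
  field_simp
  ring

/-- Passes from bounds for words of length n + k to rates: the constant `b` and the offset `k`
disappear after division by the length, so boundary terms never have to be tracked. -/
theorem le_of_tendsto_affine {u : ℕ → ℝ} {l a b : ℝ}
    (hu : Tendsto (fun n : ℕ => 1 / ((n : ℝ) + 1) * u (n + 1)) atTop (𝓝 l)) (k : ℕ)
    (h : ∀ n : ℕ, u (n + k) ≤ n * a + b) : l ≤ a := by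
  refine le_of_tendsto_of_tendsto' (hu.comp (tendsto_add_atTop_nat k))
    ((tendsto_affine_div a (b + (1 - k) * a)).comp (tendsto_add_atTop_nat k)) fun n => ?_
  have h1 := h (n + 1)
  rw [add_right_comm] at h1
  simp only [Function.comp_apply]
  rw [one_div, ← div_eq_inv_mul]
  refine div_le_div_of_nonneg_right (h1.trans_eq ?_) (by positivity)
  push_cast
  ring

theorem ge_of_tendsto_affine {u : ℕ → ℝ} {l a b : ℝ}
    (hu : Tendsto (fun n : ℕ => 1 / ((n : ℝ) + 1) * u (n + 1)) atTop (𝓝 l)) (k : ℕ)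
    (h : ∀ n : ℕ, n * a + b ≤ u (n + k)) : a ≤ l := by
  have h1 : -l ≤ -a := le_of_tendsto_affine (u := fun n => -u n) (b := -b)
    (by simpa using hu.neg) k fun n => by linarith [h n]
  linarith

/-- Fekete's lemma, in the indexing by words of length n + 1. -/
theorem tendsto_of_subadditive {u : ℕ → ℝ} (hu : Subadditive u) {c : ℝ}
    (hc : ∀ n : ℕ, c * n ≤ u n) :
    ∃ l, Tendsto (fun n : ℕ => 1 / ((n : ℝ) + 1) * u (n + 1)) atTop (𝓝 l) := by
  have hb : BddBelow (Set.range fun n : ℕ => u n / n) := by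
    -- The minimum with 0 is for n = 0, where the quotient is 0 by the convention for division by
    -- zero.
    refine ⟨min c 0, ?_⟩
    rintro _ ⟨n, rfl⟩
    rcases n.eq_zero_or_pos with rfl | hn
    · simp
    · exact (min_le_left _ _).trans ((le_div_iff₀ (by positivity)).2 (hc n))
  refine ⟨hu.lim, ((hu.tendsto_lim hb).comp (tendsto_add_atTop_nat 1)).congr fun n => ?_⟩
  simp [div_eq_inv_mul]

/-! ### The channel as an averaging operator -/

theorem exists_cons {n : ℕ} (x : Fin (n + 1) → Bool) :
    ∃ (a : Bool) (y : Fin n → Bool), x = Fin.cons a y :=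
  ⟨x 0, Fin.tail x, (Fin.cons_self_tail x).symm⟩

theorem transitionProb_cons (ε : ℝ) {n : ℕ} (u b : Bool) (x z : Fin n → Bool) :
    transitionProb 0 ε (Fin.cons u x : Fin (n + 1) → Bool) (Fin.cons b z) =
      noiseProb ε (xor u b) * transitionProb 0 ε x z := by
  simp [transitionProb, Fin.prod_univ_succ]

theorem transitionProb_append (ε : ℝ) {m n : ℕ} (x z : Fin m → Bool) (x' z' : Fin n → Bool) :
    transitionProb 0 ε (Fin.append x x') (Fin.append z z') =
      transitionProb 0 ε x z * transitionProb 0 ε x' z' := by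
  simp [transitionProb, Fin.prod_univ_add]

theorem transitionProb_comm (k : ℕ) (ε : ℝ) {n : ℕ} (x z : Fin n → Bool) :
    transitionProb k ε x z = transitionProb k ε z x := by
  simp only [transitionProb, Bool.xor_comm]

theorem noiseProb_nonneg {ε : ℝ} (hε : ε ∈ Set.Icc (0 : ℝ) 1) (e : Bool) :
    0 ≤ noiseProb ε e := by
  cases e <;> simp [noiseProb, hε.1, hε.2]

theorem transitionProb_nonneg {ε : ℝ} (hε : ε ∈ Set.Icc (0 : ℝ) 1) {n : ℕ}
    (x z : Fin n → Bool) : 0 ≤ transitionProb 0 ε x z := by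
  refine Finset.prod_nonneg fun i _ => ?_
  simpa using noiseProb_nonneg hε _

/-- The mean of `F` over the output word of the channel with input word `x`. -/
noncomputable def bscMean (ε : ℝ) {n : ℕ} (x : Fin n → Bool) (F : (Fin n → Bool) → ℝ) : ℝ :=
  ∑ z, transitionProb 0 ε x z * F z

theorem bscMean_cons (ε : ℝ) {n : ℕ} (u : Bool) (x : Fin n → Bool)
    (F : (Fin (n + 1) → Bool) → ℝ) :
    bscMean ε (Fin.cons u x : Fin (n + 1) → Bool) F =
      (1 - ε) * bscMean ε x (fun z => F (Fin.cons u z)) +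
        ε * bscMean ε x (fun z => F (Fin.cons (!u) z)) := by
  simp only [bscMean, sum_words_cons, transitionProb_cons, Fintype.sum_bool, mul_assoc,
    ← Finset.mul_sum]
  cases u <;> simp [noiseProb] <;> ring

theorem bscMean_zero (ε : ℝ) (x : Fin 0 → Bool) (F : (Fin 0 → Bool) → ℝ) :
    bscMean ε x F = F x := by
  rw [bscMean, sum_words_zero, Subsingleton.elim x Fin.elim0]
  simp [transitionProb]

theorem bscMean_const (ε : ℝ) {n : ℕ} (x : Fin n → Bool) (c : ℝ) :
    bscMean ε x (fun _ => c) = c := by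
  induction n with
  | zero => exact bscMean_zero ε x _
  | succ n ih =>
    obtain ⟨a, y, rfl⟩ := exists_cons x
    rw [bscMean_cons, ih]
    ring

theorem bscMean_add (ε : ℝ) {n : ℕ} (x : Fin n → Bool) (F G : (Fin n → Bool) → ℝ) :
    bscMean ε x (fun z => F z + G z) = bscMean ε x F + bscMean ε x G := by
  simp only [bscMean, mul_add, Finset.sum_add_distrib]

theorem sum_transitionProb (ε : ℝ) {n : ℕ} (x : Fin n → Bool) :
    ∑ z, transitionProb 0 ε x z = 1 := by
  simpa [bscMean] using bscMean_const ε x 1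

/-- The channel kernel is symmetric, so passing a law through the channel is the same operator as
averaging a function. Expansions of means thus apply directly to output probabilities. -/
theorem outputLaw_eq_bscMean (ε : ℝ) {n : ℕ} (P : (Fin n → Bool) → ℝ) (z : Fin n → Bool) :
    outputLaw ε P z = bscMean ε z P := by
  simp only [outputLaw, mixedLaw, bscMean]
  exact Finset.sum_congr rfl fun x _ => by rw [transitionProb_comm, mul_comm]

theorem sum_outputLaw_mul (ε : ℝ) {n : ℕ} (P F : (Fin n → Bool) → ℝ) :
    ∑ z, outputLaw ε P z * F z = ∑ x, P x * bscMean ε x F := by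
  simp only [outputLaw, mixedLaw, bscMean, Finset.sum_mul, Finset.mul_sum]
  rw [Finset.sum_comm]
  simp only [mul_assoc]

theorem sum_outputLaw (ε : ℝ) {n : ℕ} (P : (Fin n → Bool) → ℝ) :
    ∑ z, outputLaw ε P z = ∑ x, P x := by
  simpa [bscMean_const] using sum_outputLaw_mul ε P fun _ => 1

theorem outputLaw_nonneg {ε : ℝ} (hε : ε ∈ Set.Icc (0 : ℝ) 1) {n : ℕ}
    {P : (Fin n → Bool) → ℝ} (hP : ∀ w, 0 ≤ P w) (z : Fin n → Bool) : 0 ≤ outputLaw ε P z :=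
  Finset.sum_nonneg fun x _ => mul_nonneg (hP x) (transitionProb_nonneg hε x z)

theorem outputLaw_append_left (ε : ℝ) {m n : ℕ} (P : (Fin (m + n) → Bool) → ℝ)
    (z : Fin m → Bool) :
    ∑ z' : Fin n → Bool, outputLaw ε P (Fin.append z z') =
      outputLaw ε (fun x => ∑ x' : Fin n → Bool, P (Fin.append x x')) z := by
  simp only [outputLaw, mixedLaw, sum_words_append, transitionProb_append]
  rw [Finset.sum_comm]
  refine Finset.sum_congr rfl fun x _ => ?_
  rw [Finset.sum_comm, Finset.sum_mul]
  refine Finset.sum_congr rfl fun x' _ => ?_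
  rw [← Finset.mul_sum, ← Finset.mul_sum, sum_transitionProb, mul_one]

theorem outputLaw_append_right (ε : ℝ) {m n : ℕ} (P : (Fin (m + n) → Bool) → ℝ)
    (z' : Fin n → Bool) :
    ∑ z : Fin m → Bool, outputLaw ε P (Fin.append z z') =
      outputLaw ε (fun x' => ∑ x : Fin m → Bool, P (Fin.append x x')) z' := by
  simp only [outputLaw, mixedLaw, sum_words_append, transitionProb_append, Finset.sum_mul]
  rw [Finset.sum_comm, Finset.sum_comm (s := (Finset.univ : Finset (Fin n → Bool)))]
  refine Finset.sum_congr rfl fun x _ => ?_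
  rw [Finset.sum_comm]
  refine Finset.sum_congr rfl fun x' _ => ?_
  rw [← Finset.mul_sum, ← Finset.sum_mul, sum_transitionProb, one_mul]

theorem sum_negMulLog_transitionProb (ε : ℝ) {n : ℕ} (x : Fin n → Bool) :
    ∑ z, Real.negMulLog (transitionProb 0 ε x z) = n * Real.binEntropy ε := by
  induction n with
  | zero => simp [transitionProb]
  | succ n ih =>
    obtain ⟨a, y, rfl⟩ := exists_cons x
    have h : ∀ b, ∑ z, Real.negMulLog (transitionProb 0 ε (Fin.cons a y : Fin (n + 1) → Bool)
        (Fin.cons b z)) = Real.negMulLog (noiseProb ε (xor a b)) +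
          noiseProb ε (xor a b) * (n * Real.binEntropy ε) := by
      intro b
      simp only [transitionProb_cons, Real.negMulLog_mul, Finset.sum_add_distrib,
        ← Finset.sum_mul, ← Finset.mul_sum, sum_transitionProb, ih, one_mul]
    rw [sum_words_cons]
    simp only [h, Fintype.sum_bool]
    rw [Real.binEntropy_eq_negMulLog_add_negMulLog_one_sub]
    cases a <;> (simp [noiseProb]; ring)

theorem entropy_joint {ε : ℝ} {n : ℕ} {P : (Fin n → Bool) → ℝ} (h1 : ∑ w, P w = 1) :
    entropy (fun p : (Fin n → Bool) × (Fin n → Bool) => P p.1 * transitionProb 0 ε p.1 p.2) =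
      entropy P + n * Real.binEntropy ε := by
  simp only [entropy_eq_sum_negMulLog, Fintype.sum_prod_type, Real.negMulLog_mul,
    Finset.sum_add_distrib, ← Finset.sum_mul, ← Finset.mul_sum, sum_transitionProb,
    sum_negMulLog_transitionProb, h1, one_mul]

/-- Given any input word the output has the entropy of n independent noise bits, so H(Z | X) does
not depend on the input law. -/
theorem mutualInfo_eq {ε : ℝ} {n : ℕ} {P : (Fin n → Bool) → ℝ} (h1 : ∑ w, P w = 1) :
    mutualInfo ε P = entropy (outputLaw ε P) - n * Real.binEntropy ε := by
  have h : ∀ x, ∑ z, P x * transitionProb 0 ε x z *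
      Real.log (P x * transitionProb 0 ε x z / ∑ z', P x * transitionProb 0 ε x z') =
      -(P x * (n * Real.binEntropy ε)) := by
    intro x
    rw [← Finset.mul_sum, sum_transitionProb, mul_one]
    by_cases hx : P x = 0
    · simp [hx]
    · rw [← sum_negMulLog_transitionProb ε x, Finset.mul_sum, ← Finset.sum_neg_distrib]
      refine Finset.sum_congr rfl fun z _ => ?_
      rw [mul_div_cancel_left₀ _ hx, Real.negMulLog]
      ring
  rw [mutualInfo, condEntropy]
  simp only [h, Finset.sum_neg_distrib, ← Finset.sum_mul, h1]
  ring

/-! ### Expansion of the averaging operator in powers of ε. -/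

theorem abs_bscMean_sub_le {ε : ℝ} (hε : ε ∈ Set.Icc (0 : ℝ) 1) {n : ℕ} (x : Fin n → Bool)
    {F : (Fin n → Bool) → ℝ} {M : ℝ} (hM : ∀ z, |F z| ≤ M) :
    |bscMean ε x F - F x| ≤ 2 * n * ε * M := by
  induction n with
  | zero => simp [bscMean_zero]
  | succ n ih =>
    obtain ⟨a, y, rfl⟩ := exists_cons x
    have hA := abs_le.1 (ih y (F := fun z => F (Fin.cons a z)) fun z => hM _)
    have hB := abs_le.1 (ih y (F := fun z => F (Fin.cons (!a) z)) fun z => hM _)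
    have h1 := abs_le.1 (hM (Fin.cons a y))
    have h2 := abs_le.1 (hM (Fin.cons (!a) y))
    rw [bscMean_cons]
    obtain ⟨h0, h0'⟩ := hε
    have h0'' : 0 ≤ 1 - ε := by linarith
    push_cast
    rw [abs_le]
    constructor <;>
    nlinarith [mul_le_mul_of_nonneg_left hA.1 h0'', mul_le_mul_of_nonneg_left hA.2 h0'',
      mul_le_mul_of_nonneg_left hB.1 h0, mul_le_mul_of_nonneg_left hB.2 h0,
      mul_le_mul_of_nonneg_left h1.1 h0, mul_le_mul_of_nonneg_left h1.2 h0,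
      mul_le_mul_of_nonneg_left h2.1 h0, mul_le_mul_of_nonneg_left h2.2 h0]

/-- The sum of the increments of `F` under the flips of one symbol of `x`. -/
def flipSum {n : ℕ} (x : Fin n → Bool) (F : (Fin n → Bool) → ℝ) : ℝ :=
  ∑ i, (F (Function.update x i (!(x i))) - F x)

theorem flipSum_cons {n : ℕ} (a : Bool) (x : Fin n → Bool) (F : (Fin (n + 1) → Bool) → ℝ) :
    flipSum (Fin.cons a x : Fin (n + 1) → Bool) F =
      F (Fin.cons (!a) x) - F (Fin.cons a x) + flipSum x fun z => F (Fin.cons a z) := by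
  simp only [flipSum, Fin.sum_univ_succ, Fin.cons_zero, Fin.cons_succ, Fin.update_cons_zero,
    Fin.cons_update]

/-- Induction on the first symbol: its unflipped branch uses the inductive hypothesis, and its
flipped branch already carries a factor ε, so the cruder zeroth-order estimate suffices there. -/
theorem abs_bscMean_sub_flipSum_le {ε : ℝ} (hε : ε ∈ Set.Icc (0 : ℝ) 1) {n : ℕ}
    (x : Fin n → Bool) {F : (Fin n → Bool) → ℝ} {M : ℝ} (hM : ∀ z, |F z| ≤ M) :
    |bscMean ε x F - F x - ε * flipSum x F| ≤ 4 * n ^ 2 * ε ^ 2 * M := by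
  induction n with
  | zero => simp [bscMean_zero, flipSum]
  | succ n ih =>
    obtain ⟨a, y, rfl⟩ := exists_cons x
    have hA := abs_le.1 (ih y (F := fun z => F (Fin.cons a z)) fun z => hM _)
    have hA' := abs_le.1 (abs_bscMean_sub_le hε y (F := fun z => F (Fin.cons a z)) fun z => hM _)
    have hB := abs_le.1
      (abs_bscMean_sub_le hε y (F := fun z => F (Fin.cons (!a) z)) fun z => hM _)
    have hM0 : 0 ≤ M := (abs_nonneg _).trans (hM (Fin.cons a y))
    have h0 := hε.1
    have h3 : 0 ≤ ε ^ 2 * M * (n + 1) := by positivity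
    rw [bscMean_cons, flipSum_cons]
    push_cast
    rw [abs_le]
    constructor <;>
    nlinarith [mul_le_mul_of_nonneg_left hA'.1 h0, mul_le_mul_of_nonneg_left hA'.2 h0,
      mul_le_mul_of_nonneg_left hB.1 h0, mul_le_mul_of_nonneg_left hB.2 h0]

/-! ### Additive costs on windows of four symbols -/

/-- The sum of a cost over all windows of four symbols of a word. -/
def windowCost (c : Bool → Bool → Bool → Bool → ℝ) : (n : ℕ) → (Fin n → Bool) → ℝ
  | n + 4, z => windowCost c (n + 3) (Fin.tail z) + c (z 0) (z 1) (z 2) (z 3)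
  | 3, _ => 0
  | 2, _ => 0
  | 1, _ => 0
  | 0, _ => 0

/-- The mean of a cost over the output of the channel with input `a, b, d, e`. -/
noncomputable def meanCost (c : Bool → Bool → Bool → Bool → ℝ) (ε : ℝ) (a b d e : Bool) : ℝ :=
  bscMean ε ![a, b, d, e] fun z => c (z 0) (z 1) (z 2) (z 3)

/-- The noise is memoryless, so the mean of the cost of one window depends only on the four input
symbols under that window. -/
theorem bscMean_windowCost (c : Bool → Bool → Bool → Bool → ℝ) (ε : ℝ) {n : ℕ}
    (x : Fin (n + 4) → Bool) :
    bscMean ε x (windowCost c (n + 4)) =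
      bscMean ε (Fin.tail x) (windowCost c (n + 3)) +
        meanCost c ε (x 0) (x 1) (x 2) (x 3) := by
  simp only [windowCost]
  rw [bscMean_add]
  congr 1
  · obtain ⟨a, y, rfl⟩ := exists_cons x
    rw [bscMean_cons]
    simp only [Fin.tail_cons]
    ring
  · obtain ⟨a, x, rfl⟩ := exists_cons x
    obtain ⟨b, x, rfl⟩ := exists_cons x
    obtain ⟨d, x, rfl⟩ := exists_cons x
    obtain ⟨e, x, rfl⟩ := exists_cons x
    have h1 : ∀ {m : ℕ} (u v w t : Bool) (z : Fin m → Bool),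
        (Fin.cons u (Fin.cons v (Fin.cons w (Fin.cons t z))) : Fin (m + 4) → Bool) 1 = v :=
      fun _ _ _ _ _ => rfl
    have h2 : ∀ {m : ℕ} (u v w t : Bool) (z : Fin m → Bool),
        (Fin.cons u (Fin.cons v (Fin.cons w (Fin.cons t z))) : Fin (m + 4) → Bool) 2 = w :=
      fun _ _ _ _ _ => rfl
    have h3 : ∀ {m : ℕ} (u v w t : Bool) (z : Fin m → Bool),
        (Fin.cons u (Fin.cons v (Fin.cons w (Fin.cons t z))) : Fin (m + 4) → Bool) 3 = t :=
      fun _ _ _ _ _ => rfl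
    -- The mean is written out as a closed expression in which the tail `y` does not occur; it can
    -- then be used for both the long word and the word of length four.
    have h : ∀ {m : ℕ} (y : Fin m → Bool),
        bscMean ε (Fin.cons a (Fin.cons b (Fin.cons d (Fin.cons e y))) : Fin (m + 4) → Bool)
          (fun z => c (z 0) (z 1) (z 2) (z 3)) =
        (fun p q r s => (1 - ε) * ((1 - ε) * ((1 - ε) * ((1 - ε) * c p q r s + ε * c p q r (!s))
          + ε * ((1 - ε) * c p q (!r) s + ε * c p q (!r) (!s)))
          + ε * ((1 - ε) * ((1 - ε) * c p (!q) r s + ε * c p (!q) r (!s))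
          + ε * ((1 - ε) * c p (!q) (!r) s + ε * c p (!q) (!r) (!s))))
          + ε * ((1 - ε) * ((1 - ε) * ((1 - ε) * c (!p) q r s + ε * c (!p) q r (!s))
          + ε * ((1 - ε) * c (!p) q (!r) s + ε * c (!p) q (!r) (!s)))
          + ε * ((1 - ε) * ((1 - ε) * c (!p) (!q) r s + ε * c (!p) (!q) r (!s))
          + ε * ((1 - ε) * c (!p) (!q) (!r) s + ε * c (!p) (!q) (!r) (!s))))) a b d e := by
      intro m y
      simp only [bscMean_cons, Fin.cons_zero, h1, h2, h3, bscMean_const]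
    rw [meanCost, h]
    exact (h Fin.elim0).symm

/-- Kraft's inequality for a conditional code. The first symbol is coded given the three symbols
that follow it, so words are peeled from the front and each peeled symbol contributes a factor at
most Z; the 8 counts the three uncharged symbols at the end. -/
theorem sum_exp_windowCost_le {c : Bool → Bool → Bool → Bool → ℝ} {Z : ℝ}
    (hc : ∀ a b d, Real.exp (-c true a b d) + Real.exp (-c false a b d) ≤ Z) (n : ℕ) :
    ∑ z, Real.exp (-windowCost c (n + 3) z) ≤ 8 * Z ^ n := by
  induction n with
  | zero => simp [windowCost]
  | succ n ih =>
    have hZ : 0 ≤ Z := le_trans (by positivity) (hc true true true)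
    rw [sum_words_cons, Finset.sum_comm]
    calc _ ≤ ∑ z : Fin (n + 3) → Bool, Real.exp (-windowCost c (n + 3) z) * Z := by
          refine Finset.sum_le_sum fun z _ => ?_
          have h : ∀ b, Real.exp (-windowCost c (n + 1 + 3) (Fin.cons b z)) =
              Real.exp (-windowCost c (n + 3) z) * Real.exp (-c b (z 0) (z 1) (z 2)) := by
            intro b
            rw [← Real.exp_add, ← neg_add]
            rfl
          rw [Fintype.sum_bool, h, h, ← mul_add]
          exact mul_le_mul_of_nonneg_left (hc _ _ _) (Real.exp_pos _).le
      _ = (∑ z : Fin (n + 3) → Bool, Real.exp (-windowCost c (n + 3) z)) * Z := by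
          rw [Finset.sum_mul]
      _ ≤ 8 * Z ^ n * Z := mul_le_mul_of_nonneg_right ih hZ
      _ = 8 * Z ^ (n + 1) := by ring

/-- The Gibbs bound for this code, with log(1 + ζ) ≤ ζ: a normalisation defect ζ in each conditional
law costs at most ζ per symbol. -/
theorem entropy_outputLaw_le {c : Bool → Bool → Bool → Bool → ℝ} {ζ : ℝ} (hζ : 0 ≤ ζ)
    (hc : ∀ a b d, Real.exp (-c true a b d) + Real.exp (-c false a b d) ≤ 1 + ζ)
    {ε : ℝ} (hε : ε ∈ Set.Icc (0 : ℝ) 1) {n : ℕ} {P : (Fin (n + 3) → Bool) → ℝ}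
    (hP : ∀ w, 0 ≤ P w) (h1 : ∑ w, P w = 1) :
    entropy (outputLaw ε P) ≤
      ∑ x, P x * bscMean ε x (windowCost c (n + 3)) + (n * ζ + Real.log 8) := by
  have h := gibbs_exp (outputLaw_nonneg hε hP) ((sum_outputLaw ε P).trans h1)
    (windowCost c (n + 3)) (sum_exp_windowCost_le hc n) (by positivity)
  rw [sum_outputLaw_mul] at h
  refine h.trans (add_le_add_right ?_ _)
  rw [Real.log_mul (by norm_num) (by positivity), Real.log_pow]
  have := Real.log_le_sub_one_of_pos (show 0 < 1 + ζ by positivity)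
  nlinarith [(Nat.cast_nonneg n : (0 : ℝ) ≤ n)]

/-! ### The constraint without two consecutive ones -/

theorem mem_rll_iff (l : List Bool) : l ∈ rll 1 ⊤ ↔ ¬ [true, true] <:+: l := by
  constructor
  · intro h
    exact h _ (Or.inl ⟨0, by simp, rfl⟩)
  · rintro h u (⟨k, hk, rfl⟩ | ⟨j, hj, -⟩)
    · obtain rfl : k = 0 := by omega
      exact h
    · exact absurd hj (ENat.top_ne_natCast j)

theorem mem_rll_of_append {u v : List Bool} (h : u ++ v ∈ rll 1 ⊤) :
    u ∈ rll 1 ⊤ ∧ v ∈ rll 1 ⊤ := by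
  simp only [mem_rll_iff] at h ⊢
  exact ⟨fun hu => h (hu.trans (List.prefix_append u v).isInfix),
    fun hv => h (hv.trans (List.suffix_append u v).isInfix)⟩

theorem nil_mem_rll : [] ∈ rll 1 ⊤ := by
  simp [mem_rll_iff]

theorem cons_mem_rll_iff (a b : Bool) (l : List Bool) :
    a :: b :: l ∈ rll 1 ⊤ ↔ (a && b) = false ∧ b :: l ∈ rll 1 ⊤ := by
  simp only [mem_rll_iff, List.infix_cons_iff (a := a)]
  cases a <;> cases b <;> simp

theorem singleton_mem_rll (a : Bool) : [a] ∈ rll 1 ⊤ := by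
  simp only [mem_rll_iff, List.infix_cons_iff]
  simp

theorem ofFn_cons_mem_rll_iff {n : ℕ} (a : Bool) (x : Fin (n + 1) → Bool) :
    List.ofFn (Fin.cons a x : Fin (n + 2) → Bool) ∈ rll 1 ⊤ ↔
      (a && x 0) = false ∧ List.ofFn x ∈ rll 1 ⊤ := by
  rw [List.ofFn_cons, List.ofFn_succ (f := x), cons_mem_rll_iff]

theorem ofFn_mem_rll_succ {n : ℕ} {x : Fin (n + 2) → Bool} (h : List.ofFn x ∈ rll 1 ⊤) :
    (x 0 && x 1) = false ∧ List.ofFn (Fin.tail x) ∈ rll 1 ⊤ := by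
  rw [← Fin.cons_self_tail x, ofFn_cons_mem_rll_iff] at h
  exact h

open Classical in
-- A word without 11 starts with 0 or with 10 (beyond length one), and deleting this prefix leaves a
-- shorter such word. The resulting Fibonacci recursion is dominated by powers of the golden ratio
-- because λ² = λ + 1.
theorem sum_indicator_rll_le (n : ℕ) :
    ∑ x : Fin n → Bool, (if List.ofFn x ∈ rll 1 ⊤ then (1 : ℝ) else 0) ≤
      Real.goldenRatio ^ (n + 1) := by
  induction n using Nat.twoStepInduction with
  | zero =>
    simp [nil_mem_rll, Real.one_lt_goldenRatio.le]
  | one =>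
    simp only [sum_words_cons, sum_words_zero]
    simp only [List.ofFn_cons, List.ofFn_zero, singleton_mem_rll, Fintype.sum_bool, if_true,
      one_add_one_eq_two]
    rw [Real.goldenRatio_sq]
    linarith [Real.one_lt_goldenRatio]
  | more n h0 h1 =>
    rw [sum_words_cons, Fintype.sum_bool, sum_words_cons
      (F := fun z => if List.ofFn (Fin.cons true z : Fin (n + 2) → Bool) ∈ rll 1 ⊤
        then (1 : ℝ) else 0), Fintype.sum_bool]
    have hb : ∀ z : Fin (n + 1) → Bool, (if List.ofFn (Fin.cons false z : Fin (n + 2) → Bool)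
        ∈ rll 1 ⊤ then (1 : ℝ) else 0) = if List.ofFn z ∈ rll 1 ⊤ then (1 : ℝ) else 0 := by
      intro z
      simp only [ofFn_cons_mem_rll_iff, Bool.false_and, true_and]
    have ha : ∀ z : Fin n → Bool, (if List.ofFn (Fin.cons true (Fin.cons true z) :
        Fin (n + 2) → Bool) ∈ rll 1 ⊤ then (1 : ℝ) else 0) = 0 := by
      intro z
      rw [if_neg]
      rw [ofFn_cons_mem_rll_iff, Fin.cons_zero]
      exact fun h => Bool.noConfusion h.1
    have hc : ∀ z : Fin n → Bool, (if List.ofFn (Fin.cons true (Fin.cons false z) :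
        Fin (n + 2) → Bool) ∈ rll 1 ⊤ then (1 : ℝ) else 0) ≤
          if List.ofFn z ∈ rll 1 ⊤ then (1 : ℝ) else 0 := by
      intro z
      by_cases h : List.ofFn (Fin.cons true (Fin.cons false z) : Fin (n + 2) → Bool) ∈ rll 1 ⊤
      · have h2 : List.ofFn z ∈ rll 1 ⊤ := by
          have := (ofFn_mem_rll_succ h).2
          rw [Fin.tail_cons, List.ofFn_cons] at this
          exact (mem_rll_of_append (u := [false]) this).2
        rw [if_pos h, if_pos h2]
      · rw [if_neg h]
        positivity
    simp only [hb, ha, Finset.sum_const_zero, zero_add]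
    calc _ ≤ Real.goldenRatio ^ (n + 1) + Real.goldenRatio ^ (n + 1 + 1) :=
          add_le_add ((Finset.sum_le_sum fun z _ => hc z).trans h0) h1
      _ = Real.goldenRatio ^ (n + 1) * (Real.goldenRatio + 1) := by ring
      _ = Real.goldenRatio ^ (n + 2 + 1) := by rw [← Real.goldenRatio_sq]; ring

/-- Gibbs' inequality with the indicator of the constraint as weight: entropy is at most the
logarithm of the number of allowed words. -/
theorem entropy_le_of_admissible {n : ℕ} {P : (Fin n → Bool) → ℝ}
    (hP : P ∈ admissibleLaws (rll 1 ⊤) n) :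
    entropy P ≤ n * Real.log Real.goldenRatio + Real.log Real.goldenRatio := by
  classical
  have h := gibbs hP.1.1 (Q := fun x => if List.ofFn x ∈ rll 1 ⊤ then (1 : ℝ) else 0)
    (fun x => by positivity) hP.1.2 (sum_indicator_rll_le n)
    (pow_pos Real.goldenRatio_pos _) (fun x hx => by
      by_contra h0
      have := hP.2 x ((hP.1.1 x).lt_of_ne' h0)
      simp [this] at hx)
  have h0 : ∀ x : Fin n → Bool,
      Real.log (if List.ofFn x ∈ rll 1 ⊤ then (1 : ℝ) else 0) = 0 := by
    intro x
    split_ifs <;> simp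
  simp only [h0, mul_zero, Finset.sum_const_zero, neg_zero, zero_add, Real.log_pow] at h
  push_cast at h
  linarith

/-! ### The capacity is a limit -/

theorem marginal_left_admissible {m n : ℕ} {P : (Fin (m + n) → Bool) → ℝ}
    (hP : P ∈ admissibleLaws (rll 1 ⊤) (m + n)) :
    (fun u : Fin m → Bool => ∑ v : Fin n → Bool, P (Fin.append u v)) ∈
      admissibleLaws (rll 1 ⊤) m := by
  refine ⟨⟨fun u => Finset.sum_nonneg fun v _ => hP.1.1 _, ?_⟩, fun u hu => ?_⟩
  · rw [← sum_words_append]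
    exact hP.1.2
  · obtain ⟨v, -, hv⟩ := Finset.exists_ne_zero_of_sum_ne_zero hu.ne'
    have := hP.2 _ ((hP.1.1 _).lt_of_ne' hv)
    rw [List.ofFn_fin_append] at this
    exact (mem_rll_of_append this).1

theorem marginal_right_admissible {m n : ℕ} {P : (Fin (m + n) → Bool) → ℝ}
    (hP : P ∈ admissibleLaws (rll 1 ⊤) (m + n)) :
    (fun v : Fin n → Bool => ∑ u : Fin m → Bool, P (Fin.append u v)) ∈
      admissibleLaws (rll 1 ⊤) n := by
  refine ⟨⟨fun u => Finset.sum_nonneg fun v _ => hP.1.1 _, ?_⟩, fun v hv => ?_⟩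
  · rw [Finset.sum_comm, ← sum_words_append]
    exact hP.1.2
  · obtain ⟨u, -, hu⟩ := Finset.exists_ne_zero_of_sum_ne_zero hv.ne'
    have := hP.2 _ ((hP.1.1 _).lt_of_ne' hu)
    rw [List.ofFn_fin_append] at this
    exact (mem_rll_of_append this).2

/-- Since the channel is memoryless, the marginals of the output are the outputs of the marginals.
Output entropy is subadditive and the noise entropy is additive. -/
theorem mutualInfo_append_le {ε : ℝ} (hε : ε ∈ Set.Icc (0 : ℝ) 1) {m n : ℕ}
    {P : (Fin (m + n) → Bool) → ℝ} (hP : P ∈ stdSimplex ℝ (Fin (m + n) → Bool)) :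
    mutualInfo ε P ≤
      mutualInfo ε (fun u : Fin m → Bool => ∑ v : Fin n → Bool, P (Fin.append u v)) +
      mutualInfo ε (fun v : Fin n → Bool => ∑ u : Fin m → Bool, P (Fin.append u v)) := by
  have h := entropy_append_le (outputLaw_nonneg hε hP.1) ((sum_outputLaw ε P).trans hP.2)
  simp only [outputLaw_append_left, outputLaw_append_right] at h
  rw [mutualInfo_eq hP.2, mutualInfo_eq (by rw [← sum_words_append]; exact hP.2),
    mutualInfo_eq (by rw [Finset.sum_comm, ← sum_words_append]; exact hP.2)]
  push_cast
  linarith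

/-- The supremum of the mutual information over admissible input laws of length `n`. -/
noncomputable def maxInfo (ε : ℝ) (n : ℕ) : ℝ :=
  sSup (mutualInfo ε '' admissibleLaws (rll 1 ⊤) n)

theorem blockCapacity_eq (ε : ℝ) (n : ℕ) :
    blockCapacity (rll 1 ⊤) ε n = 1 / ((n : ℝ) + 1) * maxInfo ε (n + 1) := by
  have h0 : (0 : ℝ) ≤ 1 / ((n : ℝ) + 1) := by positivity
  rw [blockCapacity, maxInfo, ← smul_eq_mul, ← Real.sSup_smul_of_nonneg h0]
  congr 1
  ext y
  simp [Set.mem_smul_set, smul_eq_mul]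

theorem zero_word_mem_rll (n : ℕ) : List.ofFn (fun _ : Fin n => false) ∈ rll 1 ⊤ := by
  rw [mem_rll_iff]
  intro h
  have := h.subset (show true ∈ [true, true] by simp)
  simp at this

theorem admissibleLaws_nonempty (n : ℕ) : (admissibleLaws (rll 1 ⊤) n).Nonempty := by
  classical
  refine ⟨Pi.single (fun _ => false) 1, single_mem_stdSimplex ℝ _, fun w hw => ?_⟩
  by_cases h : w = fun _ => false
  · rw [h]
    exact zero_word_mem_rll n
  · simp [Pi.single_eq_of_ne h] at hw

theorem mutualInfo_le {ε : ℝ} (hε : ε ∈ Set.Icc (0 : ℝ) 1) {n : ℕ}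
    {P : (Fin n → Bool) → ℝ} (hP : P ∈ stdSimplex ℝ (Fin n → Bool)) :
    mutualInfo ε P ≤ n * Real.log 2 := by
  have h := entropy_words_le (outputLaw_nonneg hε hP.1) ((sum_outputLaw ε P).trans hP.2)
  rw [mutualInfo_eq hP.2]
  have := Real.binEntropy_nonneg hε.1 hε.2
  nlinarith [(Nat.cast_nonneg n : (0 : ℝ) ≤ n)]

theorem bddAbove_mutualInfo {ε : ℝ} (hε : ε ∈ Set.Icc (0 : ℝ) 1) (n : ℕ) :
    BddAbove (mutualInfo ε '' admissibleLaws (rll 1 ⊤) n) := by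
  refine ⟨n * Real.log 2, ?_⟩
  rintro _ ⟨P, hP, rfl⟩
  exact mutualInfo_le hε hP.1

theorem le_maxInfo {ε : ℝ} (hε : ε ∈ Set.Icc (0 : ℝ) 1) {n : ℕ} {P : (Fin n → Bool) → ℝ}
    (hP : P ∈ admissibleLaws (rll 1 ⊤) n) : mutualInfo ε P ≤ maxInfo ε n :=
  le_csSup (bddAbove_mutualInfo hε n) ⟨P, hP, rfl⟩

theorem maxInfo_le {ε : ℝ} {n : ℕ} {B : ℝ}
    (h : ∀ P ∈ admissibleLaws (rll 1 ⊤) n, mutualInfo ε P ≤ B) : maxInfo ε n ≤ B := by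
  refine csSup_le ((admissibleLaws_nonempty n).image _) ?_
  rintro _ ⟨P, hP, rfl⟩
  exact h P hP

/-- The constraint passes to prefixes and suffixes, so both marginals of an admissible law are
admissible and the block maximum is subadditive. The linear lower bound needed for Fekete's lemma is
-nH(ε), from H(Z) ≥ 0. -/
theorem tendsto_blockCapacity {ε : ℝ} (hε : ε ∈ Set.Icc (0 : ℝ) 1) :
    Tendsto (blockCapacity (rll 1 ⊤) ε) atTop (𝓝 (constrainedCapacity (rll 1 ⊤) ε)) := by
  have hsub : Subadditive (maxInfo ε) := fun m n => maxInfo_le fun P hP =>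
    (mutualInfo_append_le hε hP.1).trans (add_le_add
      (le_maxInfo hε (marginal_left_admissible hP)) (le_maxInfo hε (marginal_right_admissible hP)))
  obtain ⟨l, hl⟩ := tendsto_of_subadditive hsub (c := -Real.binEntropy ε) fun n => by
    obtain ⟨P, hP⟩ := admissibleLaws_nonempty n
    refine le_trans ?_ (le_maxInfo hε hP)
    rw [mutualInfo_eq hP.1.2]
    have := entropy_nonneg (outputLaw_nonneg hε hP.1.1) ((sum_outputLaw ε P).trans hP.1.2)
    linarith
  have : Tendsto (blockCapacity (rll 1 ⊤) ε) atTop (𝓝 l) :=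
    hl.congr fun n => (blockCapacity_eq ε n).symm
  rwa [constrainedCapacity, this.limUnder_eq]

theorem capacity_le_of_forall {ε : ℝ} (hε : ε ∈ Set.Icc (0 : ℝ) 1) {a b : ℝ} (k : ℕ)
    (h : ∀ n, ∀ P ∈ admissibleLaws (rll 1 ⊤) (n + k), mutualInfo ε P ≤ n * a + b) :
    constrainedCapacity (rll 1 ⊤) ε ≤ a :=
  le_of_tendsto_affine ((tendsto_blockCapacity hε).congr fun n => blockCapacity_eq ε n) k
    fun n => maxInfo_le (h n)

theorem le_capacity_of_tendsto {ε : ℝ} (hε : ε ∈ Set.Icc (0 : ℝ) 1) {p : WordLaw}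
    (hp : ∀ n, p n ∈ admissibleLaws (rll 1 ⊤) n) {l : ℝ}
    (hl : Tendsto (blockEntropy (outputProcess ε p)) atTop (𝓝 l)) :
    l - Real.binEntropy ε ≤ constrainedCapacity (rll 1 ⊤) ε := by
  refine le_of_tendsto_of_tendsto' (hl.sub_const _) (tendsto_blockCapacity hε) fun n => ?_
  rw [blockCapacity_eq]
  have h := le_maxInfo hε (hp (n + 1))
  rw [mutualInfo_eq (hp (n + 1)).1.2] at h
  have h0 : (0 : ℝ) < (n : ℝ) + 1 := by positivity
  simp only [blockEntropy, outputProcess]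
  calc _ = 1 / ((n : ℝ) + 1) *
      (entropy (outputLaw ε (p (n + 1))) - ((n + 1 : ℕ) : ℝ) * Real.binEntropy ε) := by
        push_cast
        field_simp
    _ ≤ _ := mul_le_mul_of_nonneg_left h (by positivity)

/-! ### Stationary families of word probabilities -/

/-- The word probabilities of a stationary binary process. -/
structure IsStationaryFamily (p : WordLaw) : Prop where
  nonneg : ∀ n w, 0 ≤ p n w
  zero : ∀ w, p 0 w = 1
  sum_cons : ∀ n (w : Fin n → Bool), ∑ b, p (n + 1) (Fin.cons b w) = p n w
  sum_snoc : ∀ n (w : Fin n → Bool), ∑ b, p (n + 1) (extendWord w b) = p n w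

theorem IsStationaryFamily.sum_eq_one {p : WordLaw} (hp : IsStationaryFamily p) (n : ℕ) :
    ∑ w, p n w = 1 := by
  induction n with
  | zero => rw [sum_words_zero, hp.zero]
  | succ n ih =>
    rw [sum_words_cons, Finset.sum_comm]
    simp only [hp.sum_cons, ih]

theorem IsStationaryFamily.sum_append_left {p : WordLaw} (hp : IsStationaryFamily p) (m n : ℕ)
    (u : Fin m → Bool) : ∑ v : Fin n → Bool, p (m + n) (Fin.append u v) = p m u := by
  induction n with
  | zero =>
    rw [sum_words_zero]
    congr 1
    exact Fin.append_right_nil u Fin.elim0 rfl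
  | succ n ih =>
    rw [sum_words_snoc, ← ih]
    refine Finset.sum_congr rfl fun v _ => ?_
    rw [← hp.sum_snoc]
    refine Finset.sum_congr rfl fun b _ => ?_
    simp only [extendWord]
    exact congrArg (p (m + n + 1)) (Fin.append_snoc u v b)

theorem WordLaw.comp_cast (p : WordLaw) {k l : ℕ} (h : k = l) (w : Fin l → Bool) :
    p k (w ∘ Fin.cast h) = p l w := by
  subst h
  rfl

theorem IsStationaryFamily.sum_append_right {p : WordLaw} (hp : IsStationaryFamily p) (m n : ℕ)
    (v : Fin n → Bool) : ∑ u : Fin m → Bool, p (m + n) (Fin.append u v) = p n v := by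
  induction m with
  | zero =>
    rw [sum_words_zero, Fin.append_left_nil Fin.elim0 v rfl, p.comp_cast]
  | succ m ih =>
    rw [sum_words_cons, Finset.sum_comm, ← ih]
    refine Finset.sum_congr rfl fun u _ => ?_
    rw [← hp.sum_cons]
    refine Finset.sum_congr rfl fun b _ => ?_
    rw [Fin.append_cons, p.comp_cast]

/-- Only consistency of the left and right marginals is used, so the result serves both a stationary
process and its image under the channel. -/
theorem tendsto_blockEntropy_of_marginals {q : WordLaw} (h0 : ∀ n w, 0 ≤ q n w) (h1 : ∀ n, ∑ w, q n w = 1)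
    (hl : ∀ m n (u : Fin m → Bool), ∑ v : Fin n → Bool, q (m + n) (Fin.append u v) = q m u)
    (hr : ∀ m n (v : Fin n → Bool), ∑ u : Fin m → Bool, q (m + n) (Fin.append u v) = q n v) :
    Tendsto (blockEntropy q) atTop (𝓝 (entropyRate q)) := by
  have hs : Subadditive fun n => entropy (q n) := fun m n => by
    have := entropy_append_le (h0 (m + n)) (h1 _)
    simpa only [hl, hr] using this
  obtain ⟨l, hl⟩ := tendsto_of_subadditive hs (c := 0) fun n => by
    simpa using entropy_nonneg (h0 n) (h1 n)
  have hl' : Tendsto (blockEntropy q) atTop (𝓝 l) := hl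
  rwa [entropyRate, hl'.limUnder_eq]

theorem IsStationaryFamily.tendsto_blockEntropy {p : WordLaw} (hp : IsStationaryFamily p) :
    Tendsto (blockEntropy p) atTop (𝓝 (entropyRate p)) :=
  tendsto_blockEntropy_of_marginals hp.nonneg hp.sum_eq_one hp.sum_append_left hp.sum_append_right

theorem IsStationaryFamily.tendsto_blockEntropy_output {p : WordLaw} (hp : IsStationaryFamily p)
    {ε : ℝ} (hε : ε ∈ Set.Icc (0 : ℝ) 1) :
    Tendsto (blockEntropy (outputProcess ε p)) atTop (𝓝 (entropyRate (outputProcess ε p))) := by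
  refine tendsto_blockEntropy_of_marginals (fun n => outputLaw_nonneg hε (hp.nonneg n))
    (fun n => (sum_outputLaw ε _).trans (hp.sum_eq_one n)) (fun m n u => ?_) fun m n v => ?_
  · simp only [outputProcess, outputLaw_append_left, hp.sum_append_left]
  · simp only [outputProcess, outputLaw_append_right, hp.sum_append_right]

theorem IsStationaryFamily.admissible {p : WordLaw} (hp : IsStationaryFamily p)
    (hS : SupportedIn p (rll 1 ⊤)) (n : ℕ) : p n ∈ admissibleLaws (rll 1 ⊤) n :=
  ⟨⟨hp.nonneg n, hp.sum_eq_one n⟩, hS n⟩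

theorem IsStationaryFamily.entropyRate_le {p : WordLaw} (hp : IsStationaryFamily p)
    (hS : SupportedIn p (rll 1 ⊤)) : entropyRate p ≤ Real.log Real.goldenRatio :=
  le_of_tendsto_affine (u := fun n => entropy (p n)) hp.tendsto_blockEntropy 0 fun n =>
    entropy_le_of_admissible (hp.admissible hS n)

/-! ### Stationary measures -/

theorem measurableSet_cylinder {n : ℕ} (w : Fin n → Bool) :
    MeasurableSet {x : ℕ → Bool | ∀ i : Fin n, x (i : ℕ) = w i} := by
  rw [Set.ofPred_forall]
  exact MeasurableSet.iInter fun i => measurableSet_eq_fun (measurable_pi_apply _) measurable_const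

theorem isStationaryFamily_wordLaw {ν : Measure (ℕ → Bool)} (hν : IsStationaryLaw ν) :
    IsStationaryFamily (wordLaw ν) := by
  have := hν.1
  refine ⟨fun n w => measureReal_nonneg, fun w => ?_, fun n w => ?_, fun n w => ?_⟩
  · simp [wordLaw]
  · have h1 : ν.real (shiftMap ⁻¹' {x | ∀ i : Fin n, x (i : ℕ) = w i}) = wordLaw ν n w := by
      rw [wordLaw, Measure.real, Measure.real,
        hν.2.measure_preimage (measurableSet_cylinder w).nullMeasurableSet]
    rw [← h1, Fintype.sum_bool]
    simp only [wordLaw]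
    rw [← measureReal_union]
    · congr 1
      ext x
      simp only [Fin.forall_fin_succ, Fin.cons_zero, Fin.cons_succ, Set.mem_union, Set.mem_ofPred_eq,
        Set.mem_preimage, shiftMap, Fin.val_zero, Fin.val_succ]
      cases x 0 <;> simp
    · rw [Set.disjoint_left]
      intro x hx hx'
      have a := hx 0
      have b := hx' 0
      rw [a] at b
      simp at b
    · exact measurableSet_cylinder _
  · rw [Fintype.sum_bool]
    simp only [wordLaw, extendWord]
    rw [← measureReal_union]
    · congr 1
      ext x
      simp only [Fin.forall_fin_succ', Fin.snoc_castSucc, Fin.snoc_last, Set.mem_union,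
        Set.mem_ofPred_eq, Fin.val_castSucc, Fin.val_last]
      cases x n <;> simp
    · rw [Set.disjoint_left]
      intro x hx hx'
      have a := hx (Fin.last n)
      have b := hx' (Fin.last n)
      rw [a] at b
      simp at b
    · exact measurableSet_cylinder _

/-! ### The Markov chain on the constraint -/

/-- The probability that a Markov chain with transition matrix `Δ` started at `s` goes on
with the word `x`. -/
def chainKernel (Δ : Bool → Bool → ℝ) : (n : ℕ) → Bool → (Fin n → Bool) → ℝ
  | 0, _, _ => 1
  | n + 1, s, x => Δ s (x 0) * chainKernel Δ n (x 0) (Fin.tail x)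

theorem chainKernel_cons (Δ : Bool → Bool → ℝ) {n : ℕ} (s b : Bool) (x : Fin n → Bool) :
    chainKernel Δ (n + 1) s (Fin.cons b x) = Δ s b * chainKernel Δ n b x := rfl

theorem chainKernel_eq_prod (Δ : Bool → Bool → ℝ) {n : ℕ} (s : Bool) (x : Fin n → Bool) :
    chainKernel Δ n s x = ∏ i : Fin n,
      Δ ((Fin.cons s x : Fin (n + 1) → Bool) i.castSucc) (x i) := by
  induction n generalizing s with
  | zero => simp [chainKernel]
  | succ n ih =>
    obtain ⟨a, y, rfl⟩ := exists_cons x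
    rw [chainKernel_cons, ih, Fin.prod_univ_succ]
    simp

theorem markovLaw_cons (μ : Bool → ℝ) (Δ : Bool → Bool → ℝ) {n : ℕ} (s : Bool)
    (x : Fin n → Bool) :
    markovLaw μ Δ (n + 1) (Fin.cons s x) = μ s * chainKernel Δ n s x := by
  rw [chainKernel_eq_prod]
  simp [markovLaw]

theorem markovLaw_extendWord (μ : Bool → ℝ) (Δ : Bool → Bool → ℝ) {n : ℕ} (w : Fin (n + 1) → Bool)
    (b : Bool) : markovLaw μ Δ (n + 2) (extendWord w b) =
      markovLaw μ Δ (n + 1) w * Δ (w (Fin.last n)) b := by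
  rw [markovLaw, markovLaw, Fin.prod_univ_castSucc, mul_assoc]
  simp only [extendWord]
  congr 1
  simp only [Fin.snoc_castSucc, Fin.succ_last, Fin.snoc_last, Fin.succ_castSucc]

theorem rllMatrix_sum (π : ℝ) (s : Bool) : ∑ b, rllMatrix π s b = 1 := by
  cases s <;> simp [rllMatrix]

theorem rllMatrix_nonneg {π : ℝ} (hπ : π ∈ Set.Icc (0 : ℝ) 1) (s b : Bool) :
    0 ≤ rllMatrix π s b := by
  cases s <;> cases b <;> simp [rllMatrix, hπ.1, hπ.2]

theorem rllStationary_nonneg {π : ℝ} (hπ : 0 ≤ π) (s : Bool) : 0 ≤ rllStationary π s := by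
  cases s <;> simp only [rllStationary] <;> positivity

theorem rllStationary_mul_matrix {π : ℝ} (hπ : 0 ≤ π) (s : Bool) :
    ∑ a, rllStationary π a * rllMatrix π a s = rllStationary π s := by
  have : 1 + π ≠ 0 := by positivity
  cases s <;> simp [rllStationary, rllMatrix] <;> field_simp <;> ring

theorem rllStationary_sum {π : ℝ} (hπ : 0 ≤ π) : ∑ a, rllStationary π a = 1 := by
  have : 1 + π ≠ 0 := by positivity
  simp [rllStationary]
  field_simp
  ring

theorem sum_chainKernel {Δ : Bool → Bool → ℝ} (hΔ : ∀ s, ∑ b, Δ s b = 1) (n : ℕ) (s : Bool) :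
    ∑ x, chainKernel Δ n s x = 1 := by
  induction n generalizing s with
  | zero => simp [chainKernel]
  | succ n ih =>
    rw [sum_words_cons]
    simp only [chainKernel_cons, ← Finset.mul_sum, ih, mul_one, hΔ]

theorem chainKernel_nonneg {π : ℝ} (hπ : π ∈ Set.Icc (0 : ℝ) 1) {n : ℕ} (s : Bool)
    (x : Fin n → Bool) : 0 ≤ chainKernel (rllMatrix π) n s x := by
  rw [chainKernel_eq_prod]
  exact Finset.prod_nonneg fun i _ => rllMatrix_nonneg hπ _ _

theorem isStationaryFamily_rllChain {π : ℝ} (hπ : π ∈ Set.Icc (0 : ℝ) 1) :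
    IsStationaryFamily (rllChain π) := by
  refine ⟨fun n w => ?_, fun w => rfl, fun n w => ?_, fun n w => ?_⟩
  · cases n with
    | zero => exact zero_le_one
    | succ n =>
      obtain ⟨a, y, rfl⟩ := exists_cons w
      rw [rllChain, markovLaw_cons]
      exact mul_nonneg (rllStationary_nonneg hπ.1 _) (chainKernel_nonneg hπ _ _)
  · cases n with
    | zero =>
      simp only [rllChain, markovLaw_cons, chainKernel, mul_one]
      exact rllStationary_sum hπ.1
    | succ n =>
      obtain ⟨a, y, rfl⟩ := exists_cons w
      simp only [rllChain, markovLaw_cons, chainKernel_cons, ← mul_assoc, ← Finset.sum_mul,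
        rllStationary_mul_matrix hπ.1]
  · cases n with
    | zero =>
      have : ∀ b, extendWord w b = Fin.cons b Fin.elim0 := by
        intro b
        funext i
        obtain rfl : i = Fin.last 0 := Fin.ext (by omega)
        simp only [extendWord, Fin.snoc_last]
        rfl
      simp only [this, rllChain, markovLaw_cons, chainKernel, mul_one]
      exact rllStationary_sum hπ.1
    | succ n =>
      simp only [rllChain, markovLaw_extendWord, ← Finset.mul_sum, rllMatrix_sum, mul_one]

theorem supportedIn_rllChain (π : ℝ) : SupportedIn (rllChain π) (rll 1 ⊤) := by
  have key : ∀ (n : ℕ) (s : Bool) (x : Fin n → Bool), chainKernel (rllMatrix π) n s x ≠ 0 →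
      List.ofFn (Fin.cons s x : Fin (n + 1) → Bool) ∈ rll 1 ⊤ := by
    intro n
    induction n with
    | zero =>
      intro s x _
      rw [List.ofFn_cons, List.ofFn_zero]
      exact singleton_mem_rll s
    | succ n ih =>
      intro s x hx
      obtain ⟨a, y, rfl⟩ := exists_cons x
      rw [chainKernel_cons] at hx
      rw [ofFn_cons_mem_rll_iff]
      refine ⟨?_, ih a y (right_ne_zero_of_mul hx)⟩
      by_contra h
      rw [Bool.not_eq_false, Bool.and_eq_true, Fin.cons_zero] at h
      rw [h.1, h.2] at hx
      simp [rllMatrix] at hx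
  intro n w hw
  cases n with
  | zero => rw [List.ofFn_zero]; exact nil_mem_rll
  | succ n =>
    obtain ⟨a, y, rfl⟩ := exists_cons w
    rw [rllChain, markovLaw_cons] at hw
    exact key n a y (right_ne_zero_of_mul hw.ne')

/-- Averaging against the stationary vector turns a one-step recursion for costs along a Markov
chain into exact linear growth. It computes both the entropy of the chain and the mean cost of the
decoder. -/
theorem stationary_recursion {μ : Bool → ℝ} {Δ : Bool → Bool → ℝ}
    (hμ : ∀ s, ∑ a, μ a * Δ a s = μ s) {e : ℕ → Bool → ℝ} {j : Bool → ℝ}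
    (he : ∀ n s, e (n + 1) s = j s + ∑ b, Δ s b * e n b) (n : ℕ) :
    ∑ s, μ s * e n s = n * ∑ s, μ s * j s + ∑ s, μ s * e 0 s := by
  induction n with
  | zero => simp
  | succ n ih =>
    have h : ∑ s, μ s * e (n + 1) s = ∑ s, μ s * j s + ∑ s, μ s * e n s := by
      simp only [he, mul_add, Finset.sum_add_distrib]
      congr 1
      simp only [Finset.mul_sum, ← mul_assoc]
      rw [Finset.sum_comm]
      simp only [← Finset.sum_mul, hμ]
    rw [h, ih]
    push_cast
    ring

theorem entropy_rllChain {π : ℝ} (hπ : 0 ≤ π) (n : ℕ) :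
    entropy (rllChain π (n + 1)) =
      n * (Real.binEntropy π / (1 + π)) + entropy (rllStationary π) := by
  have h := stationary_recursion (rllStationary_mul_matrix hπ)
    (e := fun n s => ∑ x, Real.negMulLog (chainKernel (rllMatrix π) n s x))
    (j := fun s => ∑ b, Real.negMulLog (rllMatrix π s b)) (fun n s => by
      simp only [sum_words_cons, chainKernel_cons, Real.negMulLog_mul, Finset.sum_add_distrib,
        ← Finset.sum_mul, ← Finset.mul_sum, sum_chainKernel (rllMatrix_sum π), one_mul]) n
  rw [entropy_eq_sum_negMulLog, entropy_eq_sum_negMulLog, sum_words_cons]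
  simp only [rllChain, markovLaw_cons, Real.negMulLog_mul, Finset.sum_add_distrib,
    ← Finset.sum_mul, ← Finset.mul_sum, sum_chainKernel (rllMatrix_sum π), one_mul, h]
  have h0 : ∑ s, rllStationary π s * ∑ b, Real.negMulLog (rllMatrix π s b) =
      Real.binEntropy π / (1 + π) := by
    simp only [Fintype.sum_bool, rllMatrix, rllStationary, Real.negMulLog_one,
      Real.negMulLog_zero, Real.binEntropy_eq_negMulLog_add_negMulLog_one_sub]
    ring
  rw [h0]
  simp [chainKernel]
  ring

theorem entropyRate_rllChain {π : ℝ} (hπ : π ∈ Set.Icc (0 : ℝ) 1) :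
    entropyRate (rllChain π) = Real.binEntropy π / (1 + π) := by
  have h := (isStationaryFamily_rllChain hπ).tendsto_blockEntropy
  apply le_antisymm
  · exact le_of_tendsto_affine (u := fun n => entropy (rllChain π n)) h 1
      fun n => (entropy_rllChain hπ.1 n).le
  · exact ge_of_tendsto_affine (u := fun n => entropy (rllChain π n)) h 1
      fun n => (entropy_rllChain hπ.1 n).ge

/-! ### First order chains supported in the constraint -/

/-- As 11 has probability zero, stationarity forces p(10) = p(1) = p(01). Hence p(1) = π p(0), and
all words of length two, and then by the Markov property all words, are determined by π. -/
theorem eq_rllChain_of_isFirstOrderMarkov {p : WordLaw} (hp : IsStationaryFamily p)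
    (hM : IsFirstOrderMarkov p) (hS : SupportedIn p (rll 1 ⊤)) :
    prob01 p ∈ Set.Icc (0 : ℝ) 1 ∧ p = rllChain (prob01 p) := by
  have e2 : ∀ a b, extendWord ![a] b = ![a, b] := by decide
  have c2 : ∀ a b, (Fin.cons a ![b] : Fin 2 → Bool) = ![a, b] := fun _ _ => rfl
  have h1 : p 1 ![true] + p 1 ![false] = 1 := by
    have := hp.sum_eq_one 1
    rw [sum_words_cons, Fintype.sum_bool, sum_words_zero, sum_words_zero] at this
    convert this using 3 <;> (funext i; obtain rfl : i = 0 := Fin.ext (by omega); rfl)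
  have hs := fun a => hp.sum_snoc 1 ![a]
  have hc := fun a => hp.sum_cons 1 ![a]
  simp only [e2, c2, Fintype.sum_bool] at hs hc
  have h11 : p 2 ![true, true] = 0 := by
    by_contra h
    have := hS 2 _ ((hp.nonneg 2 _).lt_of_ne' h)
    rw [mem_rll_iff] at this
    exact this (by simp)
  have ht := hs true
  have hf := hs false
  have ht' := hc true
  have hf' := hc false
  have n10 := hp.nonneg 2 ![true, false]
  have n00 := hp.nonneg 2 ![false, false]
  have n01 := hp.nonneg 2 ![false, true]
  -- p(1) = p(01) ≤ p(0) and the two add up to 1.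
  have hf0 : 0 < p 1 ![false] := by linarith
  set π := prob01 p with hπdef
  have hπ : π * p 1 ![false] = p 2 ![false, true] := div_mul_cancel₀ _ hf0.ne'
  have hπ0 : 0 ≤ π := div_nonneg n01 hf0.le
  have hπ1 : π ≤ 1 := (div_le_one hf0).2 (by linarith)
  have hpi : 0 < 1 + π := by linarith
  have hstat : ∀ a, p 1 ![a] = rllStationary π a := by
    have hfe : p 1 ![false] = 1 / (1 + π) := by
      rw [eq_div_iff hpi.ne']
      linarith
    intro a
    cases a
    · exact hfe
    · have : p 1 ![true] = π * p 1 ![false] := by linarith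
      rw [this, hfe]
      simp only [rllStationary]
      ring
  have htr : ∀ a b, p 2 ![a, b] = p 1 ![a] * rllMatrix π a b := by
    intro a b
    cases a <;> cases b <;> simp only [rllMatrix] <;> linarith
  have hmon : ∀ n (w : Fin n → Bool) b, p (n + 1) (extendWord w b) ≤ p n w := by
    intro n w b
    rw [← hp.sum_snoc n w]
    exact Finset.single_le_sum (f := fun b => p (n + 1) (extendWord w b))
      (fun b _ => hp.nonneg _ _) (Finset.mem_univ b)
  have hlast : ∀ n (u : Fin n → Bool) a, p (n + 1) (extendWord u a) ≤ p 1 ![a] := by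
    intro n
    induction n with
    | zero =>
      intro u a
      refine le_of_eq (congrArg _ ?_)
      funext i
      obtain rfl : i = Fin.last 0 := Fin.ext (by omega)
      simp only [extendWord, Fin.snoc_last]
      rfl
    | succ n ih =>
      intro u a
      obtain ⟨c, y, rfl⟩ := exists_cons u
      rw [extendWord_cons]
      refine le_trans ?_ (ih y a)
      rw [← hp.sum_cons (n + 1)]
      exact Finset.single_le_sum (f := fun b => p (n + 1 + 1) (Fin.cons b (extendWord y a)))
        (fun b _ => hp.nonneg _ _) (Finset.mem_univ c)
  refine ⟨⟨hπ0, hπ1⟩, ?_⟩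
  have hsnoc : ∀ n (w : Fin (n + 1) → Bool), ∃ (u : Fin n → Bool) (a : Bool), w = extendWord u a :=
    fun n w => ⟨Fin.init w, w (Fin.last n), (Fin.snoc_init_self w).symm⟩
  have key : ∀ n (w : Fin (n + 1) → Bool), p (n + 1) w = rllChain π (n + 1) w := by
    intro n
    induction n with
    | zero =>
      intro w
      obtain ⟨a, y, rfl⟩ := exists_cons w
      rw [rllChain, markovLaw_cons, chainKernel, mul_one, ← hstat]
      congr 1
      funext i
      obtain rfl : i = 0 := Fin.ext (by omega)
      rfl
    | succ n ih =>
      intro w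
      obtain ⟨w, b, rfl⟩ := hsnoc _ w
      obtain ⟨u, a, rfl⟩ := hsnoc _ w
      rw [rllChain, markovLaw_extendWord, ← rllChain, ← ih]
      have hl : extendWord u a (Fin.last n) = a := by simp [extendWord]
      rw [hl]
      -- If the symbol `a` has probability zero, the Markov identity is 0 = 0 and says nothing; then
      -- every word ending in `a`, hence also each extension of it, has probability zero.
      rcases (hp.nonneg 1 ![a]).eq_or_lt with h0 | h0
      · have hz : p (n + 1) (extendWord u a) = 0 :=
          le_antisymm ((hlast n u a).trans h0.ge) (hp.nonneg _ _)
        rw [hz, zero_mul]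
        exact le_antisymm ((hmon _ _ b).trans hz.le) (hp.nonneg _ _)
      · have := hM n u a b
        rw [htr] at this
        apply mul_right_cancel₀ h0.ne'
        rw [this]
        ring
  funext n w
  cases n with
  | zero => exact hp.zero w
  | succ n => exact key n w

/-! ### A cost that depends on the current run of ones -/

/-- The cost of a symbol given the three symbols before it (the most recent one comes first):
`α` after `00`, `β` after `01`, and `b`, `c`, `(0, M)` after a run of one, two, at least three
ones. -/
def runCost (α₀ α₁ β₀ β₁ b₀ b₁ c₀ c₁ M : ℝ) : Bool → Bool → Bool → Bool → ℝ
  | false, false, false, _ => α₀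
  | true, false, false, _ => α₁
  | false, false, true, _ => β₀
  | true, false, true, _ => β₁
  | false, true, false, _ => b₀
  | true, true, false, _ => b₁
  | false, true, true, false => c₀
  | true, true, true, false => c₁
  | false, true, true, true => 0
  | true, true, true, true => M

/-- The mean of a cost over the output of the channel, up to terms of order `ε ^ 2`. -/
def flipCost (c : Bool → Bool → Bool → Bool → ℝ) (ε : ℝ) (a b d e : Bool) : ℝ :=
  c a b d e + ε * (c (!a) b d e + c a (!b) d e + c a b (!d) e + c a b d (!e) - 4 * c a b d e)

theorem abs_meanCost_sub_le {c : Bool → Bool → Bool → Bool → ℝ} {M : ℝ}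
    (hM : ∀ a b d e, |c a b d e| ≤ M) {ε : ℝ} (hε : ε ∈ Set.Icc (0 : ℝ) 1) (a b d e : Bool) :
    |meanCost c ε a b d e - flipCost c ε a b d e| ≤ 64 * ε ^ 2 * M := by
  have h := abs_bscMean_sub_flipSum_le hε ![a, b, d, e]
    (F := fun z => c (z 0) (z 1) (z 2) (z 3)) fun z => hM _ _ _ _
  have hf : flipSum ![a, b, d, e] (fun z => c (z 0) (z 1) (z 2) (z 3)) =
      c (!a) b d e + c a (!b) d e + c a b (!d) e + c a b d (!e) - 4 * c a b d e := by
    simp only [flipSum, Fin.sum_univ_four]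
    simp [Function.update]
    ring
  rw [hf, sub_sub] at h
  refine le_of_eq_of_le rfl (h.trans_eq ?_)
  change 4 * ((4 : ℕ) : ℝ) ^ 2 * ε ^ 2 * M = _
  push_cast
  ring

/-- U acts as a relative value function: the hypothesis is a Bellman inequality on admissible
windows, and along the word the potential differences telescope, leaving V per window and a bounded
boundary term. -/
theorem bscMean_windowCost_le {c : Bool → Bool → Bool → Bool → ℝ} {ε V B : ℝ}
    {U : Bool → Bool → Bool → ℝ} (hB : ∀ a b d, -B ≤ U a b d)
    (h : ∀ a b d e, (a && b) = false → (b && d) = false → (d && e) = false →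
      meanCost c ε a b d e + U b d e ≤ V + U a b d) (n : ℕ) (x : Fin (n + 3) → Bool)
    (hx : List.ofFn x ∈ rll 1 ⊤) :
    bscMean ε x (windowCost c (n + 3)) ≤ n * V + U (x 0) (x 1) (x 2) + B := by
  induction n with
  | zero =>
    have h0 : bscMean ε x (windowCost c (0 + 3)) = 0 := by simp [bscMean, windowCost]
    rw [h0]
    have := hB (x 0) (x 1) (x 2)
    push_cast
    linarith
  | succ n ih =>
    rw [bscMean_windowCost]
    have h1 := ofFn_mem_rll_succ hx
    have h2 := ofFn_mem_rll_succ h1.2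
    have h3 := ofFn_mem_rll_succ h2.2
    have := ih (Fin.tail x) h1.2
    have h' := h (x 0) (x 1) (x 2) (x 3) h1.1 h2.1 h3.1
    have e : U (Fin.tail x 0) (Fin.tail x 1) (Fin.tail x 2) = U (x 1) (x 2) (x 3) := rfl
    rw [e] at this
    push_cast
    linarith

/-- A dual certificate for the capacity: one nearly normalised conditional code, with mean cost at
most V per symbol on every admissible input up to a potential, bounds the output entropy of all
inputs at once. -/
theorem capacity_le_of_cost {c : Bool → Bool → Bool → Bool → ℝ} {ε V ζ : ℝ}
    (hε : ε ∈ Set.Icc (0 : ℝ) 1) (hζ : 0 ≤ ζ)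
    (hc : ∀ a b d, Real.exp (-c true a b d) + Real.exp (-c false a b d) ≤ 1 + ζ)
    {U : Bool → Bool → Bool → ℝ}
    (h : ∀ a b d e, (a && b) = false → (b && d) = false → (d && e) = false →
      meanCost c ε a b d e + U b d e ≤ V + U a b d) :
    constrainedCapacity (rll 1 ⊤) ε ≤ V + ζ - Real.binEntropy ε := by
  set B := ∑ p : Bool × Bool × Bool, |U p.1 p.2.1 p.2.2|
  have hB : ∀ a b d, |U a b d| ≤ B := fun a b d =>
    Finset.single_le_sum (f := fun p : Bool × Bool × Bool => |U p.1 p.2.1 p.2.2|)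
      (fun _ _ => abs_nonneg _) (Finset.mem_univ (a, b, d))
  refine capacity_le_of_forall hε 3 (b := 2 * B + Real.log 8 - 3 * Real.binEntropy ε)
    fun n P hP => ?_
  rw [mutualInfo_eq hP.1.2]
  have h1 := entropy_outputLaw_le hζ hc hε hP.1.1 hP.1.2
  have h2 : ∑ x, P x * bscMean ε x (windowCost c (n + 3)) ≤ ∑ x, P x * (n * V + 2 * B) := by
    refine Finset.sum_le_sum fun x _ => ?_
    rcases (hP.1.1 x).eq_or_lt with h0 | h0
    · simp [← h0]
    · refine mul_le_mul_of_nonneg_left ?_ h0.le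
      have := bscMean_windowCost_le (fun a b d => (abs_le.1 (hB a b d)).1) h n x (hP.2 x h0)
      linarith [(abs_le.1 (hB (x 0) (x 1) (x 2))).2]
  rw [← Finset.sum_mul, hP.1.2, one_mul] at h2
  push_cast
  linarith

/-! ### The upper bound for the capacity -/

theorem log_goldenRatio_pos : 0 < Real.log Real.goldenRatio :=
  Real.log_pos Real.one_lt_goldenRatio

theorem log_goldenRatio_lt_one : Real.log Real.goldenRatio < 1 := by
  have := Real.log_le_sub_one_of_pos Real.goldenRatio_pos
  linarith [Real.goldenRatio_lt_two]

theorem exp_neg_mul_log_goldenRatio (k : ℕ) :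
    Real.exp (-(k * Real.log Real.goldenRatio)) = (Real.goldenRatio - 1) ^ k := by
  rw [Real.exp_neg, Real.exp_nat_mul, Real.exp_log Real.goldenRatio_pos, ← inv_pow]
  congr 1
  rw [inv_eq_iff_eq_inv, eq_comm]
  apply inv_eq_of_mul_eq_one_right
  linarith [Real.goldenRatio_sq]

/-- At a = a' = 0 the weights are the leading-order conditional output probabilities for π = 1/λ²:
1/λ and 1/λ² after an output 0, about 1 and λε after a single 1, 2/λ² and 1/λ³ after exactly two
ones, 1 and ε² after longer runs. The shift +a on the cost log λ is compensated by -λa on the cost 2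
log λ, so only quadratic errors remain. -/
theorem runCost_golden_exp_le {ε a a' : ℝ} (hε : 0 < ε) (hL : 1 ≤ -Real.log ε)
    (ha : |a| ≤ 14 * (ε * -Real.log ε)) (ha' : |a'| ≤ 14 * (ε * -Real.log ε))
    (ht : 28 * (ε * -Real.log ε) ≤ 1) (p q r : Bool) :
    Real.exp (-runCost (Real.log Real.goldenRatio + a)
        (2 * Real.log Real.goldenRatio - Real.goldenRatio * a)
        (Real.log Real.goldenRatio + a') (2 * Real.log Real.goldenRatio - Real.goldenRatio * a')
        (Real.goldenRatio * ε) (-Real.log ε - Real.log Real.goldenRatio)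
        (2 * Real.log Real.goldenRatio - Real.log 2) (3 * Real.log Real.goldenRatio)
        (2 * -Real.log ε) true p q r) +
      Real.exp (-runCost (Real.log Real.goldenRatio + a)
        (2 * Real.log Real.goldenRatio - Real.goldenRatio * a)
        (Real.log Real.goldenRatio + a') (2 * Real.log Real.goldenRatio - Real.goldenRatio * a')
        (Real.goldenRatio * ε) (-Real.log ε - Real.log Real.goldenRatio)
        (2 * Real.log Real.goldenRatio - Real.log 2) (3 * Real.log Real.goldenRatio)
        (2 * -Real.log ε) false p q r) ≤
      1 + 1000 * (ε * -Real.log ε) ^ 2 := by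
  have e1 := exp_neg_mul_log_goldenRatio 1
  have e2 := exp_neg_mul_log_goldenRatio 2
  have e3 := exp_neg_mul_log_goldenRatio 3
  have hl1 := Real.one_lt_goldenRatio
  have hl2 := Real.goldenRatio_lt_two
  have hsq := Real.goldenRatio_sq
  have hpos : Real.exp (Real.log Real.goldenRatio) = Real.goldenRatio :=
    Real.exp_log Real.goldenRatio_pos
  set g := Real.goldenRatio
  set l := Real.log g
  set t := ε * -Real.log ε with htdef
  have hεt : ε ≤ t := le_mul_of_one_le_right hε.le hL
  have key : ∀ y : ℝ, |y| ≤ 14 * t →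
      Real.exp (-(2 * l - g * y)) + Real.exp (-(l + y)) ≤ 1 + 1000 * t ^ 2 := by
    intro y hy
    have hy' := abs_le.1 hy
    have hy2 : y ^ 2 ≤ (14 * t) ^ 2 := by
      rw [← sq_abs]
      exact pow_le_pow_left₀ (abs_nonneg _) hy 2
    -- The assumption 28t ≤ 1 keeps g·y ≤ 1, the range of the quadratic bound for the exponential.
    have h1 := exp_le_one_add_add_sq (y := g * y) (by nlinarith)
    have h2 := exp_le_one_add_add_sq (y := -y) (by linarith)
    push_cast at e1 e2
    rw [show -(2 * l - g * y) = -(2 * l) + g * y by ring, Real.exp_add, e2,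
      show -(l + y) = -(1 * l) + -y by ring, Real.exp_add, e1]
    have h3 := mul_le_mul_of_nonneg_left h1 (sq_nonneg (g - 1))
    have h4 := mul_le_mul_of_nonneg_left h2 (show 0 ≤ (g - 1) ^ 1 by simp; linarith)
    have e : (g - 1) ^ 2 * (1 + g * y + (g * y) ^ 2) + (g - 1) ^ 1 * (1 + -y + (-y) ^ 2) =
        1 + g * y ^ 2 := by
      linear_combination (1 + y * (g - 1) + y ^ 2 * (g ^ 2 - g + 1)) * hsq
    nlinarith [sq_nonneg y]
  cases p <;> cases q
  · simpa only [runCost] using key a ha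
  · simpa only [runCost] using key a' ha'
  · simp only [runCost]
    have h1 : Real.exp (-(-Real.log ε - l)) = ε * g := by
      rw [show -(-Real.log ε - l) = Real.log ε + l by ring, Real.exp_add, Real.exp_log hε, hpos]
    have h2 := exp_le_one_add_add_sq (y := -(g * ε)) (by nlinarith)
    rw [h1]
    nlinarith [sq_nonneg ε]
  · cases r
    · simp only [runCost]
      push_cast at e2 e3
      rw [e3, show -(2 * l - Real.log 2) = -(2 * l) + Real.log 2 by ring, Real.exp_add, e2,
        Real.exp_log two_pos]
      have : (g - 1) ^ 3 + (g - 1) ^ 2 * 2 = 1 := by linear_combination g * hsq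
      rw [this]
      nlinarith [sq_nonneg t]
    · simp only [runCost]
      rw [show -(2 * -Real.log ε) = Real.log ε + Real.log ε by ring, Real.exp_add,
        Real.exp_log hε]
      simp only [neg_zero, Real.exp_zero]
      nlinarith

theorem abs_runCost_golden_le {ε a a' : ℝ} (hL : 1 ≤ -Real.log ε) (hε : 0 < ε) (hε1 : ε ≤ 1)
    (ha : |a| ≤ 1 / 2) (ha' : |a'| ≤ 1 / 2) (p q r s : Bool) :
    |runCost (Real.log Real.goldenRatio + a)
        (2 * Real.log Real.goldenRatio - Real.goldenRatio * a)
        (Real.log Real.goldenRatio + a') (2 * Real.log Real.goldenRatio - Real.goldenRatio * a')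
        (Real.goldenRatio * ε) (-Real.log ε - Real.log Real.goldenRatio)
        (2 * Real.log Real.goldenRatio - Real.log 2) (3 * Real.log Real.goldenRatio)
        (2 * -Real.log ε) p q r s| ≤ 3 * -Real.log ε := by
  have hl1 := Real.one_lt_goldenRatio
  have hl2 := Real.goldenRatio_lt_two
  have h1 := log_goldenRatio_lt_one
  have h0 := log_goldenRatio_pos
  have h2 := Real.log_pos one_lt_two
  have h3 := Real.log_two_lt_d9
  have h4 := abs_le.1 ha
  have h5 := abs_le.1 ha'
  cases p <;> cases q <;> cases r <;> cases s <;> simp only [runCost] <;> rw [abs_le] <;>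
    constructor <;> nlinarith

/-- The shifts and U solve the eight window relations as equalities up to O(t²). Six of them hold
identically by the choice of U; the windows 0101 and 0100 give the two linear equations `ha4` and
`ha5` for a and a'. The bounds `r1` to `r5` absorb products of ε with quantities of order t, and
192t² is room for the second-order error of the mean cost. -/
theorem golden_window_le {ε l l2 L a a' g t : ℝ}
    (ha4 : g * a' = ε * (g + L) - 2 * a)
    (ha5 : a' - 3 * a - g * a + ε * (2 * L + g - 2 * l2) = 0)
    (r1 : -(14 * t ^ 2) ≤ ε * a ∧ ε * a ≤ 14 * t ^ 2)
    (r2 : -(14 * t ^ 2) ≤ ε * a' ∧ ε * a' ≤ 14 * t ^ 2)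
    (r3 : -(4 * t ^ 2) ≤ ε * (g * a) ∧ ε * (g * a) ≤ 4 * t ^ 2)
    (r4 : -(7 * t ^ 2) ≤ ε * (g * a') ∧ ε * (g * a') ≤ 7 * t ^ 2)
    (r5 : -(2 * t ^ 2) ≤ ε * (g * ε) ∧ ε * (g * ε) ≤ 2 * t ^ 2)
    {c : Bool → Bool → Bool → Bool → ℝ}
    (hc : c = runCost (l + a) (2 * l - g * a) (l + a') (2 * l - g * a') (g * ε) (L - l)
      (2 * l - l2) (3 * l) (2 * L))
    {U : Bool → Bool → Bool → ℝ}
    (hU : U = fun p q r =>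
      if p then (if r then l - a' - g * a' - ε * (2 * l - l2)
        else l - a - g * a + ε * (L - 4 * l))
      else if q then a - a' - ε * (2 * l - l2) else 0)
    (p q r s : Bool) (h1 : (p && q) = false) (h2 : (q && r) = false) (h3 : (r && s) = false) :
    flipCost c ε p q r s + 192 * t ^ 2 + U q r s ≤ l + a + 400 * t ^ 2 + U p q r := by
  have ht : 0 ≤ t ^ 2 := sq_nonneg t
  subst hc hU
  revert p q r s
  simp only [Bool.forall_bool, Bool.and_false, Bool.and_true,
    Bool.true_eq_false, IsEmpty.forall_iff, forall_const, and_true, flipCost, runCost,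
    Bool.not_true, Bool.not_false, if_true, if_false, Bool.false_eq_true]
  refine ⟨⟨⟨?_, ?_⟩, ?_⟩, ?_⟩
  all_goals (try constructor)
  all_goals (try constructor)
  all_goals linarith

theorem abs_golden_shift_le {ε l2 L a a' g t : ℝ} (hg1 : 1 < g) (hg2 : g < 2) (hε : 0 < ε)
    (hL : 1 ≤ L) (ht : t = ε * L) (hl0 : 0 < l2) (hl1 : l2 < 1)
    (ha3 : a * (3 * g + 1) = ε * ((g + 1) * (L + 1) - 2 * l2))
    (ha' : a' = (g - 1) * (ε * (g + L) - 2 * a))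
    (ha4 : g * a' = ε * (g + L) - 2 * a) :
    |a| ≤ 2 * t ∧ |g * a| ≤ 4 * t ∧ |g * a'| ≤ 7 * t ∧ |a'| ≤ 7 * t := by
  have hεt : ε ≤ t := ht ▸ le_mul_of_one_le_right hε.le hL
  have hge : g * ε ≤ g * t := mul_le_mul_of_nonneg_left hεt (by linarith)
  have hge0 : 0 < g * ε := by positivity
  have hgt : g * t ≤ 2 * t := mul_le_mul_of_nonneg_right hg2.le (by linarith)
  have hgt1 : 1 * t ≤ g * t := mul_le_mul_of_nonneg_right hg1.le (by linarith)
  have hl : ε * l2 ≤ ε * 1 := mul_le_mul_of_nonneg_left hl1.le hε.le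
  have hl' : 0 < ε * l2 := by positivity
  have e : a * (3 * g + 1) = g * t + g * ε + t + ε - 2 * (ε * l2) := by
    rw [ha3, ht]
    ring
  have hU : a ≤ 2 * t := le_of_mul_le_mul_right (by linarith) (by linarith : 0 < 3 * g + 1)
  have hD : -(2 * t) ≤ a := le_of_mul_le_mul_right (by linarith) (by linarith : 0 < 3 * g + 1)
  have hA : |a| ≤ 2 * t := abs_le.2 ⟨hD, hU⟩
  have h4 : g * a' = g * ε + t - 2 * a := by
    rw [ha4, ht]
    ring
  have h7 : |g * a'| ≤ 7 * t := by
    rw [h4]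
    exact abs_le.2 ⟨by linarith, by linarith⟩
  refine ⟨hA, ?_, h7, ?_⟩
  · rw [abs_mul, abs_of_pos (by linarith : 0 < g)]
    calc g * |a| ≤ 2 * (2 * t) := mul_le_mul hg2.le hA (abs_nonneg _) (by norm_num)
      _ = 4 * t := by ring
  · rw [ha', ← ha4, abs_mul, abs_of_pos (by linarith : 0 < g - 1)]
    calc (g - 1) * |g * a'| ≤ 1 * (7 * t) :=
          mul_le_mul (by linarith) h7 (abs_nonneg _) (by norm_num)
      _ = 7 * t := by ring

theorem capacity_upper_bound_aux {ε : ℝ} (hε : 0 < ε) (hL : 1 ≤ -Real.log ε)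
    (ht : 28 * (ε * -Real.log ε) ≤ 1) :
    constrainedCapacity (rll 1 ⊤) ε ≤ Real.log Real.goldenRatio +
      ε * ((Real.goldenRatio + 1) * (-Real.log ε + 1) - 2 * Real.log 2) /
        (3 * Real.goldenRatio + 1) - Real.binEntropy ε + 1500 * (ε * -Real.log ε) ^ 2 := by
  have hl1 := Real.one_lt_goldenRatio
  have hl2 := Real.goldenRatio_lt_two
  have hsq := Real.goldenRatio_sq
  have hlog1 := log_goldenRatio_lt_one
  have hlog0 := log_goldenRatio_pos
  have h2pos := Real.log_pos one_lt_two
  have h2lt := Real.log_two_lt_d9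
  -- The pair (a, a') is the solution of the linear system `ha4`, `ha5`, and `ha3` is its eliminated
  -- form. The factor λ - 1 in a' is 1/λ. This a is exactly the first-order correction to log λ,
  -- before H(ε) is subtracted.
  set a := ε * ((Real.goldenRatio + 1) * (-Real.log ε + 1) - 2 * Real.log 2) /
        (3 * Real.goldenRatio + 1) with ha_def
  set a' := (Real.goldenRatio - 1) * (ε * (Real.goldenRatio + -Real.log ε) - 2 * a) with ha'_def
  have hεt : ε ≤ ε * -Real.log ε := le_mul_of_one_le_right hε.le hL
  have hε1 : ε ≤ 1 := by linarith
  have ha3 : a * (3 * Real.goldenRatio + 1) =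
      ε * ((Real.goldenRatio + 1) * (-Real.log ε + 1) - 2 * Real.log 2) :=
    div_mul_cancel₀ _ (by positivity)
  have ha4 : Real.goldenRatio * a' = ε * (Real.goldenRatio + -Real.log ε) - 2 * a := by
    rw [ha'_def]
    linear_combination (ε * (Real.goldenRatio + -Real.log ε) - 2 * a) * hsq
  have ha5 : a' - 3 * a - Real.goldenRatio * a +
      ε * (2 * -Real.log ε + Real.goldenRatio - 2 * Real.log 2) = 0 := by
    rw [ha'_def]
    linear_combination ε * hsq - ha3
  have hA := abs_runCost_golden_le (a := a) (a' := a') hL hε hε1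
  have hE := runCost_golden_exp_le (a := a) (a' := a') hε hL
  set g := Real.goldenRatio
  set l := Real.log g
  set L := -Real.log ε
  set t := ε * L with htdef
  obtain ⟨hA1, hga, hga', hA2⟩ :=
    abs_golden_shift_le hl1 hl2 hε hL htdef h2pos (by linarith) ha3 ha'_def ha4
  have hgε0 : 0 < g * ε := by positivity
  have hgε : g * ε ≤ 2 * t := mul_le_mul hl2.le hεt hε.le (by norm_num)
  have ht0 : 0 < t := by linarith
  have haA : |a| ≤ 14 * t := by linarith
  have ha'U : |a'| ≤ 14 * t := by linarith
  have hE' := hE haA ha'U ht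
  have hA' := hA (by linarith) (by linarith)
  have hεt2 : ε * t ≤ t ^ 2 := by
    rw [sq]
    exact mul_le_mul_of_nonneg_right hεt ht0.le
  have herr : ∀ y k : ℝ, |y| ≤ k * t → 0 ≤ k → |ε * y| ≤ k * t ^ 2 := by
    intro y k hy hk
    rw [abs_mul, abs_of_pos hε]
    calc ε * |y| ≤ ε * (k * t) := mul_le_mul_of_nonneg_left hy hε.le
      _ = k * (ε * t) := by ring
      _ ≤ k * t ^ 2 := mul_le_mul_of_nonneg_left hεt2 hk
  have r1 := abs_le.1 (herr a 14 haA (by norm_num))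
  have r2 := abs_le.1 (herr a' 14 ha'U (by norm_num))
  have r3 := abs_le.1 (herr (g * a) 4 hga (by norm_num))
  have r4 := abs_le.1 (herr (g * a') 7 hga' (by norm_num))
  have r5 := abs_le.1 (herr (g * ε) 2 (by rw [abs_of_pos hgε0]; exact hgε) (by norm_num))
  have r6 : 64 * ε ^ 2 * (3 * L) ≤ 192 * t ^ 2 := by
    rw [show 64 * ε ^ 2 * (3 * L) = 192 * (ε * t) by rw [htdef]; ring]
    linarith
  refine (capacity_le_of_cost (V := l + a + 400 * t ^ 2) ⟨hε.le, hε1⟩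
    (by positivity : (0 : ℝ) ≤ 1000 * t ^ 2) hE' (U := fun p q r =>
      if p then (if r then l - a' - g * a' - ε * (2 * l - Real.log 2)
        else l - a - g * a + ε * (L - 4 * l))
      else if q then a - a' - ε * (2 * l - Real.log 2) else 0)
      fun p q r s h1 h2 h3 => ?_).trans (by nlinarith [sq_nonneg t])
  have hm := (abs_le.1 (abs_meanCost_sub_le hA' ⟨hε.le, hε1⟩ p q r s)).2
  have := golden_window_le (l := l) (l2 := Real.log 2) ha4 ha5 r1 r2 r3 r4 r5 rfl rfl p q r s h1 h2 h3
  linarith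

/-! ### The upper bound for the entropy rate of the output -/

theorem IsStationaryFamily.sum_window {p : WordLaw} (hp : IsStationaryFamily p)
    (f : Bool → Bool → Bool → Bool → ℝ) (n : ℕ) :
    ∑ x : Fin (n + 4) → Bool, p (n + 4) x * f (x 0) (x 1) (x 2) (x 3) =
      ∑ x : Fin 4 → Bool, p 4 x * f (x 0) (x 1) (x 2) (x 3) := by
  induction n with
  | zero => rfl
  | succ n ih =>
    rw [← ih, sum_words_snoc]
    refine Finset.sum_congr rfl fun w _ => ?_
    rw [← hp.sum_snoc, Finset.sum_mul]
    refine Finset.sum_congr rfl fun b _ => ?_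
    have h : ∀ i : Fin (n + 4), extendWord w b i.castSucc = w i := fun i => by
      simp [extendWord]
    have h0 := h 0
    have h1 := h 1
    have h2 := h 2
    have h3 := h 3
    have e1 : (1 : Fin (n + 4)).castSucc = 1 := rfl
    have e2 : (2 : Fin (n + 4)).castSucc = 2 := rfl
    have e3 : (3 : Fin (n + 4)).castSucc = 3 := rfl
    rw [Fin.castSucc_zero] at h0
    rw [e1] at h1
    rw [e2] at h2
    rw [e3] at h3
    rw [← h0, ← h1, ← h2, ← h3]

theorem IsStationaryFamily.sum_bscMean_windowCost {p : WordLaw} (hp : IsStationaryFamily p)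
    (c : Bool → Bool → Bool → Bool → ℝ) (ε : ℝ) (n : ℕ) :
    ∑ x, p (n + 3) x * bscMean ε x (windowCost c (n + 3)) =
      n * ∑ x : Fin 4 → Bool, p 4 x * meanCost c ε (x 0) (x 1) (x 2) (x 3) := by
  induction n with
  | zero => simp [bscMean, windowCost]
  | succ n ih =>
    simp only [bscMean_windowCost, mul_add, Finset.sum_add_distrib]
    have h : ∑ x, p (n + 1 + 3) x * bscMean ε (Fin.tail x) (windowCost c (n + 3)) =
        ∑ x, p (n + 3) x * bscMean ε x (windowCost c (n + 3)) := by
      rw [sum_words_cons, Finset.sum_comm]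
      refine Finset.sum_congr rfl fun w _ => ?_
      rw [← hp.sum_cons, Finset.sum_mul]
      simp only [Fin.tail_cons]
    rw [h, ih]
    have := hp.sum_window (meanCost c ε) n
    rw [this]
    push_cast
    ring

/-- For a fixed stationary input no potential is needed: stationarity gives every window the law of
four consecutive symbols. -/
theorem IsStationaryFamily.entropyRate_output_le {p : WordLaw} (hp : IsStationaryFamily p)
    {c : Bool → Bool → Bool → Bool → ℝ} {ε ζ M : ℝ}
    (hε : ε ∈ Set.Icc (0 : ℝ) 1) (hζ : 0 ≤ ζ)
    (hc : ∀ a b d, Real.exp (-c true a b d) + Real.exp (-c false a b d) ≤ 1 + ζ)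
    (hM : ∀ a b d e, |c a b d e| ≤ M) :
    entropyRate (outputProcess ε p) ≤
      ∑ x : Fin 4 → Bool, p 4 x * flipCost c ε (x 0) (x 1) (x 2) (x 3) + 64 * ε ^ 2 * M + ζ := by
  have h1 : entropyRate (outputProcess ε p) ≤
      ∑ x : Fin 4 → Bool, p 4 x * meanCost c ε (x 0) (x 1) (x 2) (x 3) + ζ := by
    refine le_of_tendsto_affine (u := fun n => entropy (outputProcess ε p n)) (b := Real.log 8)
      (hp.tendsto_blockEntropy_output hε) 3 fun n => ?_
    refine (entropy_outputLaw_le hζ hc hε (hp.nonneg _) (hp.sum_eq_one _)).trans_eq ?_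
    rw [hp.sum_bscMean_windowCost]
    ring
  have h2 : ∑ x : Fin 4 → Bool, p 4 x * meanCost c ε (x 0) (x 1) (x 2) (x 3) ≤
      ∑ x : Fin 4 → Bool, p 4 x * (flipCost c ε (x 0) (x 1) (x 2) (x 3) + 64 * ε ^ 2 * M) := by
    refine Finset.sum_le_sum fun x _ => mul_le_mul_of_nonneg_left ?_ (hp.nonneg _ _)
    have := (abs_le.1 (abs_meanCost_sub_le hM hε (x 0) (x 1) (x 2) (x 3))).2
    linarith
  simp only [mul_add, Finset.sum_add_distrib, ← Finset.sum_mul, hp.sum_eq_one, one_mul] at h2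
  linarith

/-- The weights approximate the conditional probabilities of the output of the chain: 1 - π and π
after an output 0; (2 - π)ε for a 1 after a single 1; 2(1 - π)/(2 - π) and π/(2 - π) after exactly
two ones; and ε² as a token weight for a 0-to-1-free run to continue being violated, that is, for a
further 1 after three ones. -/
theorem exp_runCost_le {π ε : ℝ} (h0 : 0 < π) (h1 : π < 1) (hε : 0 < ε) (p q r : Bool) :
    Real.exp (-runCost (-Real.log (1 - π)) (-Real.log π) (-Real.log (1 - π)) (-Real.log π)
        ((2 - π) * ε) (-Real.log ε - Real.log (2 - π))
        (-Real.log (1 - π) - Real.log 2 + Real.log (2 - π)) (-Real.log π + Real.log (2 - π))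
        (2 * -Real.log ε) true p q r) +
      Real.exp (-runCost (-Real.log (1 - π)) (-Real.log π) (-Real.log (1 - π)) (-Real.log π)
        ((2 - π) * ε) (-Real.log ε - Real.log (2 - π))
        (-Real.log (1 - π) - Real.log 2 + Real.log (2 - π)) (-Real.log π + Real.log (2 - π))
        (2 * -Real.log ε) false p q r) ≤ 1 + 4 * ε ^ 2 := by
  have h1' : 0 < 1 - π := by linarith
  have h2' : 0 < 2 - π := by linarith
  have hm : Real.exp (- -Real.log π) + Real.exp (- -Real.log (1 - π)) ≤ 1 + 4 * ε ^ 2 := by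
    rw [neg_neg, neg_neg, Real.exp_log h0, Real.exp_log h1']
    nlinarith [sq_nonneg ε]
  cases p
  · cases q <;> simpa only [runCost] using hm
  · cases q
    · simp only [runCost]
      have := exp_le_one_add_add_sq (y := -((2 - π) * ε)) (by nlinarith)
      rw [show -(-Real.log ε - Real.log (2 - π)) = Real.log ε + Real.log (2 - π) by ring,
        Real.exp_add, Real.exp_log hε, Real.exp_log h2']
      have : (2 - π) ^ 2 * ε ^ 2 ≤ 2 ^ 2 * ε ^ 2 :=
        mul_le_mul_of_nonneg_right (pow_le_pow_left₀ h2'.le (by linarith) 2) (sq_nonneg ε)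
      linarith
    · cases r
      · simp only [runCost]
        rw [show -(-Real.log π + Real.log (2 - π)) = Real.log π - Real.log (2 - π) by ring,
          show -(-Real.log (1 - π) - Real.log 2 + Real.log (2 - π)) =
            Real.log (1 - π) + Real.log 2 - Real.log (2 - π) by ring, Real.exp_sub, Real.exp_sub,
          Real.exp_add, Real.exp_log h0, Real.exp_log h1', Real.exp_log h2',
          Real.exp_log two_pos, ← add_div, div_le_iff₀ h2']
        nlinarith [sq_nonneg ε, mul_nonneg h2'.le (sq_nonneg ε)]
      · simp only [runCost]
        rw [show -(2 * -Real.log ε) = Real.log ε + Real.log ε by ring, Real.exp_add,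
          Real.exp_log hε]
        simp only [neg_zero, Real.exp_zero]
        nlinarith [sq_nonneg ε]

theorem sum_rllChain_four (π : ℝ) (F : Bool → Bool → Bool → Bool → ℝ) :
    ∑ x : Fin 4 → Bool, rllChain π 4 x * F (x 0) (x 1) (x 2) (x 3) =
      ((1 - π) ^ 3 * F false false false false +
        (1 - π) ^ 2 * π * (F false false false true + F true false false false) +
        (1 - π) * π * (F false false true false + F false true false false) +
        π ^ 2 * (F false true false true + F true false true false) +
        (1 - π) * π ^ 2 * F true false false true) / (1 + π) := by
  have h : ∀ a b c d, rllChain π 4 (Fin.cons a (Fin.cons b (Fin.cons c (Fin.cons d Fin.elim0)))) *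
      F a b c d = rllStationary π a * (rllMatrix π a b * (rllMatrix π b c *
        (rllMatrix π c d * 1))) * F a b c d := fun a b c d => by
    rw [rllChain, markovLaw_cons]
    rfl
  simp only [sum_words_cons, sum_words_zero]
  refine Eq.trans (Finset.sum_congr rfl fun a _ => Finset.sum_congr rfl fun b _ =>
    Finset.sum_congr rfl fun c _ => Finset.sum_congr rfl fun d _ => h a b c d) ?_
  simp only [Fintype.sum_bool, rllStationary, rllMatrix]
  ring

/-- The coefficient of `ε` in the entropy rate of the output. -/
noncomputable def rllG (π : ℝ) : ℝ :=
  (2 * π - π ^ 2 - (2 * π - 2 * π ^ 2) * Real.log 2 + (-1 + 3 * π - π ^ 2) * Real.log π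
    + (2 - 6 * π + 2 * π ^ 2) * Real.log (1 - π)) / (1 + π)

theorem entropyRate_output_rllChain_le {π ε : ℝ} (h0 : 0 < π) (h1 : π < 1) (hε : 0 < ε)
    (hL : 1 ≤ -Real.log ε) (hε1 : ε ≤ 1) :
    entropyRate (outputProcess ε (rllChain π)) ≤ Real.binEntropy π / (1 + π) +
      π * (2 - π) / (1 + π) * ε * -Real.log ε + rllG π * ε +
        (64 * (6 - Real.log π - Real.log (1 - π)) + 6) * (ε ^ 2 * -Real.log ε) := by
  have hlog0 := Real.log_nonpos h0.le h1.le
  have hlog1 := Real.log_nonpos (by linarith : 0 ≤ 1 - π) (by linarith)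
  have hlog2 := Real.log_nonneg (by linarith : 1 ≤ 2 - π)
  have hlog2' : Real.log (2 - π) ≤ 1 :=
    (Real.log_le_sub_one_of_pos (by linarith)).trans (by linarith)
  have hl2 : 0 < Real.log 2 := Real.log_pos one_lt_two
  have hl2' := Real.log_two_lt_d9
  have hA : ∀ a b d e, |runCost (-Real.log (1 - π)) (-Real.log π) (-Real.log (1 - π))
      (-Real.log π) ((2 - π) * ε) (-Real.log ε - Real.log (2 - π))
      (-Real.log (1 - π) - Real.log 2 + Real.log (2 - π)) (-Real.log π + Real.log (2 - π))
      (2 * -Real.log ε) a b d e| ≤ (6 - Real.log π - Real.log (1 - π)) * -Real.log ε := by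
    have hx : -Real.log π * 1 ≤ -Real.log π * -Real.log ε :=
      mul_le_mul_of_nonneg_left hL (by linarith)
    have hy : -Real.log (1 - π) * 1 ≤ -Real.log (1 - π) * -Real.log ε :=
      mul_le_mul_of_nonneg_left hL (by linarith)
    have hz : (2 - π) * ε ≤ 2 * 1 := mul_le_mul (by linarith) hε1 hε.le (by norm_num)
    have hz' : 0 < (2 - π) * ε := mul_pos (by linarith) hε
    intro a b d e
    cases a <;> cases b <;> cases d <;> cases e <;> simp only [runCost] <;> rw [abs_le] <;>
      constructor <;> linarith
  have h := (isStationaryFamily_rllChain ⟨h0.le, h1.le⟩).entropyRate_output_le ⟨hε.le, hε1⟩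
    (by positivity) (exp_runCost_le h0 h1 hε) hA
  refine h.trans ?_
  rw [sum_rllChain_four]
  have hb : Real.binEntropy π = π * -Real.log π + (1 - π) * -Real.log (1 - π) := by
    rw [Real.binEntropy_eq_negMulLog_add_negMulLog_one_sub, Real.negMulLog, Real.negMulLog]
    ring
  have hεL : ε ^ 2 * 1 ≤ ε ^ 2 * -Real.log ε := mul_le_mul_of_nonneg_left hL (sq_nonneg ε)
  -- The cost (2 - π)ε of a 0 after a single 1 is itself of order ε; its first-order flip terms
  -- leave this coefficient at ε². Together with the defect 4ε² it accounts for the 6 in the error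
  -- constant.
  have hκ : (2 - π) * ((1 - π) ^ 2 - 3 * π) / (1 + π) ≤ 2 := by
    rw [div_le_iff₀ (by linarith)]
    nlinarith [mul_pos h0 h0, mul_pos h0 (mul_pos h0 h0)]
  have hκ' := mul_le_mul_of_nonneg_right hκ (sq_nonneg ε)
  have hπ : 1 + π ≠ 0 := by linarith
  rw [hb]
  calc _ = (π * -Real.log π + (1 - π) * -Real.log (1 - π)) / (1 + π) +
      π * (2 - π) / (1 + π) * ε * -Real.log ε + rllG π * ε +
      (2 - π) * ((1 - π) ^ 2 - 3 * π) / (1 + π) * ε ^ 2 +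
      64 * (6 - Real.log π - Real.log (1 - π)) * (ε ^ 2 * -Real.log ε) + 4 * ε ^ 2 := by
        simp only [flipCost, runCost, Bool.not_true, Bool.not_false, rllG]
        field_simp
        ring
    _ ≤ _ := by linarith

/-! ### Bounding the equivocation by a decoder -/

/-- Gibbs' inequality for the joint law of (X, Z) against P(z) exp(-D(x, z)). The joint entropy is
H(X) + nH(ε), so this bounds the equivocation H(X | Z) by the mean cost of any decoder that is
nearly normalised for every output. -/
theorem entropy_add_le_of_decoder {ε : ℝ} (hε : ε ∈ Set.Icc (0 : ℝ) 1) {n : ℕ}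
    {P : (Fin n → Bool) → ℝ} (hP : ∀ w, 0 ≤ P w) (h1 : ∑ w, P w = 1)
    (D : (Fin n → Bool) → (Fin n → Bool) → ℝ) {Z : ℝ} (hZ0 : 0 < Z)
    (hD : ∀ z, ∑ x, Real.exp (-D x z) ≤ Z) :
    entropy P + n * Real.binEntropy ε ≤
      entropy (outputLaw ε P) + ∑ x, P x * bscMean ε x (D x) + Real.log Z := by
  have hW := transitionProb_nonneg hε (n := n)
  have hz : ∀ x z, outputLaw ε P z = 0 → P x * transitionProb 0 ε x z = 0 := fun x z h =>
    (Finset.sum_eq_zero_iff_of_nonneg fun x _ => mul_nonneg (hP x) (hW x z)).1 h x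
      (Finset.mem_univ x)
  have h := gibbs (P := fun p : (Fin n → Bool) × (Fin n → Bool) =>
      P p.1 * transitionProb 0 ε p.1 p.2)
    (Q := fun p => outputLaw ε P p.2 * Real.exp (-D p.1 p.2))
    (fun p => mul_nonneg (hP _) (hW _ _))
    (fun p => mul_nonneg (outputLaw_nonneg hε hP _) (Real.exp_pos _).le)
    (by simp only [Fintype.sum_prod_type, ← Finset.mul_sum, sum_transitionProb, mul_one, h1])
    (Z := Z) (by
      rw [Fintype.sum_prod_type, Finset.sum_comm]
      simp only [← Finset.mul_sum]
      calc _ ≤ ∑ z, outputLaw ε P z * Z := Finset.sum_le_sum fun z _ =>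
            mul_le_mul_of_nonneg_left (hD z) (outputLaw_nonneg hε hP z)
        _ = Z := by rw [← Finset.sum_mul, sum_outputLaw, h1, one_mul])
    hZ0 (fun p hp => hz _ _ ((mul_eq_zero.1 hp).resolve_right (Real.exp_ne_zero _)))
  rw [entropy_joint h1] at h
  have e : ∀ x z, P x * transitionProb 0 ε x z *
      Real.log (outputLaw ε P z * Real.exp (-D x z)) =
      P x * transitionProb 0 ε x z * Real.log (outputLaw ε P z) -
        P x * (transitionProb 0 ε x z * D x z) := by
    intro x z
    by_cases h0 : outputLaw ε P z = 0
    · rw [← mul_assoc, hz x z h0]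
      simp
    · rw [Real.log_mul h0 (Real.exp_ne_zero _), Real.log_exp]
      ring
  simp only [Fintype.sum_prod_type, e, Finset.sum_sub_distrib] at h
  rw [Finset.sum_comm (f := fun x z => P x * transitionProb 0 ε x z *
    Real.log (outputLaw ε P z))] at h
  simp only [← Finset.sum_mul, ← Finset.mul_sum] at h
  have e2 : entropy (outputLaw ε P) =
      -∑ z, (∑ x, P x * transitionProb 0 ε x z) * Real.log (outputLaw ε P z) := rfl
  have e3 : ∀ x, bscMean ε x (D x) = ∑ z, transitionProb 0 ε x z * D x z := fun x => rfl
  simp only [e2, e3]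
  linarith

/-- The sum along a word of the cost `r` of an input symbol, given the preceding input symbol and
three output symbols. -/
def decodeCost (r : Bool → Bool → Bool → Bool → Bool → ℝ) :
    (n : ℕ) → Bool → (Fin n → Bool) → (Fin n → Bool) → ℝ
  | n + 3, s, x, z =>
    r s (x 0) (z 0) (z 1) (z 2) + decodeCost r (n + 2) (x 0) (Fin.tail x) (Fin.tail z)
  | 2, _, _, _ => 0
  | 1, _, _, _ => 0
  | 0, _, _, _ => 0

/-- Here the word is decoded forwards, the state being the input symbol just decoded. The 4 counts
the last two input symbols, which are not charged. -/
theorem sum_exp_decodeCost_le {r : Bool → Bool → Bool → Bool → Bool → ℝ} {Z : ℝ}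
    (hr : ∀ s a b c, Real.exp (-r s true a b c) + Real.exp (-r s false a b c) ≤ Z) (n : ℕ)
    (s : Bool) (z : Fin (n + 2) → Bool) :
    ∑ x, Real.exp (-decodeCost r (n + 2) s x z) ≤ 4 * Z ^ n := by
  induction n generalizing s with
  | zero => simp [decodeCost]
  | succ n ih =>
    have hZ : 0 ≤ Z := le_trans (by positivity) (hr true true true true)
    have h : ∀ b (x : Fin (n + 2) → Bool),
        Real.exp (-decodeCost r (n + 1 + 2) s (Fin.cons b x) z) =
          Real.exp (-r s b (z 0) (z 1) (z 2)) *
            Real.exp (-decodeCost r (n + 2) b x (Fin.tail z)) := by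
      intro b x
      rw [← Real.exp_add, ← neg_add]
      rfl
    rw [sum_words_cons, Fintype.sum_bool]
    simp only [h, ← Finset.mul_sum]
    calc _ ≤ Real.exp (-r s true (z 0) (z 1) (z 2)) * (4 * Z ^ n) +
          Real.exp (-r s false (z 0) (z 1) (z 2)) * (4 * Z ^ n) :=
          add_le_add (mul_le_mul_of_nonneg_left (ih _ _) (Real.exp_pos _).le)
            (mul_le_mul_of_nonneg_left (ih _ _) (Real.exp_pos _).le)
      _ = (Real.exp (-r s true (z 0) (z 1) (z 2)) + Real.exp (-r s false (z 0) (z 1) (z 2))) *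
          (4 * Z ^ n) := by ring
      _ ≤ Z * (4 * Z ^ n) := mul_le_mul_of_nonneg_right (hr _ _ _ _) (by positivity)
      _ = 4 * Z ^ (n + 1) := by ring

theorem bscMean_three (f : Bool → Bool → Bool → ℝ) (ε : ℝ) {n : ℕ} (x : Fin (n + 3) → Bool) :
    bscMean ε x (fun z => f (z 0) (z 1) (z 2)) =
      bscMean ε ![x 0, x 1, x 2] fun z => f (z 0) (z 1) (z 2) := by
  obtain ⟨a, x, rfl⟩ := exists_cons x
  obtain ⟨b, x, rfl⟩ := exists_cons x
  obtain ⟨d, x, rfl⟩ := exists_cons x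
  have h1 : ∀ {m : ℕ} (u v w : Bool) (z : Fin m → Bool),
      (Fin.cons u (Fin.cons v (Fin.cons w z)) : Fin (m + 3) → Bool) 1 = v :=
    fun _ _ _ _ => rfl
  have h2 : ∀ {m : ℕ} (u v w : Bool) (z : Fin m → Bool),
      (Fin.cons u (Fin.cons v (Fin.cons w z)) : Fin (m + 3) → Bool) 2 = w :=
    fun _ _ _ _ => rfl
  have h : ∀ {m : ℕ} (y : Fin m → Bool),
      bscMean ε (Fin.cons a (Fin.cons b (Fin.cons d y)) : Fin (m + 3) → Bool)
        (fun z => f (z 0) (z 1) (z 2)) =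
      (fun p q r => (1 - ε) * ((1 - ε) * ((1 - ε) * f p q r + ε * f p q (!r))
        + ε * ((1 - ε) * f p (!q) r + ε * f p (!q) (!r)))
        + ε * ((1 - ε) * ((1 - ε) * f (!p) q r + ε * f (!p) q (!r))
        + ε * ((1 - ε) * f (!p) (!q) r + ε * f (!p) (!q) (!r)))) a b d := by
    intro m y
    simp only [bscMean_cons, Fin.cons_zero, h1, h2, bscMean_const]
  rw [h]
  exact (h Fin.elim0).symm

theorem sum_chainKernel_three {Δ : Bool → Bool → ℝ} (hΔ : ∀ s, ∑ b, Δ s b = 1) (n : ℕ) (s : Bool)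
    (f : Bool → Bool → Bool → ℝ) :
    ∑ x : Fin (n + 3) → Bool, chainKernel Δ (n + 3) s x * f (x 0) (x 1) (x 2) =
      ∑ a, ∑ b, ∑ c, Δ s a * Δ a b * Δ b c * f a b c := by
  rw [sum_words_cons]
  refine Finset.sum_congr rfl fun a _ => ?_
  rw [sum_words_cons]
  refine Finset.sum_congr rfl fun b _ => ?_
  rw [sum_words_cons]
  refine Finset.sum_congr rfl fun c _ => ?_
  calc _ = ∑ x : Fin n → Bool, Δ s a * Δ a b * Δ b c * f a b c * chainKernel Δ n c x := by
        refine Finset.sum_congr rfl fun x _ => ?_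
        simp only [chainKernel_cons]
        change Δ s a * (Δ a b * (Δ b c * chainKernel Δ n c x)) * f a b c = _
        ring
    _ = _ := by rw [← Finset.mul_sum, sum_chainKernel hΔ, mul_one]

/-- The mean of the cost of one input symbol of the chain, given the preceding one. -/
noncomputable def stepCost (Δ : Bool → Bool → ℝ) (r : Bool → Bool → Bool → Bool → Bool → ℝ)
    (ε : ℝ) (s : Bool) : ℝ :=
  ∑ a, ∑ b, ∑ c, Δ s a * Δ a b * Δ b c *
    bscMean ε ![a, b, c] fun z => r s a (z 0) (z 1) (z 2)

/-- The first input symbol only sets the state. For the others, the law of the current symbol and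
the next two given the state, averaged over the noise, gives a one-step cost to which
`stationary_recursion` applies. -/
theorem sum_decodeCost {Δ : Bool → Bool → ℝ} (hΔ : ∀ s, ∑ b, Δ s b = 1) {μ : Bool → ℝ}
    (hμ : ∀ s, ∑ a, μ a * Δ a s = μ s) (r : Bool → Bool → Bool → Bool → Bool → ℝ) (ε : ℝ)
    (n : ℕ) :
    ∑ x, markovLaw μ Δ (n + 3) x * bscMean ε x (fun z =>
      decodeCost r (n + 2) (x 0) (Fin.tail x) (Fin.tail z)) =
      n * ∑ s, μ s * stepCost Δ r ε s := by
  have h := stationary_recursion hμ (e := fun n s => ∑ x : Fin (n + 2) → Bool,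
    chainKernel Δ (n + 2) s x * bscMean ε x (decodeCost r (n + 2) s x)) (j := stepCost Δ r ε)
    (fun n s => by
      have e1 : ∀ x : Fin (n + 3) → Bool, bscMean ε x (decodeCost r (n + 1 + 2) s x) =
          bscMean ε ![x 0, x 1, x 2] (fun z => r s (x 0) (z 0) (z 1) (z 2)) +
            bscMean ε (Fin.tail x) (decodeCost r (n + 2) (x 0) (Fin.tail x)) := by
        intro x
        rw [← bscMean_three, show decodeCost r (n + 1 + 2) s x = fun z =>
          r s (x 0) (z 0) (z 1) (z 2) + decodeCost r (n + 2) (x 0) (Fin.tail x) (Fin.tail z)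
          from rfl, bscMean_add]
        congr 1
        obtain ⟨a, y, rfl⟩ := exists_cons x
        rw [bscMean_cons]
        simp only [Fin.tail_cons]
        ring
      have e2 := sum_chainKernel_three hΔ n s fun a b c =>
        bscMean ε ![a, b, c] fun z => r s a (z 0) (z 1) (z 2)
      change ∑ x : Fin (n + 3) → Bool, chainKernel Δ (n + 3) s x *
        bscMean ε x (decodeCost r (n + 1 + 2) s x) = _
      simp only [e1, mul_add, Finset.sum_add_distrib]
      rw [e2]
      congr 1
      rw [sum_words_cons]
      simp only [chainKernel_cons, Fin.cons_zero, Fin.tail_cons, mul_assoc, ← Finset.mul_sum]) n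
  have h0 : ∀ s, ∑ x : Fin (0 + 2) → Bool,
      chainKernel Δ (0 + 2) s x * bscMean ε x (decodeCost r (0 + 2) s x) = 0 := fun s => by
    simp [bscMean, decodeCost]
  simp only [h0, mul_zero, Finset.sum_const_zero, add_zero] at h
  rw [← h, sum_words_cons]
  refine Finset.sum_congr rfl fun s _ => ?_
  rw [Finset.mul_sum]
  refine Finset.sum_congr rfl fun x _ => ?_
  rw [markovLaw_cons, bscMean_cons]
  simp only [Fin.cons_zero, Fin.tail_cons]
  ring

theorem le_entropyRate_output {π : ℝ} (hπ : π ∈ Set.Icc (0 : ℝ) 1) {ε ζ : ℝ}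
    (hε : ε ∈ Set.Icc (0 : ℝ) 1) (hζ : 0 ≤ ζ) {r : Bool → Bool → Bool → Bool → Bool → ℝ}
    (hr : ∀ s a b c, Real.exp (-r s true a b c) + Real.exp (-r s false a b c) ≤ 1 + ζ) :
    Real.binEntropy π / (1 + π) + Real.binEntropy ε -
      ∑ s, rllStationary π s * stepCost (rllMatrix π) r ε s - ζ ≤
      entropyRate (outputProcess ε (rllChain π)) := by
  have hst := isStationaryFamily_rllChain hπ
  refine ge_of_tendsto_affine (u := fun n => entropy (outputProcess ε (rllChain π) n))
    (b := 2 * (Real.binEntropy π / (1 + π)) + entropy (rllStationary π) +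
      3 * Real.binEntropy ε - Real.log 8)
    (hst.tendsto_blockEntropy_output hε) 3 fun n => ?_
  -- The 8 is 2 · 4: the free first symbol and the two free symbols at the end.
  have h := entropy_add_le_of_decoder hε (hst.nonneg (n + 3)) (hst.sum_eq_one (n + 3))
    (fun x z => decodeCost r (n + 2) (x 0) (Fin.tail x) (Fin.tail z)) (Z := 8 * (1 + ζ) ^ n)
    (by positivity) (fun z => by
      rw [sum_words_cons, Fintype.sum_bool]
      simp only [Fin.cons_zero, Fin.tail_cons]
      have := sum_exp_decodeCost_le hr n true (Fin.tail z)
      have := sum_exp_decodeCost_le hr n false (Fin.tail z)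
      linarith)
  rw [entropy_rllChain hπ.1 (n + 2), Real.log_mul (by norm_num) (by positivity),
    Real.log_pow] at h
  have h2 := sum_decodeCost (rllMatrix_sum π) (rllStationary_mul_matrix hπ.1) r ε n
  rw [show markovLaw (rllStationary π) (rllMatrix π) = rllChain π from rfl] at h2
  rw [h2] at h
  have h3 := Real.log_le_sub_one_of_pos (show 0 < 1 + ζ by positivity)
  have h4 : (n : ℝ) * Real.log (1 + ζ) ≤ n * ζ :=
    mul_le_mul_of_nonneg_left (by linarith) (Nat.cast_nonneg n)
  simp only [outputProcess]
  push_cast at h ⊢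
  linarith

/-! ### The lower bound for the entropy rate of the output -/

/-- The cost of the input symbol `x`, given the preceding input symbol and three output symbols. -/
def markovDecodeCost (u₀ u₁ v₀ v₁ T M : ℝ) : Bool → Bool → Bool → Bool → Bool → ℝ
  | true, false, _, _, _ => 0
  | true, true, _, _, _ => M
  | false, false, false, false, _ => u₀
  | false, true, false, false, _ => u₁
  | false, false, false, true, _ => 0
  | false, true, false, true, _ => M
  | false, false, true, false, _ => v₀
  | false, true, true, false, _ => v₁
  | false, _, true, true, false => T
  | false, false, true, true, true => M
  | false, true, true, true, true => 0

theorem bscMean_three_le {f : Bool → Bool → Bool → ℝ} {M : ℝ} (hM : ∀ a b c, |f a b c| ≤ M)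
    {ε : ℝ} (hε : ε ∈ Set.Icc (0 : ℝ) 1) (a b c : Bool) :
    bscMean ε ![a, b, c] (fun z => f (z 0) (z 1) (z 2)) ≤
      f a b c + ε * (f (!a) b c + f a (!b) c + f a b (!c) - 3 * f a b c) +
        36 * ε ^ 2 * M := by
  have h := (abs_le.1 (abs_bscMean_sub_flipSum_le hε ![a, b, c]
    (F := fun z => f (z 0) (z 1) (z 2)) fun z => hM _ _ _)).2
  have hf : flipSum ![a, b, c] (fun z => f (z 0) (z 1) (z 2)) =
      f (!a) b c + f a (!b) c + f a b (!c) - 3 * f a b c := by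
    simp only [flipSum, Fin.sum_univ_three]
    simp [Function.update]
    ring
  rw [hf] at h
  change _ - f a b c - _ ≤ 4 * ((3 : ℕ) : ℝ) ^ 2 * ε ^ 2 * M at h
  push_cast at h
  linarith

/-- The costs reflect which inputs explain the output with the fewest errors. After an input 1 the
next symbol is 0. After an input 0: output 00 points to 00 against 10 with one error, odds ρε;
output 10 points to 10 against 00 with one error, odds σε; output 110 comes equally likely from 100
or 010 with one error, hence log 2. For outputs 01 and 111 the alternative needs two errors and gets
weight ε². -/
theorem exp_markovDecodeCost_le {ρ σ ε : ℝ} (hρ : 0 < ρ) (hσ : 0 < σ) (hε : 0 < ε)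
    (s a b c : Bool) :
    Real.exp (-markovDecodeCost (ρ * ε) (-Real.log ε - Real.log ρ) (-Real.log ε - Real.log σ)
        (σ * ε) (Real.log 2) (2 * -Real.log ε) s true a b c) +
      Real.exp (-markovDecodeCost (ρ * ε) (-Real.log ε - Real.log ρ) (-Real.log ε - Real.log σ)
        (σ * ε) (Real.log 2) (2 * -Real.log ε) s false a b c) ≤
      1 + (1 + ρ ^ 2 + σ ^ 2) * ε ^ 2 := by
  have hM : Real.exp (-(2 * -Real.log ε)) + Real.exp (-0) ≤
      1 + (1 + ρ ^ 2 + σ ^ 2) * ε ^ 2 := by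
    rw [show -(2 * -Real.log ε) = Real.log ε + Real.log ε by ring, Real.exp_add,
      Real.exp_log hε, neg_zero, Real.exp_zero]
    nlinarith [sq_nonneg (ρ * ε), sq_nonneg (σ * ε)]
  have hy : ∀ y : ℝ, 0 < y → Real.exp (-(-Real.log ε - Real.log y)) + Real.exp (-(y * ε)) ≤
      1 + y ^ 2 * ε ^ 2 := by
    intro y hy
    have := exp_le_one_add_add_sq (y := -(y * ε)) (by nlinarith)
    rw [show -(-Real.log ε - Real.log y) = Real.log ε + Real.log y by ring,
      Real.exp_add, Real.exp_log hε, Real.exp_log hy]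
    nlinarith
  have h1 := hy ρ hρ
  have h2 := hy σ hσ
  have p0 := sq_nonneg ε
  have p1 := sq_nonneg (ρ * ε)
  have p2 := sq_nonneg (σ * ε)
  cases s
  · cases a <;> cases b
    · simp only [markovDecodeCost]
      nlinarith
    · simpa only [markovDecodeCost] using hM
    · simp only [markovDecodeCost]
      nlinarith
    · cases c
      · simp only [markovDecodeCost, Real.exp_neg, Real.exp_log two_pos]
        nlinarith
      · simp only [markovDecodeCost]
        rw [add_comm]
        exact hM
  · simpa only [markovDecodeCost] using hM

/-- A constant for the error term in the expansion of the entropy rate of the output. -/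
noncomputable def errConst (π : ℝ) : ℝ :=
  36 * (3 + |Real.log (π / (1 - π) ^ 2)| + π / (1 - π) ^ 2 + (1 - π) ^ 2 / π) +
    2 + π / (1 - π) ^ 2 + (π / (1 - π) ^ 2) ^ 2 + ((1 - π) ^ 2 / π) ^ 2

theorem le_binEntropy {ε : ℝ} (h1 : ε < 1) :
    ε * -Real.log ε + ε - ε ^ 2 ≤ Real.binEntropy ε := by
  rw [Real.binEntropy_eq_negMulLog_add_negMulLog_one_sub, Real.negMulLog, Real.negMulLog]
  have := Real.log_le_sub_one_of_pos (by linarith : 0 < 1 - ε)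
  nlinarith

theorem binEntropy_le {ε : ℝ} (h1 : ε < 1) :
    Real.binEntropy ε ≤ ε * -Real.log ε + ε := by
  rw [Real.binEntropy_eq_negMulLog_add_negMulLog_one_sub, Real.negMulLog, Real.negMulLog]
  have := Real.one_sub_inv_le_log_of_pos (by linarith : 0 < 1 - ε)
  have h2 := mul_le_mul_of_nonneg_left this (by linarith : 0 ≤ 1 - ε)
  rw [mul_sub, mul_inv_cancel₀ (by linarith)] at h2
  linarith

/-- With ρ = π/(1 - π)² and σ = 1/ρ the odds are the true posterior ones to leading order, so the
equivocation bound is sharp at orders ε log(1/ε) and ε. Subtracting it from H(ε) = ε log(1/ε) + ε +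
O(ε²) produces the two coefficients. -/
theorem le_entropyRate_output_rllChain {π ε : ℝ} (h0 : 0 < π) (h1 : π < 1) (hε : 0 < ε)
    (hL : 1 ≤ -Real.log ε) (hε1 : ε < 1) :
    Real.binEntropy π / (1 + π) + π * (2 - π) / (1 + π) * ε * -Real.log ε + rllG π * ε -
        errConst π * (ε ^ 2 * -Real.log ε) ≤
      entropyRate (outputProcess ε (rllChain π)) := by
  have h1' : 0 < 1 - π := by linarith
  set ρ := π / (1 - π) ^ 2 with hρ_def
  set σ := (1 - π) ^ 2 / π with hσ_def
  have hρ : 0 < ρ := by positivity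
  have hσ : 0 < σ := by positivity
  have hlσ : Real.log σ = -Real.log ρ := by
    rw [← Real.log_inv, hρ_def, hσ_def, inv_div]
  have hlρ : Real.log ρ = Real.log π - 2 * Real.log (1 - π) := by
    rw [hρ_def, Real.log_div h0.ne' (by positivity), Real.log_pow]
    norm_num
  have hr := exp_markovDecodeCost_le hρ hσ hε
  have h := le_entropyRate_output ⟨h0.le, h1.le⟩ ⟨hε.le, hε1.le⟩ (by positivity) hr
  refine le_trans ?_ h
  set r := markovDecodeCost (ρ * ε) (-Real.log ε - Real.log ρ) (-Real.log ε - Real.log σ)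
        (σ * ε) (Real.log 2) (2 * -Real.log ε) with hr_def
  set B := 3 + |Real.log ρ| + ρ + σ with hB
  have hM : ∀ x a b c, |r false x a b c| ≤ B * -Real.log ε := by
    have hl2 := Real.log_two_lt_d9
    have hl2' : 0 < Real.log 2 := Real.log_pos one_lt_two
    have hx : |Real.log ρ| * 1 ≤ |Real.log ρ| * -Real.log ε :=
      mul_le_mul_of_nonneg_left hL (abs_nonneg _)
    have hy : ρ * ε ≤ ρ * -Real.log ε := mul_le_mul_of_nonneg_left (by linarith) hρ.le
    have hz : σ * ε ≤ σ * -Real.log ε := mul_le_mul_of_nonneg_left (by linarith) hσ.le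
    have hy' : 0 < ρ * ε := by positivity
    have hz' : 0 < σ * ε := by positivity
    have ha := le_abs_self (Real.log ρ)
    have hb := neg_abs_le (Real.log ρ)
    rw [hr_def, hlσ, hB]
    intro x a b c
    cases x <;> cases a <;> cases b <;> cases c <;> simp only [markovDecodeCost] <;>
      rw [abs_le] <;> constructor <;> linarith
  -- After an input 1 the chain moves to 0 with certainty, which the decoder gets for free whatever
  -- the output.
  have hs1 : stepCost (rllMatrix π) r ε true = 0 := by
    have : ∀ b c, (bscMean ε ![false, b, c] fun z => r true false (z 0) (z 1) (z 2)) = 0 :=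
      fun b c => by
        simp only [hr_def, markovDecodeCost]
        exact bscMean_const _ _ _
    simp only [stepCost, Fintype.sum_bool, this]
    simp [rllMatrix]
  have hm := fun a b c => bscMean_three_le (f := r false a) (hM a) ⟨hε.le, hε1.le⟩ a b c
  have w := rllMatrix_nonneg (π := π) ⟨h0.le, h1.le⟩
  have hs0 : stepCost (rllMatrix π) r ε false ≤
      (1 - π) ^ 2 * (ρ * ε + ε * (-Real.log ε - Real.log σ)) +
        π * (σ * ε + ε * (-Real.log ε - Real.log ρ)) + ε * (2 * π * (1 - π)) * Real.log 2 +
        (ρ * (1 - π) * π - 2 * ρ * (1 - π) ^ 2 - 2 * σ * π) * ε ^ 2 +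
        36 * ε ^ 2 * (B * -Real.log ε) := by
    have : stepCost (rllMatrix π) r ε false ≤ ∑ a, ∑ b, ∑ c, rllMatrix π false a *
        rllMatrix π a b * rllMatrix π b c * (r false a a b c + ε * (r false a (!a) b c +
          r false a a (!b) c + r false a a b (!c) - 3 * r false a a b c) +
        36 * ε ^ 2 * (B * -Real.log ε)) :=
      Finset.sum_le_sum fun a _ => Finset.sum_le_sum fun b _ => Finset.sum_le_sum fun c _ =>
        mul_le_mul_of_nonneg_left (hm a b c) (mul_nonneg (mul_nonneg (w _ _) (w _ _)) (w _ _))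
    refine this.trans_eq ?_
    simp only [Fintype.sum_bool, hr_def, markovDecodeCost, rllMatrix, Bool.not_true,
      Bool.not_false]
    ring
  have hb := le_binEntropy hε1
  have hπ : 0 < 1 + π := by linarith
  have e1 : (1 - π) ^ 2 * ρ = π := mul_div_cancel₀ _ (by positivity)
  have e2 : π * σ = (1 - π) ^ 2 := mul_div_cancel₀ _ h0.ne'
  have hX : ρ * (1 - π) * π - 2 * ρ * (1 - π) ^ 2 - 2 * σ * π ≤ ρ := by
    have : (1 - π) * π ≤ 1 := by nlinarith
    have := mul_le_mul_of_nonneg_left this hρ.le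
    have := mul_pos hσ h0
    have := mul_pos hρ (pow_pos h1' 2)
    linarith
  have hεL : ε ^ 2 * 1 ≤ ε ^ 2 * -Real.log ε := mul_le_mul_of_nonneg_left hL (sq_nonneg ε)
  have hB0 : 0 ≤ B := by positivity
  have hs0' : stepCost (rllMatrix π) r ε false ≤
      π * ε + (1 - π) ^ 2 * (ε * (-Real.log ε + Real.log ρ)) +
        (1 - π) ^ 2 * ε + π * (ε * (-Real.log ε - Real.log ρ)) +
        ε * (2 * π * (1 - π)) * Real.log 2 + (ρ + 36 * B) * (ε ^ 2 * -Real.log ε) := by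
    have := mul_le_mul_of_nonneg_right hX (sq_nonneg ε)
    have h3 : ρ * (ε ^ 2 * 1) ≤ ρ * (ε ^ 2 * -Real.log ε) := mul_le_mul_of_nonneg_left hεL hρ.le
    rw [hlσ] at hs0
    have e3 : (1 - π) ^ 2 * (ρ * ε + ε * (-Real.log ε - -Real.log ρ)) =
        π * ε + (1 - π) ^ 2 * (ε * (-Real.log ε + Real.log ρ)) := by
      rw [mul_add, ← mul_assoc, e1]
      ring
    have e4 : π * (σ * ε + ε * (-Real.log ε - Real.log ρ)) =
        (1 - π) ^ 2 * ε + π * (ε * (-Real.log ε - Real.log ρ)) := by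
      rw [mul_add, ← mul_assoc, e2]
    linarith
  have hdiv := div_le_div_of_nonneg_right hs0' hπ.le
  have hmain : π * (2 - π) / (1 + π) * ε * -Real.log ε + rllG π * ε =
      ε * -Real.log ε + ε - (π * ε + (1 - π) ^ 2 * (ε * (-Real.log ε + Real.log ρ)) +
        (1 - π) ^ 2 * ε + π * (ε * (-Real.log ε - Real.log ρ)) +
        ε * (2 * π * (1 - π)) * Real.log 2) / (1 + π) := by
    rw [hlρ, rllG]
    field_simp
    ring
  have herr : (ρ + 36 * B) * (ε ^ 2 * -Real.log ε) / (1 + π) ≤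
      (ρ + 36 * B) * (ε ^ 2 * -Real.log ε) :=
    div_le_self (mul_nonneg (by positivity) (by linarith [sq_nonneg ε])) (by linarith)
  have hζ : (2 + ρ ^ 2 + σ ^ 2) * (ε ^ 2 * 1) ≤ (2 + ρ ^ 2 + σ ^ 2) * (ε ^ 2 * -Real.log ε) :=
    mul_le_mul_of_nonneg_left hεL (by positivity)
  have hsum : ∑ s, rllStationary π s * stepCost (rllMatrix π) r ε s =
      stepCost (rllMatrix π) r ε false / (1 + π) := by
    rw [Fintype.sum_bool, hs1, rllStationary]
    ring
  have herrc : errConst π = 36 * B + 2 + ρ + ρ ^ 2 + σ ^ 2 := rfl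
  rw [hsum, herrc]
  rw [add_div _ ((ρ + 36 * B) * (ε ^ 2 * -Real.log ε)) (1 + π)] at hdiv
  linarith

/-! ### The coefficients `f` and `g` of the chain -/

theorem flipCoeff_zero (p : WordLaw) {n : ℕ} (u : Fin n → Bool) :
    flipCoeff p 0 u = flipSum u (p n) := by
  simp [flipCoeff, flipSum]

/-- The output probability of w is P(w) + ε · (flip sum) + O(ε²), so it has exact order ε precisely
when the constant term vanishes and the linear one does not. -/
theorem isTheta_mixedLaw_iff {n : ℕ} (P : (Fin n → Bool) → ℝ) (w : Fin n → Bool) :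
    (fun ε : ℝ => mixedLaw 0 ε P w) =Θ[𝓝[>] 0] (fun ε : ℝ => ε) ↔
      P w = 0 ∧ flipSum w P ≠ 0 := by
  have hM : ∀ z, |P z| ≤ ∑ z, |P z| := fun z =>
    Finset.single_le_sum (f := fun z => |P z|) (fun _ _ => abs_nonneg _) (Finset.mem_univ z)
  have hmem : ∀ᶠ ε : ℝ in 𝓝[>] 0, ε ∈ Set.Icc (0 : ℝ) 1 :=
    mem_of_superset (Ioo_mem_nhdsGT one_pos) Set.Ioo_subset_Icc_self
  have hpos : ∀ᶠ ε : ℝ in 𝓝[>] 0, 0 < ε := self_mem_nhdsWithin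
  have hO : (fun ε : ℝ => mixedLaw 0 ε P w - P w - ε * flipSum w P) =O[𝓝[>] 0]
      (fun ε : ℝ => ε ^ 2) := by
    refine IsBigO.of_bound (4 * n ^ 2 * ∑ z, |P z|) (hmem.mono fun ε hε => ?_)
    have h := abs_bscMean_sub_flipSum_le hε w hM
    rw [← outputLaw_eq_bscMean] at h
    rw [Real.norm_eq_abs, Real.norm_eq_abs, abs_of_nonneg (sq_nonneg ε)]
    exact h.trans_eq (by ring)
  have ho : (fun ε : ℝ => ε ^ 2) =o[𝓝[>] 0] (fun ε : ℝ => ε) := by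
    exact (isLittleO_pow_id one_lt_two).mono nhdsWithin_le_nhds
  have hid : Tendsto (fun ε : ℝ => ε) (𝓝[>] 0) (𝓝 0) := nhdsWithin_le_nhds
  have hne : ∃ᶠ ε : ℝ in 𝓝[>] 0, ε ≠ 0 :=
    (hpos.mono fun ε hε => ne_of_gt hε).frequently
  constructor
  · intro h
    have h1 : (fun ε : ℝ => P w) =O[𝓝[>] 0] (fun ε : ℝ => ε) := by
      have h2 : (fun ε : ℝ => ε * flipSum w P) =O[𝓝[>] 0] (fun ε : ℝ => ε) :=
        ((isBigO_refl _ _).const_mul_left (flipSum w P)).congr_left fun ε => mul_comm _ _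
      exact ((h.1.sub h2).sub (hO.trans_isLittleO ho).isBigO).congr_left fun ε => by ring
    have h0 : P w = 0 := tendsto_nhds_unique tendsto_const_nhds (h1.trans_tendsto hid)
    refine ⟨h0, fun hz => ?_⟩
    simp only [h0, hz, mul_zero, sub_zero] at hO
    exact (isLittleO_irrefl hne) ((h.2.trans hO).trans_isLittleO ho)
  · rintro ⟨h0, hz⟩
    have h1 : (fun ε : ℝ => mixedLaw 0 ε P w - ε * flipSum w P) =o[𝓝[>] 0] (fun ε : ℝ => ε) := by
      simpa only [h0, sub_zero] using hO.trans_isLittleO ho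
    have h2 : (fun ε : ℝ => ε * flipSum w P) =Θ[𝓝[>] 0] (fun ε : ℝ => ε) := by
      have := (isTheta_const_mul_left hz).2 (isTheta_refl (fun ε : ℝ => ε) (𝓝[>] 0))
      simpa only [mul_comm] using this
    have h3 := h1.trans_isTheta h2.symm
    exact (IsEquivalent.isTheta h3).trans h2

/-- The word `a b c`. -/
def word3 (a b c : Bool) : Fin 3 → Bool := Fin.cons a (Fin.cons b (Fin.cons c Fin.elim0))

/-- The word `a b c d`. -/
def word4 (a b c d : Bool) : Fin 4 → Bool := Fin.cons a (word3 b c d)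

theorem sum_word3 {M : Type*} [AddCommMonoid M] (F : (Fin 3 → Bool) → M) :
    ∑ w, F w = ∑ a, ∑ b, ∑ c, F (word3 a b c) := by
  simp only [sum_words_cons, sum_words_zero, word3]

theorem extendWord_elim0 (v : Bool) :
    extendWord (Fin.elim0 : Fin 0 → Bool) v = Fin.cons v Fin.elim0 := by
  funext i
  obtain rfl : i = Fin.last 0 := Fin.ext (by omega)
  simp only [extendWord, Fin.snoc_last]
  rfl

theorem extendWord_word3 (a b c v : Bool) : extendWord (word3 a b c) v = word4 a b c v := by
  simp only [word3, word4, extendWord_cons]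
  rw [extendWord_elim0]

theorem flipSum_elim0 (F : (Fin 0 → Bool) → ℝ) : flipSum Fin.elim0 F = 0 := by
  simp [flipSum]

theorem flipSum_word3 (F : (Fin 3 → Bool) → ℝ) (a b c : Bool) :
    flipSum (word3 a b c) F = F (word3 (!a) b c) + F (word3 a (!b) c) + F (word3 a b (!c)) -
      3 * F (word3 a b c) := by
  simp only [word3, flipSum_cons, flipSum_elim0]
  ring

theorem flipSum_word4 (F : (Fin 4 → Bool) → ℝ) (a b c d : Bool) :
    flipSum (word4 a b c d) F = F (word4 (!a) b c d) + F (word4 a (!b) c d) +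
      F (word4 a b (!c) d) + F (word4 a b c (!d)) - 4 * F (word4 a b c d) := by
  simp only [word4, word3, flipSum_cons, flipSum_elim0]
  ring

theorem rllChain_word3 (π : ℝ) (a b c : Bool) : rllChain π 3 (word3 a b c) =
    rllStationary π a * (rllMatrix π a b * rllMatrix π b c) := by
  rw [word3, rllChain, markovLaw_cons, chainKernel_cons, chainKernel_cons, chainKernel, mul_one]

theorem rllChain_word4 (π : ℝ) (a b c d : Bool) : rllChain π 4 (word4 a b c d) =
    rllChain π 3 (word3 a b c) * rllMatrix π c d := by
  rw [rllChain_word3, word4, word3, rllChain, markovLaw_cons, chainKernel_cons, chainKernel_cons,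
    chainKernel_cons, chainKernel]
  ring

theorem fCoeff_rllChain {π : ℝ} (h0 : 0 < π) (h1 : π < 1) :
    fCoeff 1 (rllChain π) = rllChain π 3 ![false, true, false] +
      rllChain π 3 ![false, false, true] + rllChain π 3 ![true, true, true] ∧
    fCoeff 1 (rllChain π) = π * (2 - π) / (1 + π) := by
  have h1' : 0 < 1 - π := by linarith
  have hπ : 0 < 1 + π := by linarith
  have e2 : ∀ (a b : Bool), rllChain π 2 (Fin.cons a (Fin.cons b Fin.elim0)) =
      rllStationary π a * rllMatrix π a b := by
    intro a b
    rw [rllChain, markovLaw_cons, chainKernel_cons, chainKernel, mul_one]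
  have e : ∀ a b v, extendWord (Fin.cons a (Fin.cons b Fin.elim0) : Fin 2 → Bool) v =
      word3 a b v := by
    intro a b v
    simp only [word3, extendWord_cons]
    rw [extendWord_elim0]
  have key : fCoeff 1 (rllChain π) = π * (2 - π) / (1 + π) := by
    have e3 : ∀ a b c, rllChain π (2 + 1) (word3 a b c) =
        rllStationary π a * (rllMatrix π a b * rllMatrix π b c) := rllChain_word3 π
    change fBlock (rllChain π) 2 0 = _
    simp only [fBlock, flipCoeff_zero, sum_words_cons, sum_words_zero, e, e2,
      flipSum_word3, e3, Fintype.sum_bool]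
    simp only [rllStationary, rllMatrix, mul_zero, lt_irrefl, not_false_iff, and_true, if_false, mul_one, Bool.not_true, Bool.not_false]
    have p1 : 0 < π / (1 + π) := by positivity
    have p2 : 0 < 1 / (1 + π) * (1 - π) := by positivity
    have p3 : 0 < 1 / (1 + π) * π := by positivity
    have p4 : 0 < π / (1 + π) * (1 - π) := by positivity
    have p5 : 0 < π / (1 + π) * π := by positivity
    have p6 : 0 < 1 / (1 + π) * ((1 - π) * π) := by positivity
    have p7 : 0 < 1 / (1 + π) * ((1 - π) * (1 - π)) := by positivity
    simp only [p1, p2, p3, p4, p5, p6, p7, one_mul, not_true, and_false, if_false, if_true]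
    field_simp
    ring
  refine ⟨?_, key⟩
  rw [key]
  have e3 : ∀ a b c : Bool, (![a, b, c] : Fin 3 → Bool) = word3 a b c := fun _ _ _ => by
    funext i
    fin_cases i <;> rfl
  rw [e3, e3, e3, rllChain_word3, rllChain_word3, rllChain_word3]
  simp only [rllStationary, rllMatrix]
  field_simp
  ring

open Classical in
theorem gBlock_three_zero (p : WordLaw) :
    gBlock p 3 0 =
      -(∑ a, ∑ b, ∑ c, ∑ d, if 0 < p 4 (word4 a b c d)
        then flipSum (word4 a b c d) (p 4) *
            Real.log (p 4 (word4 a b c d) / p 3 (word3 a b c)) +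
          (flipSum (word4 a b c d) (p 4) * p 3 (word3 a b c) -
            flipSum (word3 a b c) (p 3) * p 4 (word4 a b c d)) / p 3 (word3 a b c)
        else 0) -
      (∑ a, ∑ b, ∑ c, ∑ d, if 0 < p 3 (word3 a b c) ∧ ¬ 0 < p 4 (word4 a b c d)
        then flipSum (word4 a b c d) (p 4) *
          Real.log (flipSum (word4 a b c d) (p 4) / p 3 (word3 a b c))
        else 0) -
      (∑ a, ∑ b, ∑ c, ∑ d, if p 3 (word3 a b c) = 0 ∧ flipSum (word3 a b c) (p 3) ≠ 0 ∧
          p 4 (word4 a b c d) = 0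
        then flipSum (word4 a b c d) (p 4) *
          Real.log (flipSum (word4 a b c d) (p 4) / flipSum (word3 a b c) (p 3))
        else 0) := by
  simp only [gBlock, flipCoeff_zero, isTheta_mixedLaw_iff, sum_word3, extendWord_word3]
  congr 1
  refine Finset.sum_congr rfl fun a _ => Finset.sum_congr rfl fun b _ =>
    Finset.sum_congr rfl fun c _ => Finset.sum_congr rfl fun d _ => ?_
  -- When the flip sum of the longer word vanishes so does the summand, hence this part of the
  -- condition can be dropped.
  by_cases h : flipSum (word4 a b c d) (p 4) = 0
  · simp [h]
  · simp only [h, ne_eq, not_false_iff, and_true, and_assoc]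

theorem rllChain_word3_pos_iff {π : ℝ} (h0 : 0 < π) (h1 : π < 1) (a b c : Bool) :
    0 < rllChain π 3 (word3 a b c) ↔ (a && b || b && c) = false := by
  have h1' : 0 < 1 - π := by linarith
  rw [rllChain_word3]
  cases a <;> cases b <;> cases c <;> simp only [rllStationary, rllMatrix] <;>
    first
    | exact iff_of_true (by positivity) rfl
    | exact iff_of_false (by simp) (by simp)

theorem rllChain_word4_pos_iff {π : ℝ} (h0 : 0 < π) (h1 : π < 1) (a b c d : Bool) :
    0 < rllChain π 4 (word4 a b c d) ↔ (a && b || b && c || c && d) = false := by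
  have h1' : 0 < 1 - π := by linarith
  rw [rllChain_word4, rllChain_word3]
  cases a <;> cases b <;> cases c <;> cases d <;> simp only [rllStationary, rllMatrix] <;>
    first
    | exact iff_of_true (by positivity) rfl
    | exact iff_of_false (by simp) (by simp)

/-- For the words involving 11 that occur here, the flip sum of the longer word is the flip sum (or
probability) of its prefix times an explicit factor, so each logarithm is that of a conditional
probability. The factors 2 - π, 2(1 - π)/(2 - π) and π/(2 - π) are those used as costs in the upper
bound for the output entropy. -/
theorem gCoeff_rllChain {π : ℝ} (h0 : 0 < π) (h1 : π < 1) :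
    gCoeff 1 (rllChain π) = rllG π := by
  have h1' : 0 < 1 - π := by linarith
  have hπ : 0 < 1 + π := by linarith
  have h2 : 0 < 2 - π := by linarith
  have w3 := rllChain_word3_pos_iff h0 h1
  have w4 := rllChain_word4_pos_iff h0 h1
  have z3 : ∀ a b c, rllChain π 3 (word3 a b c) = 0 ↔ ¬ (a && b || b && c) = false :=
    fun a b c => by
      rw [← w3, not_lt]
      exact ((isStationaryFamily_rllChain ⟨h0.le, h1.le⟩).nonneg _ _).ge_iff_eq'.symm
  have z4 : ∀ a b c d, rllChain π 4 (word4 a b c d) = 0 ↔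
      ¬ (a && b || b && c || c && d) = false :=
    fun a b c d => by
      rw [← w4, not_lt]
      exact ((isStationaryFamily_rllChain ⟨h0.le, h1.le⟩).nonneg _ _).ge_iff_eq'.symm
  change gBlock (rllChain π) 3 0 = _
  rw [gBlock_three_zero]
  simp only [w3, w4, z3, z4, Fintype.sum_bool, Bool.and_false, Bool.and_true, Bool.or_false,
    Bool.or_true, Bool.true_eq_false, not_true, not_false_iff, and_true, true_and, false_and,
    and_false, if_true, if_false, add_zero, zero_add]
  have l : ∀ a b c d, (a && b || b && c) = false →
      Real.log (rllChain π 4 (word4 a b c d) / rllChain π 3 (word3 a b c)) =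
        Real.log (rllMatrix π c d) := fun a b c d h => by
    rw [rllChain_word4, mul_div_cancel_left₀ _ ((w3 a b c).2 h).ne']
  have f4 : ∀ a b c d, flipSum (word4 a b c d) (rllChain π 4) =
      rllStationary π (!a) * (rllMatrix π (!a) b * rllMatrix π b c) * rllMatrix π c d +
      rllStationary π a * (rllMatrix π a (!b) * rllMatrix π (!b) c) * rllMatrix π c d +
      rllStationary π a * (rllMatrix π a b * rllMatrix π b (!c)) * rllMatrix π (!c) d +
      rllStationary π a * (rllMatrix π a b * rllMatrix π b c) * rllMatrix π c (!d) -
      4 * (rllStationary π a * (rllMatrix π a b * rllMatrix π b c) * rllMatrix π c d) :=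
    fun a b c d => by simp only [flipSum_word4, rllChain_word4, rllChain_word3]
  have f3 : ∀ a b c, flipSum (word3 a b c) (rllChain π 3) =
      rllStationary π (!a) * (rllMatrix π (!a) b * rllMatrix π b c) +
      rllStationary π a * (rllMatrix π a (!b) * rllMatrix π (!b) c) +
      rllStationary π a * (rllMatrix π a b * rllMatrix π b (!c)) -
      3 * (rllStationary π a * (rllMatrix π a b * rllMatrix π b c)) :=
    fun a b c => by simp only [flipSum_word3, rllChain_word3]
  have p111 : flipSum (word3 true true true) (rllChain π 3) = π ^ 2 / (1 + π) := by
    simp only [f3, rllStationary, rllMatrix, Bool.not_true]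
    ring
  have p110 : flipSum (word3 true true false) (rllChain π 3) = π * (2 - π) / (1 + π) := by
    simp only [f3, rllStationary, rllMatrix, Bool.not_true, Bool.not_false]
    ring
  have p011 : flipSum (word3 false true true) (rllChain π 3) = π * (2 - π) / (1 + π) := by
    simp only [f3, rllStationary, rllMatrix, Bool.not_true, Bool.not_false]
    ring
  have q1111 : flipSum (word4 true true true true) (rllChain π 4) = 0 := by
    simp only [f4, rllStationary, rllMatrix, Bool.not_true]
    ring
  have q1110 : flipSum (word4 true true true false) (rllChain π 4) = π ^ 2 / (1 + π) := by
    simp only [f4, rllStationary, rllMatrix, Bool.not_true, Bool.not_false]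
    ring
  have q1101 : flipSum (word4 true true false true) (rllChain π 4) =
      π * (2 - π) / (1 + π) * π := by
    simp only [f4, rllStationary, rllMatrix, Bool.not_true, Bool.not_false]
    ring
  have q1100 : flipSum (word4 true true false false) (rllChain π 4) =
      π * (2 - π) / (1 + π) * (1 - π) := by
    simp only [f4, rllStationary, rllMatrix, Bool.not_true, Bool.not_false]
    ring
  have q0110 : flipSum (word4 false true true false) (rllChain π 4) =
      π * (2 - π) / (1 + π) * (2 * (1 - π) / (2 - π)) := by
    simp only [f4, rllStationary, rllMatrix, Bool.not_true, Bool.not_false]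
    field_simp
    ring
  have q0111 : flipSum (word4 false true true true) (rllChain π 4) =
      π * (2 - π) / (1 + π) * (π / (2 - π)) := by
    simp only [f4, rllStationary, rllMatrix, Bool.not_true, Bool.not_false]
    field_simp
    ring
  have q1011 : flipSum (word4 true false true true) (rllChain π 4) =
      rllChain π 3 (word3 true false true) * (2 - π) := by
    simp only [f4, rllChain_word3, rllStationary, rllMatrix, Bool.not_true, Bool.not_false]
    ring
  have q0011 : flipSum (word4 false false true true) (rllChain π 4) =
      rllChain π 3 (word3 false false true) * (2 - π) := by
    simp only [f4, rllChain_word3, rllStationary, rllMatrix, Bool.not_true, Bool.not_false]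
    ring
  have n1 : π ^ 2 / (1 + π) ≠ 0 := by positivity
  have n2 : π * (2 - π) / (1 + π) ≠ 0 := by positivity
  simp only [q1011, q0011, mul_div_cancel_left₀ _ ((w3 true false true).2 rfl).ne',
    mul_div_cancel_left₀ _ ((w3 false false true).2 rfl).ne', l true false true false rfl,
    l true false false true rfl, l true false false false rfl, l false true false true rfl,
    l false true false false rfl, l false false true false rfl, l false false false true rfl,
    l false false false false rfl]
  simp only [p111, p110, p011, q1111, q1110, q1101, q1100, q0110, q0111, n1, n2, ne_eq,
    not_false_iff, if_true, mul_div_cancel_left₀ _ n2, div_self n1, Real.log_one, zero_mul, mul_zero,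
    Real.log_div h0.ne' h2.ne', Real.log_div (mul_pos two_pos h1').ne' h2.ne',
    Real.log_mul two_ne_zero h1'.ne']
  simp only [f4, f3, rllChain_word4, rllChain_word3, rllStationary, rllMatrix, Bool.not_true,
    Bool.not_false, Real.log_one, rllG]
  field_simp
  ring

/-! ### The chain of maximal entropy -/

theorem one_div_goldenRatio_sq : 1 / Real.goldenRatio ^ 2 = 2 - Real.goldenRatio := by
  rw [div_eq_iff (by positivity)]
  linear_combination (Real.goldenRatio - 1) * Real.goldenRatio_sq

theorem log_two_sub_goldenRatio :
    Real.log (2 - Real.goldenRatio) = -(2 * Real.log Real.goldenRatio) := by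
  rw [← one_div_goldenRatio_sq, Real.log_div one_ne_zero (by positivity), Real.log_one,
    Real.log_pow]
  norm_num

theorem log_goldenRatio_sub_one :
    Real.log (Real.goldenRatio - 1) = -Real.log Real.goldenRatio := by
  rw [← Real.log_inv]
  congr 1
  rw [eq_comm]
  apply inv_eq_of_mul_eq_one_right
  linarith [Real.goldenRatio_sq]

theorem three_halves_lt_goldenRatio : 3 / 2 < Real.goldenRatio := by
  nlinarith [Real.goldenRatio_sq, Real.goldenRatio_pos]

theorem binEntropy_eq (π : ℝ) :
    Real.binEntropy π = π * -Real.log π + (1 - π) * -Real.log (1 - π) := by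
  rw [Real.binEntropy_eq_negMulLog_add_negMulLog_one_sub, Real.negMulLog, Real.negMulLog]
  ring

theorem binEntropy_golden : Real.binEntropy (2 - Real.goldenRatio) =
    (1 + (2 - Real.goldenRatio)) * Real.log Real.goldenRatio := by
  rw [binEntropy_eq, log_two_sub_goldenRatio,
    show 1 - (2 - Real.goldenRatio) = Real.goldenRatio - 1 by ring, log_goldenRatio_sub_one]
  ring

/-- Relative entropy with respect to the law (1/λ², 1/λ) is positive off that law; its cross entropy
is 2π log λ + (1 - π) log λ. -/
theorem binEntropy_lt {π : ℝ} (h0 : 0 < π) (h1 : π < 1) (hne : π ≠ 2 - Real.goldenRatio) :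
    Real.binEntropy π < (1 + π) * Real.log Real.goldenRatio := by
  have hg1 := Real.one_lt_goldenRatio
  have hg2 := Real.goldenRatio_lt_two
  have h1' : 0 < 1 - π := by linarith
  have a : 0 < 2 - Real.goldenRatio := by linarith
  have b : 0 < Real.goldenRatio - 1 := by linarith
  have e1 := Real.log_lt_sub_one_of_pos (div_pos a h0) fun h =>
    hne ((div_eq_one_iff_eq h0.ne').1 h).symm
  have e2 := Real.log_le_sub_one_of_pos (div_pos b h1')
  rw [Real.log_div a.ne' h0.ne', log_two_sub_goldenRatio] at e1
  rw [Real.log_div b.ne' h1'.ne', log_goldenRatio_sub_one] at e2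
  have f1 := mul_lt_mul_of_pos_left e1 h0
  have f2 := mul_le_mul_of_nonneg_left e2 h1'.le
  have g1 : π * ((2 - Real.goldenRatio) / π - 1) = 2 - Real.goldenRatio - π := by
    field_simp
  have g2 : (1 - π) * ((Real.goldenRatio - 1) / (1 - π) - 1) = Real.goldenRatio - 1 - (1 - π) := by
    field_simp
  rw [g1] at f1
  rw [g2] at f2
  rw [binEntropy_eq]
  linarith

/-- Relative entropy is at most the χ²-distance to the golden law, whose factor is λ² + λ = 2λ + 1 <
5. -/
theorem le_binEntropy_golden {π : ℝ} (h0 : 0 < π) (h1 : π < 1) :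
    (1 + π) * Real.log Real.goldenRatio - 5 * (π - (2 - Real.goldenRatio)) ^ 2 ≤
      Real.binEntropy π := by
  have hg1 := Real.one_lt_goldenRatio
  have hg2 := Real.goldenRatio_lt_two
  have hsq := Real.goldenRatio_sq
  have h1' : 0 < 1 - π := by linarith
  have a : 0 < 2 - Real.goldenRatio := by linarith
  have b : 0 < Real.goldenRatio - 1 := by linarith
  have e1 := Real.log_le_sub_one_of_pos (div_pos h0 a)
  have e2 := Real.log_le_sub_one_of_pos (div_pos h1' b)
  rw [Real.log_div h0.ne' a.ne', log_two_sub_goldenRatio] at e1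
  rw [Real.log_div h1'.ne' b.ne', log_goldenRatio_sub_one] at e2
  have f1 := mul_le_mul_of_nonneg_left e1 h0.le
  have f2 := mul_le_mul_of_nonneg_left e2 h1'.le
  have g1 : π / (2 - Real.goldenRatio) = π * (Real.goldenRatio + 1) := by
    rw [div_eq_iff a.ne']
    linear_combination π * hsq
  have g2 : (1 - π) / (Real.goldenRatio - 1) = (1 - π) * Real.goldenRatio := by
    rw [div_eq_iff b.ne']
    linear_combination -(1 - π) * hsq
  rw [g1] at f1
  rw [g2] at f2
  have key : π * (π * (Real.goldenRatio + 1) - 1) + (1 - π) * ((1 - π) * Real.goldenRatio - 1) =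
      (2 * Real.goldenRatio + 1) * (π - (2 - Real.goldenRatio)) ^ 2 := by
    linear_combination (-(2 * Real.goldenRatio - 5) - 4 * π) * hsq
  have hle : (2 * Real.goldenRatio + 1) * (π - (2 - Real.goldenRatio)) ^ 2 ≤
      5 * (π - (2 - Real.goldenRatio)) ^ 2 :=
    mul_le_mul_of_nonneg_right (by linarith) (sq_nonneg _)
  rw [binEntropy_eq]
  linarith

theorem entropyRate_rllChain_eq_iff {π : ℝ} (hπ : π ∈ Set.Icc (0 : ℝ) 1) :
    entropyRate (rllChain π) = Real.log Real.goldenRatio ↔ π = 1 / Real.goldenRatio ^ 2 := by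
  have hpos : 0 < 1 + π := by linarith [hπ.1]
  rw [entropyRate_rllChain hπ, div_eq_iff hpos.ne', one_div_goldenRatio_sq, mul_comm]
  have hl := log_goldenRatio_pos
  constructor
  · intro h
    by_contra hne
    rcases hπ.1.eq_or_lt with h0 | h0
    · rw [← h0, Real.binEntropy_zero] at h
      linarith
    rcases hπ.2.eq_or_lt with h1 | h1
    · rw [h1, Real.binEntropy_one] at h
      linarith
    exact (binEntropy_lt h0 h1 hne).ne h
  · rintro rfl
    exact binEntropy_golden

/-! ### The noiseless channel. -/

theorem outputLaw_zero {n : ℕ} (P : (Fin n → Bool) → ℝ) : outputLaw 0 P = P := by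
  funext z
  have hM : ∀ z, |P z| ≤ ∑ z, |P z| := fun z =>
    Finset.single_le_sum (f := fun z => |P z|) (fun _ _ => abs_nonneg _) (Finset.mem_univ z)
  have h := abs_bscMean_sub_le (ε := 0) ⟨le_rfl, zero_le_one⟩ z hM
  rw [mul_zero, zero_mul, ← outputLaw_eq_bscMean] at h
  exact sub_eq_zero.1 (abs_nonpos_iff.1 h)

theorem golden_mem : 2 - Real.goldenRatio ∈ Set.Icc (0 : ℝ) 1 :=
  ⟨by linarith [Real.goldenRatio_lt_two], by linarith [Real.one_lt_goldenRatio]⟩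

theorem constrainedCapacity_zero :
    constrainedCapacity (rll 1 ⊤) 0 = Real.log Real.goldenRatio := by
  have h01 : (0 : ℝ) ∈ Set.Icc (0 : ℝ) 1 := ⟨le_rfl, zero_le_one⟩
  apply le_antisymm
  · refine capacity_le_of_forall h01 (b := Real.log Real.goldenRatio) 0 fun n P hP => ?_
    rw [mutualInfo_eq hP.1.2, outputLaw_zero, Real.binEntropy_zero, mul_zero, sub_zero]
    exact entropy_le_of_admissible hP
  · have hst := isStationaryFamily_rllChain golden_mem
    have h := le_capacity_of_tendsto h01 (hst.admissible (supportedIn_rllChain _))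
      (hst.tendsto_blockEntropy_output h01)
    have e : outputProcess 0 (rllChain (2 - Real.goldenRatio)) =
        rllChain (2 - Real.goldenRatio) := by
      funext n
      exact outputLaw_zero _
    rw [e, Real.binEntropy_zero, sub_zero,
      (entropyRate_rllChain_eq_iff golden_mem).2 one_div_goldenRatio_sq.symm] at h
    exact h

/-! ### Asymptotics -/

theorem eventually_le_neg_log (B : ℝ) : ∀ᶠ ε : ℝ in 𝓝[>] 0, B ≤ -Real.log ε :=
  (Real.tendsto_log_nhdsGT_zero.eventually (eventually_le_atBot (-B))).mono fun ε h => by linarith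

theorem tendsto_mul_neg_log : Tendsto (fun ε : ℝ => ε * -Real.log ε) (𝓝[>] 0) (𝓝 0) := by
  have := (Real.continuous_negMulLog.tendsto 0).mono_left (nhdsWithin_le_nhds (s := Set.Ioi 0))
  rw [Real.negMulLog_zero] at this
  exact this.congr fun ε => by rw [Real.negMulLog]; ring

theorem eventually_pos : ∀ᶠ ε : ℝ in 𝓝[>] 0, 0 < ε := self_mem_nhdsWithin

theorem eventually_lt_one : ∀ᶠ ε : ℝ in 𝓝[>] 0, ε < 1 :=
  nhdsWithin_le_nhds (Iio_mem_nhds one_pos)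

theorem entropyRate_output_expansion {π : ℝ} (h0 : 0 < π) (h1 : π < 1) :
    (fun ε : ℝ => entropyRate (outputProcess ε (rllChain π))
        - (entropyRate (rllChain π) + π * (2 - π) / (1 + π) * ε * Real.log (1 / ε)
          + gCoeff 1 (rllChain π) * ε))
      =O[𝓝[>] 0] (fun ε : ℝ => ε ^ 2 * Real.log ε) := by
  refine IsBigO.of_bound (max (64 * (6 - Real.log π - Real.log (1 - π)) + 6) (errConst π)) ?_
  filter_upwards [eventually_pos, eventually_lt_one, eventually_le_neg_log 1] with ε hε hε1 hL
  have hu := entropyRate_output_rllChain_le h0 h1 hε hL hε1.le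
  have hl := le_entropyRate_output_rllChain h0 h1 hε hL hε1
  have hx : 0 ≤ ε ^ 2 * -Real.log ε := mul_nonneg (sq_nonneg ε) (by linarith)
  rw [entropyRate_rllChain ⟨h0.le, h1.le⟩, gCoeff_rllChain h0 h1, one_div, Real.log_inv,
    Real.norm_eq_abs, Real.norm_eq_abs, show |ε ^ 2 * Real.log ε| = ε ^ 2 * -Real.log ε by
      rw [← abs_neg, ← mul_neg, abs_of_nonneg hx]]
  have m1 := mul_le_mul_of_nonneg_right
    (le_max_left (64 * (6 - Real.log π - Real.log (1 - π)) + 6) (errConst π)) hx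
  have m2 := mul_le_mul_of_nonneg_right
    (le_max_right (64 * (6 - Real.log π - Real.log (1 - π)) + 6) (errConst π)) hx
  exact abs_le.2 ⟨by linarith, by linarith⟩

/-! ### The coefficients at π = 1/λ². -/

theorem rllG_golden : rllG (2 - Real.goldenRatio) =
    (Real.goldenRatio + 1 - 2 * Real.log 2) / (3 * Real.goldenRatio + 1) := by
  have hg1 := Real.one_lt_goldenRatio
  have hg2 := Real.goldenRatio_lt_two
  have hsq := Real.goldenRatio_sq
  rw [rllG, log_two_sub_goldenRatio,
    show 1 - (2 - Real.goldenRatio) = Real.goldenRatio - 1 by ring, log_goldenRatio_sub_one,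
    div_eq_div_iff (by linarith) (by linarith)]
  linear_combination (-3 * Real.goldenRatio + 3 +
    (6 * Real.goldenRatio - 10) * Real.log 2) * hsq

theorem golden_coeff : (Real.goldenRatio + 1) / (3 * Real.goldenRatio + 1) =
    1 - (2 * Real.goldenRatio + 2) / (4 * Real.goldenRatio + 3) := by
  have hg1 := Real.goldenRatio_pos
  rw [one_sub_div (by positivity), div_eq_div_iff (by positivity) (by positivity)]
  linear_combination -2 * Real.goldenRatio_sq

theorem golden_coeff' :
    (2 - Real.goldenRatio) * (2 - (2 - Real.goldenRatio)) / (1 + (2 - Real.goldenRatio)) =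
    1 - (2 * Real.goldenRatio + 2) / (4 * Real.goldenRatio + 3) := by
  have hg1 := Real.goldenRatio_pos
  have hg2 := Real.goldenRatio_lt_two
  rw [one_sub_div (by positivity), div_eq_div_iff (by linarith) (by positivity)]
  linear_combination (-4 * Real.goldenRatio + 3) * Real.goldenRatio_sq

/-! ### Two-sided bounds for the capacity. -/

theorem capacity_upper_bound : ∀ᶠ ε : ℝ in 𝓝[>] 0, constrainedCapacity (rll 1 ⊤) ε ≤
    Real.log Real.goldenRatio
      - (2 * Real.goldenRatio + 2) / (4 * Real.goldenRatio + 3) * ε * -Real.log ε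
      + (rllG (2 - Real.goldenRatio) - 1) * ε + 1501 * (ε * -Real.log ε) ^ 2 := by
  filter_upwards [eventually_pos, eventually_lt_one, eventually_le_neg_log 1,
    tendsto_mul_neg_log.eventually (ge_mem_nhds (show (0 : ℝ) < 1 / 28 by norm_num))]
    with ε hε hε1 hL ht
  have h := capacity_upper_bound_aux hε hL (by linarith)
  have hb := le_binEntropy hε1
  have e : ε * ((Real.goldenRatio + 1) * (-Real.log ε + 1) - 2 * Real.log 2) /
        (3 * Real.goldenRatio + 1) =
      (1 - (2 * Real.goldenRatio + 2) / (4 * Real.goldenRatio + 3)) * (ε * -Real.log ε) +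
        rllG (2 - Real.goldenRatio) * ε := by
    rw [← golden_coeff, rllG_golden]
    ring
  rw [e] at h
  have : ε ^ 2 * 1 ≤ (ε * -Real.log ε) ^ 2 := by
    rw [mul_pow]
    exact mul_le_mul_of_nonneg_left (one_le_pow₀ hL) (sq_nonneg ε)
  linarith

/-- With π = π₀ + δ, the entropy rate drops by at most 5δ² and the coefficient of t = ε log(1/ε)
rises by at least δ/3. For δ = t/30 the net gain is t²/90 - t²/180 = t²/180. The change of the ε
coefficient and the error of the entropy expansion are O(εt), which is eventually at most t²/360,
leaving t²/360. -/
theorem capacity_lower_bound : ∀ᶠ ε : ℝ in 𝓝[>] 0,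
    1 / 360 * (ε * -Real.log ε) ^ 2 ≤ constrainedCapacity (rll 1 ⊤) ε -
      (Real.log Real.goldenRatio
        - (2 * Real.goldenRatio + 2) / (4 * Real.goldenRatio + 3) * ε * -Real.log ε
        + (rllG (2 - Real.goldenRatio) - 1) * ε) := by
  have hg1 := three_halves_lt_goldenRatio
  have hg2 := Real.goldenRatio_lt_two
  set π₀ := 2 - Real.goldenRatio with hπ₀
  have hp : 0 < π₀ := by linarith
  have hp1 : π₀ < 1 / 2 := by linarith
  have hd : DifferentiableAt ℝ rllG π₀ := by
    unfold rllG
    have : 1 - π₀ ≠ 0 := by linarith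
    have : 1 + π₀ ≠ 0 := by linarith
    fun_prop (disch := first | assumption | exact hp.ne')
  obtain ⟨D, hD⟩ := hd.isBigO_sub.bound
  have hc : ContinuousAt errConst π₀ := by
    unfold errConst
    have h1 : (1 - π₀) ^ 2 ≠ 0 := pow_ne_zero 2 (by linarith)
    have h2 : π₀ / (1 - π₀) ^ 2 ≠ 0 := div_ne_zero hp.ne' h1
    fun_prop (disch := first | assumption | exact hp.ne')
  -- The input chain varies with ε, so the error constant must be bounded uniformly for π near π₀;
  -- continuity gives this.
  have hE := hc.eventually (gt_mem_nhds (lt_add_one (errConst π₀)))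
  have hπt : Tendsto (fun ε : ℝ => π₀ + 1 / 30 * (ε * -Real.log ε)) (𝓝[>] 0) (𝓝 π₀) := by
    have := (tendsto_mul_neg_log.const_mul (1 / 30)).const_add π₀
    rwa [mul_zero, add_zero] at this
  filter_upwards [eventually_pos, eventually_lt_one, eventually_le_neg_log 1,
    eventually_le_neg_log (360 * (|D| / 30 + |errConst π₀ + 1|)), hπt.eventually hD,
    hπt.eventually hE, hπt.eventually (gt_mem_nhds hp1)] with ε hε hε1 hL hL' hDε hEε hπε
  set t := ε * -Real.log ε with ht
  set π := π₀ + 1 / 30 * t with hπ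
  have ht0 : 0 < t := mul_pos hε (by linarith)
  have hπ0 : 0 < π := by linarith
  have hπ1 : π < 1 := by linarith
  have hεI : ε ∈ Set.Icc (0 : ℝ) 1 := ⟨hε.le, hε1.le⟩
  have hst := isStationaryFamily_rllChain (π := π) ⟨hπ0.le, hπ1.le⟩
  have h1 := le_capacity_of_tendsto hεI (hst.admissible (supportedIn_rllChain _))
    (hst.tendsto_blockEntropy_output hεI)
  have h2 := le_entropyRate_output_rllChain hπ0 hπ1 hε hL hε1
  have h3 := binEntropy_le hε1
  have h4 : Real.log Real.goldenRatio - 5 * (1 / 30 * t) ^ 2 ≤ Real.binEntropy π / (1 + π) := by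
    rw [le_div_iff₀ (by linarith)]
    have := le_binEntropy_golden hπ0 hπ1
    rw [← hπ₀, show π - π₀ = 1 / 30 * t by rw [hπ]; ring] at this
    have h5 : 0 ≤ 5 * (1 / 30 * t) ^ 2 * π := by positivity
    linarith
  have h5 : 1 - (2 * Real.goldenRatio + 2) / (4 * Real.goldenRatio + 3) + 1 / 3 * (1 / 30 * t) ≤
      π * (2 - π) / (1 + π) := by
    rw [← golden_coeff', ← hπ₀]
    have e : π * (2 - π) / (1 + π) = π₀ * (2 - π₀) / (1 + π₀) +
        (2 - π - π₀ - π * π₀) / ((1 + π) * (1 + π₀)) * (1 / 30 * t) := by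
      rw [show 1 / 30 * t = π - π₀ by rw [hπ]; ring]
      have : 1 + π ≠ 0 := by linarith
      have : 1 + π₀ ≠ 0 := by linarith
      field_simp
      ring
    rw [e]
    -- This is the divided difference of the coefficient π(2 - π)/(1 + π); the value 1/3 is attained
    -- at π = π₀ = 1/2, and both parameters are below 1/2.
    have : 1 / 3 ≤ (2 - π - π₀ - π * π₀) / ((1 + π) * (1 + π₀)) := by
      rw [le_div_iff₀ (by positivity)]
      have : π * π₀ ≤ 1 / 2 * (1 / 2) := mul_le_mul hπε.le hp1.le hp.le (by norm_num)
      linarith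
    have := mul_le_mul_of_nonneg_right this (show 0 ≤ 1 / 30 * t by positivity)
    linarith
  have h6 := mul_le_mul_of_nonneg_right h5 ht0.le
  have h7 : rllG π₀ - |D| / 30 * t ≤ rllG π := by
    rw [Real.norm_eq_abs, Real.norm_eq_abs, show π - π₀ = 1 / 30 * t by rw [hπ]; ring,
      abs_of_nonneg (show 0 ≤ 1 / 30 * t by positivity)] at hDε
    have h8 := (abs_le.1 hDε).1
    have h9 := mul_le_mul_of_nonneg_right (le_abs_self D) (show 0 ≤ 1 / 30 * t by positivity)
    linarith
  have h8 := mul_le_mul_of_nonneg_right h7 hε.le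
  have h9 : errConst π * (ε ^ 2 * -Real.log ε) ≤ |errConst π₀ + 1| * (ε * t) := by
    rw [show ε ^ 2 * -Real.log ε = ε * t by rw [ht]; ring]
    exact mul_le_mul_of_nonneg_right (hEε.le.trans (le_abs_self _)) (by positivity)
  have h10 := mul_le_mul_of_nonneg_right hL' (show 0 ≤ ε * t by positivity)
  have e10 : -Real.log ε * (ε * t) = t ^ 2 := by rw [ht]; ring
  rw [e10] at h10
  have e11 : π * (2 - π) / (1 + π) * ε * -Real.log ε = π * (2 - π) / (1 + π) * t := by
    rw [ht]; ring
  have e12 : (2 * Real.goldenRatio + 2) / (4 * Real.goldenRatio + 3) * ε * -Real.log ε =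
      (2 * Real.goldenRatio + 2) / (4 * Real.goldenRatio + 3) * t := by
    rw [ht]; ring
  rw [e11] at h2
  rw [e12]
  linarith

theorem mainTheorem6 :
    -- a first order stationary Markov chain supported in S(1,∞) is determined by π₀₁
    (∀ ν : Measure (ℕ → Bool), IsStationaryLaw ν → IsFirstOrderMarkov (wordLaw ν) →
      SupportedIn (wordLaw ν) (rll 1 ⊤) →
        prob01 (wordLaw ν) ∈ Set.Icc (0 : ℝ) 1 ∧
        wordLaw ν = rllChain (prob01 (wordLaw ν))) ∧
    -- the coefficients f and g and the entropy rate of the output process, for such chains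
    (∀ π : ℝ, 0 < π → π < 1 →
      fCoeff 1 (rllChain π) =
        rllChain π 3 ![false, true, false] + rllChain π 3 ![false, false, true]
          + rllChain π 3 ![true, true, true] ∧
      fCoeff 1 (rllChain π) = π * (2 - π) / (1 + π) ∧
      gCoeff 1 (rllChain π) =
        (2 * π - π ^ 2 - (2 * π - 2 * π ^ 2) * Real.log 2
          + (-1 + 3 * π - π ^ 2) * Real.log π
          + (2 - 6 * π + 2 * π ^ 2) * Real.log (1 - π)) / (1 + π) ∧
      Tendsto (blockEntropy (rllChain π)) atTop (𝓝 (entropyRate (rllChain π))) ∧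
      (∀ ε ∈ Set.Icc (0 : ℝ) 1,
        Tendsto (blockEntropy (outputProcess ε (rllChain π))) atTop
          (𝓝 (entropyRate (outputProcess ε (rllChain π))))) ∧
      (fun ε : ℝ => entropyRate (outputProcess ε (rllChain π))
          - (entropyRate (rllChain π)
              + π * (2 - π) / (1 + π) * ε * Real.log (1 / ε)
              + gCoeff 1 (rllChain π) * ε))
        =O[𝓝[>] 0] (fun ε : ℝ => ε ^ 2 * Real.log ε)) ∧
    -- the maximum entropy chain on S(1,∞)
    (∀ ν : Measure (ℕ → Bool), IsStationaryLaw ν → SupportedIn (wordLaw ν) (rll 1 ⊤) →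
      Tendsto (blockEntropy (wordLaw ν)) atTop (𝓝 (entropyRate (wordLaw ν))) ∧
      entropyRate (wordLaw ν) ≤ Real.log Real.goldenRatio) ∧
    (∀ π ∈ Set.Icc (0 : ℝ) 1,
      entropyRate (rllChain π) = Real.log Real.goldenRatio ↔ π = 1 / Real.goldenRatio ^ 2) ∧
    -- the noisy constrained capacity is a limit, with noiseless value log λ
    (∀ ε ∈ Set.Icc (0 : ℝ) 1,
      Tendsto (blockCapacity (rll 1 ⊤) ε) atTop (𝓝 (constrainedCapacity (rll 1 ⊤) ε))) ∧
    constrainedCapacity (rll 1 ⊤) 0 = Real.log Real.goldenRatio ∧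
    -- its asymptotic expansion
    (fun ε : ℝ => constrainedCapacity (rll 1 ⊤) ε
        - (Real.log Real.goldenRatio
            - (2 * Real.goldenRatio + 2) / (4 * Real.goldenRatio + 3) * ε * Real.log (1 / ε)
            + (gCoeff 1 (rllChain (1 / Real.goldenRatio ^ 2)) - 1) * ε))
      =O[𝓝[>] 0] (fun ε : ℝ => ε ^ 2 * Real.log (1 / ε) ^ 2) ∧
    -- the error term cannot be improved
    (∃ c : ℝ, 0 < c ∧ ∀ᶠ ε : ℝ in 𝓝[>] 0,
      c * (ε ^ 2 * Real.log (1 / ε) ^ 2) ≤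
        constrainedCapacity (rll 1 ⊤) ε
          - (Real.log Real.goldenRatio
              - (2 * Real.goldenRatio + 2) / (4 * Real.goldenRatio + 3) * ε * Real.log (1 / ε)
              + (gCoeff 1 (rllChain (1 / Real.goldenRatio ^ 2)) - 1) * ε)) := by
  refine ⟨fun ν hν hM hS => eq_rllChain_of_isFirstOrderMarkov (isStationaryFamily_wordLaw hν) hM hS,
    fun π h0 h1 => ?_, fun ν hν hS => ?_, fun π hπ => entropyRate_rllChain_eq_iff hπ,
    fun ε hε => tendsto_blockCapacity hε, constrainedCapacity_zero, ?_, ?_⟩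
  · have hst := isStationaryFamily_rllChain (π := π) ⟨h0.le, h1.le⟩
    exact ⟨(fCoeff_rllChain h0 h1).1, (fCoeff_rllChain h0 h1).2, gCoeff_rllChain h0 h1,
      hst.tendsto_blockEntropy, fun ε hε => hst.tendsto_blockEntropy_output hε,
      entropyRate_output_expansion h0 h1⟩
  · have hst := isStationaryFamily_wordLaw hν
    exact ⟨hst.tendsto_blockEntropy, hst.entropyRate_le hS⟩
  · rw [one_div_goldenRatio_sq, gCoeff_rllChain (by linarith [Real.goldenRatio_lt_two])
      (by linarith [Real.one_lt_goldenRatio])]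
    refine IsBigO.of_bound 1501 ?_
    filter_upwards [capacity_upper_bound, capacity_lower_bound] with ε hu hl
    rw [one_div, Real.log_inv, Real.norm_eq_abs, Real.norm_eq_abs, ← mul_pow,
      abs_of_nonneg (sq_nonneg (ε * -Real.log ε))]
    have := sq_nonneg (ε * -Real.log ε)
    exact abs_le.2 ⟨by linarith, by linarith⟩
  · rw [one_div_goldenRatio_sq, gCoeff_rllChain (by linarith [Real.goldenRatio_lt_two])
      (by linarith [Real.one_lt_goldenRatio])]
    refine ⟨1 / 360, by norm_num, capacity_lower_bound.mono fun ε hl => ?_⟩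
    rw [one_div ε, Real.log_inv, ← mul_pow]
    exact hl
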